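/- **Setting.** Let $\mathbb K=\mathbb R$ or $\mathbb C$, $d=\dim_{\mathbb R}\mathbb K$. Let $\mathcal D=C^\infty(\mathbb T;\mathbb K)$ be the smooth functions on the torus $\mathbb T=\mathbb R/\mathbb Z$ and $\mathcal D'$ its dual, with the $\sigma$-algebra generated by the evaluations. Fix $\varepsilon\in\mathcal D'$ (the envelope) and $T\ge 0$; put $(A'\varphi)(r)=\varepsilon(\varphi(\cdot+r))$, so that $(\varepsilon*\eta)(\varphi)=\eta(A'\varphi)$ for $\eta\in\mathcal D'$. Let $z$ be a $\mathcal D'$-valued random variable (the signal). A *discretization* consists of $M,N\in\mathbb N$ and real smooth functions $\chi_1,\dots,\chi_N$ on $\mathbb T$ (e.g. a partition of unity). A vector $v\in\mathbb R^N$ (the parameters of $|\sigma|^2$) defines the covariance structure $X(v)$ of the scatterer, in one of two ways: $X(v)(\psi,\psi')=\int|\sigma|^2\psi\overline{\psi'}$ with variance function $|\sigma|^2=\sum_jv_j\chi_j$ (Itô measure), or $X(v)(\psi,\psi')=\sum_jv_j\langle\psi,\chi_j\rangle\overline{\langle\psi',\chi_j\rangle}$, where $\langle\psi,\chi\rangle=\int\psi\chi$.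 Put $K_v(\varphi,\varphi')=X(v)(A'\varphi,A'\varphi')+T\int\varphi\overline{\varphi'}$, and for $\varphi_1,\dots,\varphi_M\in\mathcal D$ let $\Sigma(v)=\big(K_v(\varphi_i,\varphi_k)\big)_{i,k\le M}$, an affine function of $v$ with values in the Hermitian matrices. A random distribution $u$ is *conditionally Gaussian on $U\subseteq\mathcal D$ with form $Q$ given* a random variable $\theta$ if $E[e^{i\,\mathrm{Re}\,u(\varphi)}\mid\theta]=e^{-Q(\varphi,\varphi)/2}$ a.s. for all $\varphi\in U$ (here $Q$ may depend on $\theta$). White noise $\xi$ has $E e^{i\,\mathrm{Re}\,\xi(\varphi)}=e^{-\|\varphi\|^2_{L^2}/2}$ for all $\varphi\in\mathcal D$. The inverse Wishart distribution $\mathcal W^{-1}(\Psi,\nu)$ ($\Psi>0$ of size $p\times p$ over $\mathbb K$, $\nu>p-1$) is the probability measure on the Hermitian $p\times p$ matrices with density proportional to $w_{\Psi,\nu}(S)=|S|^{-(d(\nu+p-1)/2+1)}e^{-\mathrm{Tr}(\Psi S^{-1})/2}$ for $S>0$ and $0$ otherwise; for $\mathbb K=\mathbb R$ the exponent of $|S|$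 is $-(\nu+p+1)/2$. For an affine map $\Sigma$ on $\mathbb R^N$ with Hermitian values and a measurable set $D\subseteq\mathbb R^N$ of admitted parameters (e.g. $[0,\infty)^N$), the *affine transform* $\mathcal A_{\Sigma,D}(\Psi,\nu)$ of $\mathcal W^{-1}(\Psi,\nu)$ is the probability law on $D$ with Lebesgue density proportional to $w_{\Psi,\nu}(\Sigma(v))$. (If $\Sigma$ is a bijection onto the Hermitian matrices and $D=\mathbb R^N$, it is the image of $\mathcal W^{-1}(\Psi,\nu)$ under $\Sigma^{-1}$.) "Posterior" means regular conditional distribution. **Theorem.** 1. *(Hierarchical model.)* Let $\theta$ be a random parameter and $v=v(\theta)$ a measurable function of it with values in $\mathbb R^N$. If $z=\varepsilon*\mu+\sqrt T\,\xi$, where given $\theta$ the scatterer $\mu$ is conditionally Gaussian on $A'U$ with form $X(v)$, and $\xi$ is white noise independent of $(\theta,\mu)$, then $z$ is conditionally Gaussian on $U$ with form $K_v$ given $\theta$. The remaining parts use only this conditional law of $z$. 2. *(Finite marginals.)* Let $v$ be random, let $z$ be conditionally Gaussian with form $K_v$ given $v$ on the span of $\varphi_1,\dots,\varphi_M$, and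 let $Y=(z(\varphi_1),\dots,z(\varphi_M))$. If the prior law of $v$ is $\mathcal A_{\Sigma,D}(\Psi,\nu)$, with $\Psi>0$ and $\nu>M-1$, then a.s. the posterior of $v$ given $Y$ is $\mathcal A_{\Sigma,D}(YY'+\Psi,\nu+1)$. If $N\ge1$ and $\Sigma$ is injective, this posterior is a.s. not Gaussian. If $D=\mathbb R^N$ and $\Sigma$ is a bijection onto the Hermitian matrices, then $\Sigma(v)$ has prior $\mathcal W^{-1}(\Psi,\nu)$ and a.s. posterior $\mathcal W^{-1}(YY'+\Psi,\nu+1)$. 3. *(Infinite-dimensional limit.)* Let $\varphi_1,\varphi_2,\dots$ span a dense subspace of $\mathcal D$. For every $n\in\mathbb N$ let a discretization with $M_n$ test functions $\varphi_1,\dots,\varphi_{M_n}$ and $N_n$ parameters be given, $M_n$ nondecreasing and $M_n\to\infty$, with $\Sigma_n$ injective, and let $|\sigma|^2$ be represented by a random family $v=(v^{(n)})_n\in\prod_n\mathbb R^{N_n}$ such that, for each $n$, $z$ is conditionally Gaussian with form $K^{(n)}_{v^{(n)}}$ given $v$ on the span of $\varphi_1,\dots,\varphi_{M_n}$. Suppose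 that for every $n$ the prior law of $v^{(n)}$ is $\mathcal A_{\Sigma_n,D_n}(\Psi_n,\nu_n)$, with $D_n$ measurable, $\Psi_n>0$ and $\nu_n>M_n-1$. Put $Y_n=(z(\varphi_1),\dots,z(\varphi_{M_n}))$ and let $\Pi_z$ be the posterior of $v$ given $z$, with level-$k$ marginal $\Pi_z^{(k)}$. Then: - for all $n$, a.s., the posterior of $v^{(n)}$ given $Y_n$ is $\mathcal A_{\Sigma_n,D_n}(Y_nY_n'+\Psi_n,\nu_n+1)$; - for all $k$ there are affine maps $R_n:\mathbb R^{N_n}\to\mathbb R^{N_k}$ with $R_nv^{(n)}=v^{(k)}$ a.s. for $n\ge k$, such that a.s. $\Pi^{(k)}_z=\lim_{n\to\infty}(R_n)_*\,\mathcal A_{\Sigma_n,D_n}(Y_nY_n'+\Psi_n,\nu_n+1)$ weakly; - for all $k$, a.s., $\Pi_z^{(k)}$ is not a Gaussian law, unless it is a point mass; - if moreover every $\Sigma_n$ is a bijection onto the Hermitian matrices and every $D_n=\mathbb R^{N_n}$, then for all $k$, a.s., $\Pi_z^{(k)}=\mathcal A_{\Sigma_k,\mathbb R^{N_k}}(Y_kY_k'+\Psi_k,\nu_k+1)$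 (the posterior is again a consistent family of the same type), and a.s. $\Pi_z$ is not Gaussian. -/

import Mathlib

open MeasureTheory ProbabilityTheory Filter Topology
open scoped Matrix

namespace Radar

/-! ## Test functions and distributions on the torus `ℝ / ℤ` -/

section Smooth

open scoped ContDiff

/-- The space `𝒟(𝕋; 𝕜)` of smooth `𝕜`-valued functions on the torus, realised as the smooth
`1`-periodic functions on the line. -/
def Test (𝕜 : Type*) [RCLike 𝕜] : Submodule 𝕜 (ℝ → 𝕜) where
  carrier := {φ | ContDiff ℝ ∞ φ ∧ Function.Periodic φ 1}
  add_mem' := fun h h' => ⟨h.1.add h'.1, h.2.add h'.2⟩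
  zero_mem' := ⟨contDiff_const, fun _ => rfl⟩
  smul_mem' := fun c φ h => ⟨contDiff_const.smul h.1, fun t => by
    have := h.2 t
    simp [this]⟩

/-- The space `𝒟'(𝕋; 𝕜)` of distributions on the torus: linear functionals on the test functions
that are continuous, that is, dominated by finitely many of the seminorms `sup |φ⁽ʲ⁾|`. -/
structure TDist (𝕜 : Type*) [RCLike 𝕜] where
  toLin : Test 𝕜 →ₗ[𝕜] 𝕜
  bound : ∃ (C : ℝ) (k : ℕ), ∀ (φ : Test 𝕜) (B : ℝ),
    (∀ j ≤ k, ∀ t : ℝ, ‖iteratedDeriv j (φ : ℝ → 𝕜) t‖ ≤ B) → ‖toLin φ‖ ≤ C * B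

instance (𝕜 : Type*) [RCLike 𝕜] : CoeFun (TDist 𝕜) (fun _ => Test 𝕜 → 𝕜) := ⟨fun u => u.toLin⟩

/-- The `σ`-algebra on `𝒟'(𝕋; 𝕜)` generated by the evaluations `u ↦ u(φ)`. -/
instance (𝕜 : Type*) [RCLike 𝕜] : MeasurableSpace (TDist 𝕜) :=
  ⨆ φ : Test 𝕜, MeasurableSpace.comap (fun u : TDist 𝕜 => u φ) inferInstance

section Convolution

variable {𝕜 : Type*} [RCLike 𝕜]

/-- The translate `t ↦ φ (t + r)`. -/
def shift (r : ℝ) (φ : Test 𝕜) : Test 𝕜 :=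
  ⟨fun t => (φ : ℝ → 𝕜) (t + r), φ.2.1.comp (contDiff_id.add contDiff_const), fun t => by
    have := φ.2.2 (t + r)
    show (φ : ℝ → 𝕜) (t + 1 + r) = (φ : ℝ → 𝕜) (t + r)
    rw [add_right_comm]
    exact this⟩

/-- The derivative of a test function. -/
noncomputable def dTest (φ : Test 𝕜) : Test 𝕜 :=
  ⟨deriv (φ : ℝ → 𝕜), (contDiff_infty_iff_deriv.1 φ.2.1).2, fun t => by
    have h : (fun x => (φ : ℝ → 𝕜) (x + 1)) = φ := funext φ.2.2
    have := deriv_comp_add_const (f := (φ : ℝ → 𝕜)) 1 t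
    rw [← this, h]⟩

theorem exists_bound (φ : Test 𝕜) : ∃ K : ℝ, ∀ t : ℝ, ‖(φ : ℝ → 𝕜) t‖ ≤ K := by
  obtain ⟨K, hK⟩ := (isCompact_Icc (a := (0 : ℝ)) (b := 1)).exists_bound_of_continuousOn
    φ.2.1.continuous.continuousOn
  refine ⟨K, fun t => ?_⟩
  obtain ⟨y, hy, h⟩ := φ.2.2.exists_mem_Ico₀ zero_lt_one t
  rw [h]
  exact hK y ⟨hy.1, hy.2.le⟩

theorem iteratedDeriv_mem (φ : Test 𝕜) (j : ℕ) : iteratedDeriv j (φ : ℝ → 𝕜) ∈ Test 𝕜 := by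
  induction j with
  | zero => simp
  | succ j ih =>
    rw [iteratedDeriv_succ]
    exact (dTest ⟨_, ih⟩).2

theorem exists_bounds (φ : Test 𝕜) (k : ℕ) :
    ∃ K : ℝ, 0 ≤ K ∧ ∀ j ≤ k, ∀ t : ℝ, ‖iteratedDeriv j (φ : ℝ → 𝕜) t‖ ≤ K := by
  choose K hK using fun j => exists_bound ⟨_, iteratedDeriv_mem φ j⟩
  refine ⟨∑ j ∈ Finset.range (k + 1), |K j|, Finset.sum_nonneg fun _ _ => abs_nonneg _,
    fun j hj t => (hK j t).trans ((le_abs_self _).trans ?_)⟩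
  exact Finset.single_le_sum (f := fun j => |K j|) (fun _ _ => abs_nonneg _)
    (Finset.mem_range.2 (by omega))

/-- Second order Taylor estimate for a smooth function with bounded second derivative. -/
theorem taylor_bound (f : ℝ → 𝕜) (hf : ContDiff ℝ ∞ f) (K : ℝ)
    (hK : ∀ t, ‖deriv (deriv f) t‖ ≤ K) (t h : ℝ) :
    ‖f (t + h) - f t - (h : 𝕜) * deriv f t‖ ≤ K * |h| * |h| := by
  have hf1 : Differentiable ℝ f := (contDiff_infty_iff_deriv.1 hf).1
  have hf' := (contDiff_infty_iff_deriv.1 hf).2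
  have hf2 : Differentiable ℝ (deriv f) := (contDiff_infty_iff_deriv.1 hf').1
  have hK0 : 0 ≤ K := (norm_nonneg _).trans (hK 0)
  have e1 : ∀ x y : ℝ, ‖deriv f y - deriv f x‖ ≤ K * ‖y - x‖ := fun x y =>
    convex_univ.norm_image_sub_le_of_norm_deriv_le (fun z _ => hf2 z) (fun z _ => hK z)
      (Set.mem_univ x) (Set.mem_univ y)
  have e2 := (convex_uIcc t (t + h)).norm_image_sub_le_of_norm_hasDerivWithin_le
    (f := fun x => f x - (x - t) • deriv f t) (f' := fun x => deriv f x - (1 : ℝ) • deriv f t)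
    (C := K * |h|)
    (fun x _ => ((hf1 x).hasDerivAt.sub
      (((hasDerivAt_id x).sub_const t).smul_const (deriv f t))).hasDerivWithinAt)
    (fun x hx => by
      rw [one_smul]
      refine (e1 t x).trans (mul_le_mul_of_nonneg_left ?_ hK0)
      have := Set.abs_sub_left_of_mem_uIcc hx
      simpa using this)
    Set.left_mem_uIcc Set.right_mem_uIcc
  simp only [add_sub_cancel_left, sub_self, zero_smul, sub_zero, Real.norm_eq_abs] at e2
  rw [RCLike.real_smul_eq_coe_mul] at e2
  calc _ = ‖f (t + h) - (h : 𝕜) * deriv f t - f t‖ := by congr 1; ring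
    _ ≤ _ := e2

theorem hasDerivAt_apply_shift (u : TDist 𝕜) (φ : Test 𝕜) (r : ℝ) :
    HasDerivAt (fun x : ℝ => u (shift x φ)) (u (shift r (dTest φ))) r := by
  obtain ⟨C, k, hC⟩ := u.bound
  obtain ⟨K, hK0, hK⟩ := exists_bounds φ (k + 2)
  have key : ∀ h : ℝ, ‖u (shift (r + h) φ) - u (shift r φ) - (h : 𝕜) * u (shift r (dTest φ))‖
      ≤ C * (K * |h| * |h|) := by
    intro h
    have e : u (shift (r + h) φ) - u (shift r φ) - (h : 𝕜) * u (shift r (dTest φ))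
        = u (shift (r + h) φ - shift r φ - (h : 𝕜) • shift r (dTest φ)) := by
      rw [map_sub, map_sub, map_smul, smul_eq_mul]
    rw [e]
    refine hC _ _ fun j hj t => ?_
    have cd : ∀ ψ : Test 𝕜, ∀ s : ℝ, ContDiffAt ℝ j (fun x => (ψ : ℝ → 𝕜) (x + s)) t :=
      fun ψ s => ((shift s ψ).2.1.of_le (by exact_mod_cast le_top)).contDiffAt
    have e1 : ((shift (r + h) φ - shift r φ - (h : 𝕜) • shift r (dTest φ) : Test 𝕜) : ℝ → 𝕜)
        = ((fun x => (φ : ℝ → 𝕜) (x + (r + h))) - (fun x => (φ : ℝ → 𝕜) (x + r)))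
          - ((h : 𝕜) • fun x => (dTest φ : ℝ → 𝕜) (x + r)) := rfl
    have c1 : ContDiffAt ℝ j ((fun x => (φ : ℝ → 𝕜) (x + (r + h))) -
        (fun x => (φ : ℝ → 𝕜) (x + r))) t := (cd φ _).sub (cd φ _)
    have c2 : ContDiffAt ℝ j ((h : 𝕜) • fun x => (dTest φ : ℝ → 𝕜) (x + r)) t :=
      contDiffAt_const.smul (cd (dTest φ) r)
    rw [e1, iteratedDeriv_sub c1 c2,
      iteratedDeriv_sub (cd φ _) (cd φ _), iteratedDeriv_const_smul (cd (dTest φ) r),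
      iteratedDeriv_comp_add_const, iteratedDeriv_comp_add_const, iteratedDeriv_comp_add_const]
    have e2 : iteratedDeriv j (dTest φ : ℝ → 𝕜) = deriv (iteratedDeriv j (φ : ℝ → 𝕜)) := by
      rw [← iteratedDeriv_succ, iteratedDeriv_succ']; rfl
    have := taylor_bound (iteratedDeriv j (φ : ℝ → 𝕜)) (iteratedDeriv_mem φ j).1 K
      (fun s => by
        rw [← iteratedDeriv_succ, ← iteratedDeriv_succ]
        exact hK (j + 2) (by omega) s) (t + r) h
    rw [e2]
    simpa [add_assoc, smul_eq_mul] using this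
  rw [hasDerivAt_iff_isLittleO_nhds_zero]
  have hO : (fun h : ℝ => u (shift (r + h) φ) - u (shift r φ) - h • u (shift r (dTest φ)))
      =O[𝓝 0] fun h : ℝ => h ^ 2 := by
    refine Asymptotics.IsBigO.of_bound (|C| * K) (Eventually.of_forall fun h => ?_)
    rw [RCLike.real_smul_eq_coe_mul]
    refine (key h).trans ?_
    have : C * (K * |h| * |h|) = C * K * |h| ^ 2 := by ring
    rw [this, norm_pow, Real.norm_eq_abs]
    gcongr
    exact le_abs_self C
  exact hO.trans_isLittleO (by simpa using Asymptotics.isLittleO_pow_id (𝕜 := ℝ) one_lt_two)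

theorem contDiff_apply_shift (u : TDist 𝕜) (φ : Test 𝕜) :
    ContDiff ℝ ∞ (fun x : ℝ => u (shift x φ)) := by
  rw [contDiff_infty]
  intro n
  induction n generalizing φ with
  | zero =>
    exact contDiff_zero.2 (continuous_iff_continuousAt.2
      fun r => (hasDerivAt_apply_shift u φ r).continuousAt)
  | succ n ih =>
    have hd : deriv (fun x : ℝ => u (shift x φ)) = fun x => u (shift x (dTest φ)) :=
      funext fun r => (hasDerivAt_apply_shift u φ r).deriv
    push_cast
    rw [contDiff_succ_iff_deriv]
    refine ⟨fun r => (hasDerivAt_apply_shift u φ r).differentiableAt, by simp, ?_⟩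
    rw [hd]
    exact ih (dTest φ)

/-- The transpose of the convolution operator `η ↦ ε * η` on `𝒟'(𝕋)`: the test function
`r ↦ ε(φ(· + r))`, formally `r ↦ ∫ ε(t - r) φ(t) dt`.  The distribution `ε * η` is
`φ ↦ η (transpose ε φ)`. -/
def transpose (ε : TDist 𝕜) (φ : Test 𝕜) : Test 𝕜 :=
  ⟨fun r => ε (shift r φ), contDiff_apply_shift ε φ, fun r => by
    have : shift (r + 1) φ = shift r φ := by
      ext t
      have := φ.2.2 (t + r)
      simpa [shift, add_assoc] using this
    simp only [this]⟩

end Convolution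

end Smooth

/-! ## Covariance structures -/

section Covariance

variable {𝕜 : Type*} [RCLike 𝕜]

/-- The `L²` inner product `∫ φ ψ̄` over the torus. -/
noncomputable def ip (φ ψ : Test 𝕜) : 𝕜 :=
  ∫ t in (0 : ℝ)..1, (φ : ℝ → 𝕜) t * (starRingEnd 𝕜) ((ψ : ℝ → 𝕜) t)

/-- The two ways in which finitely many variance parameters `v₁, …, v_N` and profiles
`χ₁, …, χ_N` give a covariance structure. -/
inductive CovKind
  /-- Itô measure whose variance function is `|σ(x)|² = ∑ⱼ vⱼ χⱼ(x)`. -/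
  | ito
  /-- Covariance operator `ψ ↦ ∑ⱼ vⱼ ⟨ψ, χⱼ⟩ χⱼ`. -/
  | smoothed

/-- A discretization of the problem: the number `M` of test functions with which the signal is
observed, the number `N` of variance parameters, and the profiles of the variance function (for
instance a smooth partition of unity on the torus). -/
structure Discretization where
  M : ℕ
  N : ℕ
  kind : CovKind
  χ : Fin N → Test ℝ

/-- The Hermitian form `X(v)` of the scatterer with variance parameters `v`:
`∫ (∑ⱼ vⱼ χⱼ) ψ ψ̄'`, or `∑ⱼ vⱼ (∫ χⱼ ψ) (∫ χⱼ ψ')⁻` (bar for the conjugate). -/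
noncomputable def scatterForm (L : Discretization) (v : Fin L.N → ℝ) (ψ ψ' : Test 𝕜) : 𝕜 :=
  match L.kind with
  | .ito => ∫ t in (0 : ℝ)..1, ((∑ j, v j * (L.χ j : ℝ → ℝ) t : ℝ) : 𝕜) *
      ((ψ : ℝ → 𝕜) t * (starRingEnd 𝕜) ((ψ' : ℝ → 𝕜) t))
  | .smoothed => ∑ j, (v j : 𝕜) *
      ((∫ t in (0 : ℝ)..1, (((L.χ j : ℝ → ℝ) t : ℝ) : 𝕜) * (ψ : ℝ → 𝕜) t) *
        (starRingEnd 𝕜) (∫ t in (0 : ℝ)..1, (((L.χ j : ℝ → ℝ) t : ℝ) : 𝕜) * (ψ' : ℝ → 𝕜) t))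

/-- The Hermitian form `A X(v) A' + T` of the signal `z = ε * μ + √T ξ`, where `A η = ε * η`. -/
noncomputable def signalForm (ε : TDist 𝕜) (T : ℝ) (L : Discretization) (v : Fin L.N → ℝ)
    (φ φ' : Test 𝕜) : 𝕜 :=
  scatterForm L v (transpose ε φ) (transpose ε φ') + (T : 𝕜) * ip φ φ'

/-- The covariance matrix `Σ(v)` of `(z(φ₁), …, z(φ_M))`, an affine function of `v`. -/
noncomputable def sigmaMat (ε : TDist 𝕜) (T : ℝ) (L : Discretization) (φ : Fin L.M → Test 𝕜)
    (v : Fin L.N → ℝ) : Matrix (Fin L.M) (Fin L.M) 𝕜 :=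
  Matrix.of fun i k => signalForm ε T L v (φ i) (φ k)

end Covariance

/-! ## The hierarchical model -/

section Model

variable {𝕜 : Type*} [RCLike 𝕜] {Ω : Type*} [MeasurableSpace Ω]

/-- Given `θ`, the random distribution `u` is centered Gaussian on the test functions in `U`, with
covariance form `Q`: the conditional characteristic functional is
`E[exp(i Re u(φ)) | θ] = exp(-Q(φ, φ) / 2)`. -/
def CondGaussian (P : Measure Ω) {Θ : Type*} [MeasurableSpace Θ] (θ : Ω → Θ) (u : Ω → TDist 𝕜)
    (Q : Ω → Test 𝕜 → Test 𝕜 → 𝕜) (U : Set (Test 𝕜)) : Prop :=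
  ∀ φ ∈ U,
    P[fun ω => Complex.exp (Complex.I * ((RCLike.re (u ω φ) : ℝ) : ℂ)) |
        MeasurableSpace.comap θ inferInstance]
      =ᵐ[P] fun ω => Complex.exp (((-(RCLike.re (Q ω φ φ)) / 2 : ℝ) : ℂ))

/-- `ξ` is Gaussian white noise: `E exp(i Re ξ(φ)) = exp(-‖φ‖² / 2)`. -/
def IsWhiteNoise (P : Measure Ω) (ξ : Ω → TDist 𝕜) : Prop :=
  ∀ φ : Test 𝕜, ∫ ω, Complex.exp (Complex.I * ((RCLike.re (ξ ω φ) : ℝ) : ℂ)) ∂P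
    = Complex.exp (((-(RCLike.re (ip φ φ)) / 2 : ℝ) : ℂ))

/-- The hierarchical model `z = ε * μ + √T ξ`: given the parameters `θ`, the scatterer `μ` is
centered Gaussian with covariance structure `X(v(θ))` (on the test functions `A'φ`, `φ ∈ U`), and
`ξ` is white noise independent of `(θ, μ)`. -/
structure IsHierarchical (P : Measure Ω) {Θ : Type*} [MeasurableSpace Θ] (θ : Ω → Θ)
    (ε : TDist 𝕜) (T : ℝ) (L : Discretization) (v : Θ → Fin L.N → ℝ) (U : Set (Test 𝕜))
    (μ ξ z : Ω → TDist 𝕜) : Prop where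
  measurable_scatterer : Measurable μ
  measurable_noise : Measurable ξ
  scatterer : CondGaussian P θ μ (fun ω => scatterForm L (v (θ ω))) (transpose ε '' U)
  noise : IsWhiteNoise P ξ
  indep : IndepFun ξ (fun ω => (θ ω, μ ω)) P
  signal : ∀ᵐ ω ∂P, ∀ φ : Test 𝕜, z ω φ = μ ω (transpose ε φ) + ((√T : ℝ) : 𝕜) * ξ ω φ

/-- The finite-dimensional marginal `(z(φ₁), …, z(φ_M))` of the signal. -/
def obs {M : ℕ} (z : Ω → TDist 𝕜) (φ : Fin M → Test 𝕜) : Ω → Fin M → 𝕜 :=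
  fun ω i => z ω (φ i)

end Model

/-! ## Inverse Wishart distributions -/

section Wishart

open scoped ComplexOrder

variable {𝕜 : Type*} [RCLike 𝕜]

open Classical in
/-- The unnormalized density of the inverse Wishart distribution with scale matrix `Ψ` and `ν`
degrees of freedom on the positive definite `p × p` matrices over `𝕜`:
`|S|^{-(ν+p+1)/2} exp(-Tr(Ψ S⁻¹)/2)` for `𝕜 = ℝ` and `|S|^{-(ν+p)} exp(-Tr(Ψ S⁻¹)/2)` for
`𝕜 = ℂ`. -/
noncomputable def iwKernel {p : ℕ} (Ψ : Matrix (Fin p) (Fin p) 𝕜) (ν : ℝ)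
    (S : Matrix (Fin p) (Fin p) 𝕜) : ℝ :=
  if S.PosDef then
    (RCLike.re S.det) ^ (-((Module.finrank ℝ 𝕜 : ℝ) * (ν + p - 1) / 2 + 1)) *
      Real.exp (-(RCLike.re (Ψ * S⁻¹).trace) / 2)
  else 0

/-- The measure divided by its total mass (meaningful if that mass is positive and finite). -/
noncomputable def normalized {E : Type*} [MeasurableSpace E] (m : Measure E) : Measure E :=
  (m Set.univ)⁻¹ • m

/-- The affine transform of the inverse Wishart distribution `𝒲⁻¹(Ψ, ν)` along `S`: the law of a
parameter vector `v ∈ D` whose Lebesgue density is proportional to the inverse Wishart density at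
the matrix `S v`.  If `S` is an affine bijection onto the Hermitian matrices and `D` is everything,
it is the image of `𝒲⁻¹(Ψ, ν)` under the inverse of `S`. -/
noncomputable def affineIW {p N : ℕ} (S : (Fin N → ℝ) → Matrix (Fin p) (Fin p) 𝕜)
    (D : Set (Fin N → ℝ)) (Ψ : Matrix (Fin p) (Fin p) 𝕜) (ν : ℝ) : Measure (Fin N → ℝ) :=
  normalized ((volume.restrict D).withDensity fun v => ENNReal.ofReal (iwKernel Ψ ν (S v)))

/-- The real vector space of Hermitian matrices. -/
noncomputable abbrev Herm (𝕜 : Type*) [RCLike 𝕜] (p : ℕ) : Submodule ℝ (Matrix (Fin p) (Fin p) 𝕜) :=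
  selfAdjoint.submodule ℝ (Matrix (Fin p) (Fin p) 𝕜)

/-- The entrywise Borel `σ`-algebra on matrices. -/
instance matrixMeasurableSpace (𝕜 : Type*) [RCLike 𝕜] (p : ℕ) :
    MeasurableSpace (Matrix (Fin p) (Fin p) 𝕜) :=
  inferInstanceAs (MeasurableSpace (Fin p → Fin p → 𝕜))

/-- Linear coordinates on the Hermitian matrices. -/
noncomputable def hermCoord (𝕜 : Type*) [RCLike 𝕜] (p : ℕ)
    (c : Fin (Module.finrank ℝ (Herm 𝕜 p)) → ℝ) : Matrix (Fin p) (Fin p) 𝕜 :=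
  ((Module.finBasis ℝ (Herm 𝕜 p)).equivFun.symm c : Herm 𝕜 p)

/-- The inverse Wishart distribution `𝒲⁻¹(Ψ, ν)`: the probability measure on the Hermitian matrices
whose density with respect to Lebesgue measure is proportional to `iwKernel Ψ ν` (the choice of
linear coordinates does not matter after normalization). -/
noncomputable def invWishart {p : ℕ} (Ψ : Matrix (Fin p) (Fin p) 𝕜) (ν : ℝ) :
    Measure (Matrix (Fin p) (Fin p) 𝕜) :=
  (affineIW (hermCoord 𝕜 p) Set.univ Ψ ν).map (hermCoord 𝕜 p)

/-- The outer product `y y'`. -/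
noncomputable def outer {p : ℕ} (y : Fin p → 𝕜) : Matrix (Fin p) (Fin p) 𝕜 := Matrix.vecMulVec y (star y)

/-- The parameters of an inverse Wishart distribution are admissible. -/
def Admissible {p : ℕ} (Ψ : Matrix (Fin p) (Fin p) 𝕜) (ν : ℝ) : Prop :=
  Ψ.PosDef ∧ (p : ℝ) - 1 < ν

end Wishart

/-- The test functions `φ` span a dense subspace of `𝒟(𝕋; 𝕜)`. -/
def Total {𝕜 : Type*} [RCLike 𝕜] (φ : ℕ → Test 𝕜) : Prop :=
  ∀ (ψ : Test 𝕜) (k : ℕ) (δ : ℝ), 0 < δ → ∃ η ∈ Submodule.span 𝕜 (Set.range φ),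
    ∀ j ≤ k, ∀ t : ℝ, ‖iteratedDeriv j ((ψ - η : Test 𝕜) : ℝ → 𝕜) t‖ ≤ δ

end Radar

open Radar

namespace Radar

/-! ### Sesquilinearity of the covariance forms; the covariance matrix as an affine map. -/

section SignalForm

variable {𝕜 : Type*} [RCLike 𝕜]

/-! The finite-dimensional statement is conjugacy. A centered Gaussian vector on `𝕜ᴹ` with
covariance `S > 0` has density proportional to `|S|^(-d/2) exp(-Tr(yy' S⁻¹)/2)`. Multiplying the
inverse Wishart kernel by this only replaces `Ψ` by `yy' + Ψ` and `ν` by `ν + 1`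
(`iwKernel_mul_gaussDensity`). The identity is pointwise in `S`, so it survives restriction to any
affine family `S = Σ(v)` with `v` in `D`. Characteristic functions identify the joint law of
parameters and observations (`map_prodMk_eq_compProd_gaussKernel`), and Bayes' formula
(`condDistrib_of_joint_density`) gives the posterior.

Non-Gaussianity comes from positivity. Almost surely `Σ(v) > 0`, so every quadratic value `w Σ(v)
w̄`, an affine function of `v`, is bounded below. A real Gaussian variable bounded below is
constant, so a Gaussian law carried by this set is a point mass if `Σ` is injective
(`isGaussian_eq_dirac_of_posDef`). A Lebesgue density excludes the point mass at finite levels; a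
posterior given the whole signal need not have a density.

For the limit, the observations at all levels generate the σ-algebra of `z`, because their test
functions are total and distributions are continuous (`comap_eq_iSup_comap_obs`). Lévy's upward
theorem then gives weak convergence of the laws of the level-`k` parameters given `Y_n`
(`ae_tendsto_integral_condDistrib`). Two levels describe the same conditional law of `z`, so the
coarse covariance matrix is the leading block of the fine one (`ae_sigmaMat_eq_submatrix`).
Injectivity of the coarse map turns this into an affine map between parameters.

In the bijective case, the Schur complement splits the fine kernel into a function of the leading
block and a factor that integrates to a constant (`iwFun_fromBlocks`, `lintegral_iwFun_fromBlocks`).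
Hence the fine posterior of the leading block depends on `Y_n` only through `Y_k`
(`exists_kernel_map_affineIW`), so it is the posterior given `Y_k`. The sequence of level-`k`
posteriors is constant for `n ≥ k`, and so equals its limit. Normalization removes all constant
factors, so none of them has to be computed. -/

theorem continuous_test (φ : Test 𝕜) : Continuous (φ : ℝ → 𝕜) := φ.2.1.continuous

/-- The transpose of the convolution operator as a linear map. -/
def transposeLin (ε : TDist 𝕜) : Test 𝕜 →ₗ[𝕜] Test 𝕜 where
  toFun := transpose ε
  map_add' φ ψ := by
    ext r
    exact ε.toLin.map_add (shift r φ) (shift r ψ)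
  map_smul' c φ := by
    ext r
    exact ε.toLin.map_smul c (shift r φ)

theorem ip_add_left (φ φ' ψ : Test 𝕜) : ip (φ + φ') ψ = ip φ ψ + ip φ' ψ := by
  have h : ∀ φ : Test 𝕜, IntervalIntegrable
      (fun t => (φ : ℝ → 𝕜) t * (starRingEnd 𝕜) ((ψ : ℝ → 𝕜) t)) volume 0 1 := fun φ =>
    ((continuous_test φ).mul
      (RCLike.continuous_conj.comp (continuous_test ψ))).intervalIntegrable _ _
  simp only [ip]
  rw [← intervalIntegral.integral_add (h φ) (h φ')]
  simp [add_mul]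

theorem ip_smul_left (c : 𝕜) (φ ψ : Test 𝕜) : ip (c • φ) ψ = c * ip φ ψ := by
  simp [ip, mul_assoc]

theorem intervalIntegral_conj (f : ℝ → 𝕜) (a b : ℝ) :
    ∫ t in a..b, (starRingEnd 𝕜) (f t) = (starRingEnd 𝕜) (∫ t in a..b, f t) := by
  simp [intervalIntegral, integral_conj]

theorem ip_conj (φ ψ : Test 𝕜) : (starRingEnd 𝕜) (ip φ ψ) = ip ψ φ := by
  simp only [ip]
  rw [← intervalIntegral_conj]
  simp [mul_comm]

theorem scatterForm_add_left (L : Discretization) (v : Fin L.N → ℝ) (φ φ' ψ : Test 𝕜) :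
    scatterForm L v (φ + φ') ψ = scatterForm L v φ ψ + scatterForm L v φ' ψ := by
  have hχ : ∀ j, Continuous fun t => (((L.χ j : ℝ → ℝ) t : ℝ) : 𝕜) := fun j =>
    RCLike.continuous_ofReal.comp (continuous_test (L.χ j))
  unfold scatterForm
  split
  · have h : ∀ φ : Test 𝕜, IntervalIntegrable
        (fun t => ((∑ j, v j * (L.χ j : ℝ → ℝ) t : ℝ) : 𝕜) *
          ((φ : ℝ → 𝕜) t * (starRingEnd 𝕜) ((ψ : ℝ → 𝕜) t))) volume 0 1 := fun φ => by
      refine Continuous.intervalIntegrable (Continuous.mul ?_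
        ((continuous_test φ).mul (RCLike.continuous_conj.comp (continuous_test ψ)))) _ _
      push_cast
      exact continuous_finsetSum _ fun j _ => continuous_const.mul (hχ j)
    rw [← intervalIntegral.integral_add (h φ) (h φ')]
    simp [add_mul, mul_add]
  · rw [← Finset.sum_add_distrib]
    refine Finset.sum_congr rfl fun j _ => ?_
    have h : ∀ φ : Test 𝕜, IntervalIntegrable
        (fun t => (((L.χ j : ℝ → ℝ) t : ℝ) : 𝕜) * (φ : ℝ → 𝕜) t) volume 0 1 := fun φ =>
      ((hχ j).mul (continuous_test φ)).intervalIntegrable _ _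
    have e : ∫ t in (0 : ℝ)..1, (((L.χ j : ℝ → ℝ) t : ℝ) : 𝕜) * ((φ + φ' : Test 𝕜) : ℝ → 𝕜) t
        = (∫ t in (0 : ℝ)..1, (((L.χ j : ℝ → ℝ) t : ℝ) : 𝕜) * (φ : ℝ → 𝕜) t)
          + ∫ t in (0 : ℝ)..1, (((L.χ j : ℝ → ℝ) t : ℝ) : 𝕜) * (φ' : ℝ → 𝕜) t := by
      rw [← intervalIntegral.integral_add (h φ) (h φ')]
      simp [mul_add]
    rw [e]
    ring

theorem scatterForm_smul_left (L : Discretization) (v : Fin L.N → ℝ) (c : 𝕜) (φ ψ : Test 𝕜) :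
    scatterForm L v (c • φ) ψ = c * scatterForm L v φ ψ := by
  unfold scatterForm
  split
  · rw [← intervalIntegral.integral_const_mul]
    congr 1
    ext t
    simp only [Submodule.coe_smul, Pi.smul_apply, smul_eq_mul]
    ring
  · rw [Finset.mul_sum]
    refine Finset.sum_congr rfl fun j _ => ?_
    have e : ∫ t in (0 : ℝ)..1, (((L.χ j : ℝ → ℝ) t : ℝ) : 𝕜) * ((c • φ : Test 𝕜) : ℝ → 𝕜) t
        = c * ∫ t in (0 : ℝ)..1, (((L.χ j : ℝ → ℝ) t : ℝ) : 𝕜) * (φ : ℝ → 𝕜) t := by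
      rw [← intervalIntegral.integral_const_mul]
      congr 1
      ext t
      simp only [Submodule.coe_smul, Pi.smul_apply, smul_eq_mul]
      ring
    rw [e]
    ring

theorem scatterForm_conj (L : Discretization) (v : Fin L.N → ℝ) (φ ψ : Test 𝕜) :
    (starRingEnd 𝕜) (scatterForm L v φ ψ) = scatterForm L v ψ φ := by
  unfold scatterForm
  split
  · rw [← intervalIntegral_conj]
    simp only [map_mul, RCLike.conj_ofReal, RCLike.conj_conj]
    congr 1
    ext t
    ring
  · rw [map_sum]
    refine Finset.sum_congr rfl fun j _ => ?_
    simp only [map_mul, RCLike.conj_ofReal, RCLike.conj_conj]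
    ring

/-- Both covariance structures are linear in `v`; the expansion over unit vectors supplies the
linear part of `sigmaAff`. -/
theorem scatterForm_eq_sum (L : Discretization) (v : Fin L.N → ℝ) (φ ψ : Test 𝕜) :
    scatterForm L v φ ψ = ∑ j, v j • scatterForm L (Pi.single j 1) φ ψ := by
  unfold scatterForm
  split
  · simp only [RCLike.real_smul_eq_coe_mul, ← intervalIntegral.integral_const_mul]
    rw [← intervalIntegral.integral_finsetSum]
    · congr 1
      ext t
      push_cast
      rw [Finset.sum_mul]
      refine Finset.sum_congr rfl fun j _ => ?_
      simp [Pi.single_apply, mul_assoc]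
    · intro j _
      refine Continuous.intervalIntegrable (continuous_const.mul (Continuous.mul ?_
        ((continuous_test φ).mul (RCLike.continuous_conj.comp (continuous_test ψ))))) _ _
      refine RCLike.continuous_ofReal.comp (continuous_finsetSum _ fun i _ => ?_)
      exact continuous_const.mul (continuous_test (L.χ i))
  · refine Finset.sum_congr rfl fun j _ => ?_
    rw [Finset.sum_eq_single j]
    · simp [RCLike.real_smul_eq_coe_mul]
    · intro i _ hi
      simp [hi]
    · simp

variable (ε : TDist 𝕜) (T : ℝ) (L : Discretization)

theorem signalForm_conj (v : Fin L.N → ℝ) (φ ψ : Test 𝕜) :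
    (starRingEnd 𝕜) (signalForm ε T L v φ ψ) = signalForm ε T L v ψ φ := by
  simp [signalForm, scatterForm_conj, ip_conj]

/-- The signal form as a linear map of its first argument. -/
noncomputable def signalFormLin (v : Fin L.N → ℝ) (ψ : Test 𝕜) : Test 𝕜 →ₗ[𝕜] 𝕜 where
  toFun φ := signalForm ε T L v φ ψ
  map_add' φ φ' := by
    have : transpose ε (φ + φ') = transpose ε φ + transpose ε φ' := (transposeLin ε).map_add φ φ'
    simp only [signalForm, this, scatterForm_add_left, ip_add_left]
    ring
  map_smul' c φ := by
    have : transpose ε (c • φ) = c • transpose ε φ := (transposeLin ε).map_smul c φ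
    simp only [signalForm, this, scatterForm_smul_left, ip_smul_left, RingHom.id_apply, smul_eq_mul]
    ring

theorem signalForm_sum_sum (v : Fin L.N → ℝ) {ι : Type*} [Fintype ι] (φ : ι → Test 𝕜) (w : ι → 𝕜) :
    signalForm ε T L v (∑ i, w i • φ i) (∑ i, w i • φ i)
      = ∑ i, ∑ k, w i * (starRingEnd 𝕜) (w k) * signalForm ε T L v (φ i) (φ k) := by
  have h1 : ∀ ψ, signalForm ε T L v (∑ i, w i • φ i) ψ
      = ∑ i, w i * signalForm ε T L v (φ i) ψ := fun ψ => by
    refine (map_sum (signalFormLin ε T L v ψ) (fun i => w i • φ i) Finset.univ).trans ?_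
    exact Finset.sum_congr rfl fun i _ => (signalFormLin ε T L v ψ).map_smul (w i) (φ i)
  rw [h1]
  refine Finset.sum_congr rfl fun i _ => ?_
  rw [← signalForm_conj, h1, map_sum, Finset.mul_sum]
  refine Finset.sum_congr rfl fun k _ => ?_
  rw [map_mul, signalForm_conj]
  ring

/-- The covariance matrix as an affine map of the variance parameters. -/
noncomputable def sigmaAff (φ : Fin L.M → Test 𝕜) :
    (Fin L.N → ℝ) →ᵃ[ℝ] Matrix (Fin L.M) (Fin L.M) 𝕜 :=
  (∑ j, (LinearMap.proj (R := ℝ) (φ := fun _ : Fin L.N => ℝ) j).smulRight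
      (Matrix.of fun i k => scatterForm L (Pi.single j 1)
        (transpose ε (φ i)) (transpose ε (φ k)))).toAffineMap +
    AffineMap.const ℝ _ (Matrix.of fun i k => (T : 𝕜) * ip (φ i) (φ k))

theorem coe_sigmaAff (φ : Fin L.M → Test 𝕜) : ⇑(sigmaAff ε T L φ) = sigmaMat ε T L φ := by
  ext v i k
  simp only [sigmaMat, signalForm, Matrix.of_apply]
  rw [scatterForm_eq_sum]
  simp [sigmaAff, Matrix.sum_apply]

theorem isHermitian_sigmaMat (φ : Fin L.M → Test 𝕜) (v : Fin L.N → ℝ) :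
    (sigmaMat ε T L φ v).IsHermitian := by
  ext i k
  exact signalForm_conj ε T L v (φ k) (φ i)

/-- Evaluating `z` at `∑ wᵢ φᵢ` gives `w ⬝ᵥ Y`, so this converts the conditional characteristic
functional of `z` into the characteristic function of `Y`. The form is conjugate-linear in its
second argument, whence `star w` on the right. -/
theorem signalForm_span (φ : Fin L.M → Test 𝕜) (v : Fin L.N → ℝ) (w : Fin L.M → 𝕜) :
    signalForm ε T L v (∑ i, w i • φ i) (∑ i, w i • φ i)
      = w ⬝ᵥ (sigmaMat ε T L φ v *ᵥ star w) := by
  rw [signalForm_sum_sum]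
  simp only [dotProduct, Matrix.mulVec, sigmaMat, Matrix.of_apply, Finset.mul_sum, Pi.star_apply,
    RCLike.star_def]
  refine Finset.sum_congr rfl fun i _ => Finset.sum_congr rfl fun k _ => ?_
  ring

end SignalForm

/-! ### Gaussian densities over `ℝ` and `ℂ`, and conjugacy. -/

section GaussianDensity

open scoped ComplexOrder

variable {𝕜 : Type*} [RCLike 𝕜]

/-- Conjugation preserves the algebra norm, so its square at `a` is its value at the real scalar
`‖a‖²`. This yields the real Jacobian of a `𝕜`-linear map, treating `ℝ` and `ℂ` together. -/
theorem abs_algebraNorm (a : 𝕜) : |Algebra.norm ℝ a| = ‖a‖ ^ Module.finrank ℝ 𝕜 := by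
  have h1 : Algebra.norm ℝ ((starRingEnd 𝕜) a) = Algebra.norm ℝ a :=
    Algebra.norm_eq_of_algEquiv (RCLike.conjAe (K := 𝕜)) a
  have h2 : Algebra.norm ℝ a * Algebra.norm ℝ a = (‖a‖ ^ 2) ^ Module.finrank ℝ 𝕜 := by
    nth_rewrite 2 [← h1]
    rw [← map_mul, RCLike.mul_conj, ← Algebra.norm_algebraMap]
    simp
  rw [← abs_of_nonneg (pow_nonneg (norm_nonneg a) _), ← sq_eq_sq_iff_abs_eq_abs, sq, h2, ← pow_mul,
    ← pow_mul, mul_comm]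

/-- The Lebesgue measure on `𝕜ᴹ`. -/
noncomputable def refMeasure (𝕜 : Type*) [RCLike 𝕜] (M : ℕ) : Measure (Fin M → 𝕜) :=
  (volume : Measure (EuclideanSpace 𝕜 (Fin M))).map
    (PiLp.continuousLinearEquiv 2 ℝ (fun _ : Fin M => 𝕜))

instance (M : ℕ) : (refMeasure 𝕜 M).IsAddHaarMeasure :=
  ContinuousLinearEquiv.isAddHaarMeasure_map _ _

/-- The total mass of the unnormalized standard Gaussian density on `𝕜ᴹ`. -/
noncomputable def gaussConst (𝕜 : Type*) [RCLike 𝕜] (M : ℕ) : ℝ :=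
  (2 * Real.pi) ^ ((Module.finrank ℝ (EuclideanSpace 𝕜 (Fin M)) : ℝ) / 2)

theorem gaussConst_pos (M : ℕ) : 0 < gaussConst 𝕜 M := Real.rpow_pos_of_pos (by positivity) _

theorem integral_standard_gaussian {M : ℕ} (a : Fin M → 𝕜) :
    ∫ x, ((Real.exp (-(∑ i, ‖x i‖ ^ 2) / 2) : ℝ) : ℂ) *
        Complex.exp (Complex.I * ((RCLike.re (a ⬝ᵥ x) : ℝ) : ℂ)) ∂(refMeasure 𝕜 M)
      = gaussConst 𝕜 M * Complex.exp (((-(∑ i, ‖a i‖ ^ 2) / 2 : ℝ) : ℂ)) := by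
  let e := PiLp.continuousLinearEquiv 2 ℝ (fun _ : Fin M => 𝕜)
  have he : MeasurableEmbedding e := e.toHomeomorph.measurableEmbedding
  refine (he.integral_map _).trans ?_
  -- The frequency is `star a` because the real inner product of `star a` and `x` is `Re (a ⬝ᵥ x)`.
  have h := GaussianFourier.integral_cexp_neg_mul_sq_norm_add (V := EuclideanSpace 𝕜 (Fin M)) (b := 1 / 2)
    (by norm_num) Complex.I (WithLp.toLp 2 (star a))
  have h1 : ((Real.pi : ℂ) / (1 / 2)) ^ ((Module.finrank ℝ (EuclideanSpace 𝕜 (Fin M)) : ℂ) / 2)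
      = gaussConst 𝕜 M := by
    rw [gaussConst, Complex.ofReal_cpow (by positivity)]
    push_cast
    congr 1
    ring
  rw [h1] at h
  convert h using 1
  · congr 1
    ext x
    rw [Complex.ofReal_exp, ← Complex.exp_add]
    congr 1
    congr 1
    · have : (‖x‖ : ℂ) ^ 2 = ((∑ i, ‖x i‖ ^ 2 : ℝ) : ℂ) := by
        rw [← Complex.ofReal_pow, EuclideanSpace.norm_sq_eq]
      rw [this]
      push_cast
      simp [e]
      ring
    · congr 2
      rw [PiLp.inner_apply]
      simp [e, dotProduct, RCLike.inner_apply, real_inner_eq_re_inner 𝕜]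
      simp only [mul_comm]
  · congr 2
    rw [← Complex.ofReal_pow, EuclideanSpace.norm_sq_eq]
    push_cast
    simp [Complex.I_sq]
    ring

/-- The centered Gaussian density on `𝕜ᴹ` with covariance `S`, up to the factor `gaussConst`. -/
noncomputable def gaussDensity {M : ℕ} (S : Matrix (Fin M) (Fin M) 𝕜) (y : Fin M → 𝕜) : ℝ :=
  (RCLike.re S.det) ^ (-(Module.finrank ℝ 𝕜 : ℝ) / 2) *
    Real.exp (-(RCLike.re (outer y * S⁻¹).trace) / 2)

theorem continuous_gaussDensity {M : ℕ} (S : Matrix (Fin M) (Fin M) 𝕜) :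
    Continuous (gaussDensity S) := by
  unfold gaussDensity outer
  refine continuous_const.mul (Real.continuous_exp.comp (Continuous.div_const (Continuous.neg
    (RCLike.continuous_re.comp (Continuous.matrix_trace ?_))) _))
  exact (Continuous.matrix_vecMulVec continuous_id continuous_star).mul continuous_const

/-- Conjugacy: the traces add, and lowering the exponent of the determinant by `d/2` is raising `ν`
by one. Off the positive definite cone both kernels vanish. -/
theorem iwKernel_mul_gaussDensity {M : ℕ} (Ψ S : Matrix (Fin M) (Fin M) 𝕜) (ν : ℝ)
    (y : Fin M → 𝕜) :
    iwKernel Ψ ν S * gaussDensity S y = iwKernel (outer y + Ψ) (ν + 1) S := by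
  unfold iwKernel gaussDensity
  split_ifs with h
  · have hd : 0 < RCLike.re S.det := (RCLike.pos_iff.1 h.det_pos).1
    rw [mul_mul_mul_comm, ← Real.rpow_add hd, ← Real.exp_add, add_mul, Matrix.trace_add, map_add]
    congr 2 <;> ring
  · simp

theorem exists_eq_mul_conjTranspose {M : ℕ} {S : Matrix (Fin M) (Fin M) 𝕜} (hS : S.PosDef) :
    ∃ C : Matrix (Fin M) (Fin M) 𝕜, C.det ≠ 0 ∧ S = C * Cᴴ := by
  open scoped MatrixOrder in
  obtain ⟨B, hB⟩ := CStarAlgebra.nonneg_iff_eq_star_mul_self.mp hS.posSemidef.nonneg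
  refine ⟨Bᴴ, fun h => ?_, by simpa [Matrix.star_eq_conjTranspose] using hB⟩
  have := hS.det_pos
  rw [hB, Matrix.star_eq_conjTranspose, Matrix.det_mul, h, zero_mul] at this
  exact lt_irrefl _ this

/-- Write `S = C Cᴴ` and substitute `y = C x`. The Jacobian `|det C|^d` cancels the factor
`|S|^(-d/2)`, which leaves the standard Gaussian integral at the frequency `w ᵥ* C`. -/
theorem integral_gaussDensity_mul_cexp {M : ℕ} {S : Matrix (Fin M) (Fin M) 𝕜} (hS : S.PosDef)
    (w : Fin M → 𝕜) :
    ∫ y, (gaussDensity S y : ℂ) * Complex.exp (Complex.I * ((RCLike.re (w ⬝ᵥ y) : ℝ) : ℂ))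
        ∂(refMeasure 𝕜 M)
      = gaussConst 𝕜 M * Complex.exp (((-(RCLike.re (w ⬝ᵥ (S *ᵥ star w))) / 2 : ℝ) : ℂ)) := by
  obtain ⟨C, hC, rfl⟩ := exists_eq_mul_conjTranspose hS
  set f : (Fin M → 𝕜) →ₗ[ℝ] (Fin M → 𝕜) := (Matrix.toLin' C).restrictScalars ℝ with hf
  have hdet : |LinearMap.det f| = ‖C.det‖ ^ Module.finrank ℝ 𝕜 := by
    rw [hf, LinearMap.det_restrictScalars, LinearMap.det_toLin', abs_algebraNorm]
  have hpos : 0 < ‖C.det‖ ^ Module.finrank ℝ 𝕜 := pow_pos (norm_pos_iff.2 hC) _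
  have hdet0 : LinearMap.det f ≠ 0 := by
    rw [← abs_pos, hdet]; exact hpos
  have hfc : Continuous f := LinearMap.continuous_of_finiteDimensional f
  have hmap := Measure.map_linearMap_addHaar_eq_smul_addHaar (refMeasure 𝕜 M) hdet0
  have hdS : RCLike.re (C * Cᴴ).det = ‖C.det‖ ^ 2 := by
    rw [Matrix.det_mul, Matrix.det_conjTranspose, RCLike.star_def, RCLike.mul_conj]
    norm_cast
  have hCu : IsUnit C.det := isUnit_iff_ne_zero.2 hC
  have key : ∀ x, gaussDensity (C * Cᴴ) (f x)
      = (‖C.det‖ ^ Module.finrank ℝ 𝕜)⁻¹ * Real.exp (-(∑ i, ‖x i‖ ^ 2) / 2) := by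
    intro x
    have e1 : outer (f x) = C * outer x * Cᴴ := by
      rw [outer, outer, Matrix.mul_vecMulVec, Matrix.vecMulVec_mul]
      simp [hf, Matrix.star_mulVec]
    have e2 : (outer (f x) * (C * Cᴴ)⁻¹).trace = (outer x).trace := by
      rw [e1, Matrix.mul_inv_rev]
      have : C * outer x * Cᴴ * ((Cᴴ)⁻¹ * C⁻¹) = C * outer x * (Cᴴ * (Cᴴ)⁻¹) * C⁻¹ := by
        simp only [Matrix.mul_assoc]
      rw [this, Matrix.mul_nonsing_inv _ (by simpa [Matrix.det_conjTranspose] using hC),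
        Matrix.mul_one, Matrix.trace_mul_comm, ← Matrix.mul_assoc, Matrix.nonsing_inv_mul _ hCu,
        Matrix.one_mul]
    have e3 : RCLike.re (outer x).trace = ∑ i, ‖x i‖ ^ 2 := by
      simp only [outer, Matrix.trace, Matrix.diag, Matrix.vecMulVec_apply, Pi.star_apply,
        RCLike.star_def, RCLike.mul_conj, map_sum]
      norm_cast
    rw [gaussDensity, e2, e3, hdS]
    congr 1
    rw [← Real.rpow_natCast, ← Real.rpow_mul (norm_nonneg _), ← Real.rpow_natCast,
      ← Real.rpow_neg (norm_nonneg _)]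
    congr 1
    push_cast
    ring
  have hcont : Continuous fun y => (gaussDensity (C * Cᴴ) y : ℂ) *
      Complex.exp (Complex.I * ((RCLike.re (w ⬝ᵥ y) : ℝ) : ℂ)) := by
    refine (Complex.continuous_ofReal.comp (continuous_gaussDensity _)).mul
      (Complex.continuous_exp.comp (continuous_const.mul (Complex.continuous_ofReal.comp
        (RCLike.continuous_re.comp ?_))))
    exact Continuous.dotProduct continuous_const continuous_id
  have h1 := integral_map (μ := refMeasure 𝕜 M) hfc.aemeasurable hcont.aestronglyMeasurable
  rw [hmap, integral_smul_measure] at h1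
  have h2 : ∀ x, (gaussDensity (C * Cᴴ) (f x) : ℂ) *
      Complex.exp (Complex.I * ((RCLike.re (w ⬝ᵥ f x) : ℝ) : ℂ))
      = ((‖C.det‖ ^ Module.finrank ℝ 𝕜)⁻¹ : ℝ) • (((Real.exp (-(∑ i, ‖x i‖ ^ 2) / 2) : ℝ) : ℂ) *
        Complex.exp (Complex.I * ((RCLike.re ((w ᵥ* C) ⬝ᵥ x) : ℝ) : ℂ))) := by
    intro x
    rw [key, ← Matrix.dotProduct_mulVec]
    simp only [hf, LinearMap.coe_restrictScalars, Matrix.toLin'_apply, Complex.real_smul]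
    push_cast
    ring
  simp only [h2] at h1
  rw [integral_smul, integral_standard_gaussian, abs_inv, hdet, ENNReal.toReal_ofReal (by positivity)]
    at h1
  -- Both sides of `h1` carry the same factor: the scaling of the image measure on one, the
  -- determinant in the density on the other.
  have h3 := smul_right_injective ℂ (inv_ne_zero hpos.ne') h1
  refine h3.trans ?_
  congr 4
  rw [← Matrix.mulVec_mulVec, Matrix.dotProduct_mulVec, ← Matrix.star_vecMul]
  simp only [dotProduct, Pi.star_apply, RCLike.star_def, RCLike.mul_conj, map_sum]
  norm_cast

theorem gaussDensity_nonneg {M : ℕ} {S : Matrix (Fin M) (Fin M) 𝕜} (hS : S.PosDef)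
    (y : Fin M → 𝕜) : 0 ≤ gaussDensity S y := by
  have hd : 0 < RCLike.re S.det := (RCLike.pos_iff.1 hS.det_pos).1
  exact mul_nonneg (Real.rpow_nonneg hd.le _) (Real.exp_nonneg _)

theorem integral_gaussDensity {M : ℕ} {S : Matrix (Fin M) (Fin M) 𝕜} (hS : S.PosDef) :
    ∫ y, gaussDensity S y ∂(refMeasure 𝕜 M) = gaussConst 𝕜 M := by
  have h := integral_gaussDensity_mul_cexp hS 0
  simp only [zero_dotProduct, map_zero, Complex.ofReal_zero, mul_zero, Complex.exp_zero, mul_one,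
    neg_zero, zero_div] at h
  rw [integral_complex_ofReal] at h
  exact_mod_cast h

/-- The Bochner integral of a non-integrable function is zero by convention, whereas this one is
positive. -/
theorem integrable_gaussDensity {M : ℕ} {S : Matrix (Fin M) (Fin M) 𝕜} (hS : S.PosDef) :
    Integrable (gaussDensity S) (refMeasure 𝕜 M) := by
  by_contra h
  have := integral_gaussDensity hS
  rw [integral_undef h] at this
  exact (gaussConst_pos M).ne this

theorem lintegral_gaussDensity {M : ℕ} {S : Matrix (Fin M) (Fin M) 𝕜} (hS : S.PosDef) :
    ∫⁻ y, ENNReal.ofReal (gaussDensity S y) ∂(refMeasure 𝕜 M)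
      = ENNReal.ofReal (gaussConst 𝕜 M) := by
  rw [← ofReal_integral_eq_lintegral_ofReal (integrable_gaussDensity hS)
    (Eventually.of_forall (gaussDensity_nonneg hS)), integral_gaussDensity hS]

end GaussianDensity

/-! ### Normalized measures and Bayes' formula. -/

section Bayes

open scoped ENNReal

variable {Ω E F : Type*} [MeasurableSpace Ω] [MeasurableSpace E] [MeasurableSpace F]

theorem normalized_smul {c : ℝ≥0∞} (h0 : c ≠ 0) (h1 : c ≠ ∞) (m : Measure E) :
    normalized (c • m) = normalized m := by
  simp only [normalized, Measure.smul_apply, smul_eq_mul, smul_smul]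
  rw [ENNReal.mul_inv (Or.inl h0) (Or.inl h1), mul_right_comm, ENNReal.inv_mul_cancel h0 h1, one_mul]

theorem normalized_univ_le_one (m : Measure E) : normalized m Set.univ ≤ 1 := by
  simp only [normalized, Measure.smul_apply, smul_eq_mul]
  exact ENNReal.inv_mul_le_one _

theorem normalized_map {f : E → F} (hf : Measurable f) (m : Measure E) :
    (normalized m).map f = normalized (m.map f) := by
  rw [normalized, normalized, Measure.map_smul, Measure.map_apply hf MeasurableSet.univ,
    Set.preimage_univ]

/-- In `ENNReal`, normalizing a measure of mass `0` or `∞` produces mass `0`. Thus the mere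
existence of a random variable with the given prior law makes its kernel normalizable, and no
integral has to be estimated. -/
theorem mass_of_isProbabilityMeasure_normalized {m : Measure E}
    (h : IsProbabilityMeasure (normalized m)) : m Set.univ ≠ 0 ∧ m Set.univ ≠ ∞ := by
  have h1 := h.measure_univ
  simp only [normalized, Measure.smul_apply, smul_eq_mul] at h1
  constructor <;> intro h2 <;> simp [h2] at h1

theorem normalized_absolutelyContinuous (m : Measure E) : normalized m ≪ m :=
  Measure.smul_absolutelyContinuous

/-- The normalized densities `f y`, with respect to `ρ`, as a kernel. -/
noncomputable def normalizedKernel (ρ : Measure F) [SFinite ρ] (f : E → F → ℝ≥0∞)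
    (hf : Measurable (Function.uncurry f)) : Kernel E F where
  toFun y := normalized (ρ.withDensity (f y))
  measurable' := by
    refine Measure.measurable_of_measurable_coe _ fun s hs => ?_
    simp only [normalized, Measure.smul_apply, smul_eq_mul, withDensity_apply _ hs,
      withDensity_apply _ MeasurableSet.univ]
    exact (hf.lintegral_prod_right' (ν := ρ.restrict Set.univ)).inv.mul
      (hf.lintegral_prod_right' (ν := ρ.restrict s))

instance (ρ : Measure F) [SFinite ρ] (f : E → F → ℝ≥0∞) (hf : Measurable (Function.uncurry f)) :
    IsFiniteKernel (normalizedKernel ρ f hf) :=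
  ⟨1, ENNReal.one_lt_top, fun _ => normalized_univ_le_one _⟩

/-- Bayes' formula: the posterior has density proportional to the joint density. -/
theorem condDistrib_of_joint_density [StandardBorelSpace F] [Nonempty F] (P : Measure Ω)
    [IsFiniteMeasure P] {Y : Ω → E} {V : Ω → F} (hY : Measurable Y) (hV : Measurable V)
    (η : Measure E) [SFinite η] (ρ : Measure F) [SFinite ρ] (f : E → F → ℝ≥0∞)
    (hf : Measurable (Function.uncurry f))
    (h : P.map (fun ω => (Y ω, V ω)) = (η.prod ρ).withDensity (Function.uncurry f)) :
    condDistrib V Y P =ᵐ[P.map Y] fun y => normalized (ρ.withDensity (f y)) := by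
  have hm : Measurable fun y => ∫⁻ x, f y x ∂ρ := hf.lintegral_prod_right'
  have hfst : P.map Y = η.withDensity fun y => ∫⁻ x, f y x ∂ρ := by
    ext s hs
    have e : Y ⁻¹' s = (fun ω => (Y ω, V ω)) ⁻¹' (s ×ˢ Set.univ) := by ext; simp
    rw [Measure.map_apply hY hs, e, ← Measure.map_apply (hY.prodMk hV) (hs.prod MeasurableSet.univ),
      h, withDensity_apply _ (hs.prod MeasurableSet.univ), withDensity_apply _ hs,
      ← Measure.prod_restrict, lintegral_prod _ hf.aemeasurable]
    simp
  -- The inner integral is the density of the law of `Y`, which has finite mass.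
  have hfin : ∀ᵐ y ∂η, ∫⁻ x, f y x ∂ρ < ∞ := by
    refine ae_lt_top hm ?_
    rw [← setLIntegral_univ, ← withDensity_apply _ MeasurableSet.univ, ← hfst]
    exact measure_ne_top _ _
  refine condDistrib_ae_eq_of_measure_eq_compProd Y hV.aemeasurable
    (κ := normalizedKernel ρ f hf) ?_
  have := Measure.isFiniteMeasure_map P (fun ω => (Y ω, V ω))
  refine Measure.ext_prod_iff.2 fun {s t} hs ht => ?_
  rw [Measure.compProd_apply_prod hs ht, h, withDensity_apply _ (hs.prod ht),
    ← Measure.prod_restrict, lintegral_prod _ hf.aemeasurable, hfst,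
    setLIntegral_withDensity_eq_setLIntegral_mul _ hm (Kernel.measurable_coe _ ht) hs]
  refine lintegral_congr_ae (ae_restrict_of_ae ?_)
  filter_upwards [hfin] with y hy
  simp only [Function.uncurry, Pi.mul_apply, normalizedKernel, normalized, Kernel.coe_mk,
    Measure.smul_apply, smul_eq_mul, withDensity_apply _ ht, withDensity_apply _ MeasurableSet.univ,
    Measure.restrict_univ]
  -- Where the marginal density vanishes its inverse is `∞` and cannot be cancelled, but there both
  -- sides are zero.
  by_cases h0 : ∫⁻ x, f y x ∂ρ = 0
  · rw [h0, zero_mul]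
    exact le_antisymm ((setLIntegral_le_lintegral _ _).trans h0.le) zero_le
  · rw [← mul_assoc, ENNReal.mul_inv_cancel h0 hy.ne, one_mul]

/-- If the conditional law given `Y` only depends on `g ∘ Y`, it is the conditional law
given `g ∘ Y`. -/
theorem condDistrib_comp_of_ae_eq [StandardBorelSpace F] [Nonempty F] {G : Type*}
    [MeasurableSpace G] (P : Measure Ω)
    [IsFiniteMeasure P] {Y : Ω → E} {V : Ω → F} (hY : Measurable Y) (hV : Measurable V)
    {g : E → G} (hg : Measurable g) (κ : Kernel G F) [IsFiniteKernel κ]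
    (h : ∀ᵐ ω ∂P, condDistrib V Y P (Y ω) = κ (g (Y ω))) :
    ∀ᵐ ω ∂P, condDistrib V (fun ω => g (Y ω)) P (g (Y ω)) = κ (g (Y ω)) := by
  have hgY : Measurable fun ω => g (Y ω) := hg.comp hY
  refine ae_of_ae_map (p := fun x => condDistrib V (fun ω => g (Y ω)) P x = κ x) hgY.aemeasurable ?_
  refine condDistrib_ae_eq_of_measure_eq_compProd _ hV.aemeasurable ?_
  ext s hs
  -- The joint law of `(g ∘ Y, V)` is an image of that of `(Y, V)`; disintegrating the latter along
  -- `Y` exhibits `κ` as a disintegration of the former.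
  have h1 : P.map (fun ω => (g (Y ω), V ω)) = (P.map fun ω => (Y ω, V ω)).map (Prod.map g id) := by
    rw [Measure.map_map (hg.prodMap measurable_id) (hY.prodMk hV)]
    rfl
  have hs' : MeasurableSet (Prod.map g (id : F → F) ⁻¹' s) := (hg.prodMap measurable_id) hs
  rw [h1, ← compProd_map_condDistrib hV.aemeasurable, Measure.map_apply
    (hg.prodMap measurable_id) hs, Measure.compProd_apply hs', Measure.compProd_apply hs,
    lintegral_map (Kernel.measurable_kernel_prodMk_left hs') hY,
    lintegral_map (Kernel.measurable_kernel_prodMk_left hs) hgY]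
  refine lintegral_congr_ae ?_
  filter_upwards [h] with ω hω
  rw [hω]
  rfl

end Bayes

/-! ### Joint law of parameters and observations; the finite-dimensional posterior. -/

section JointLaw

open scoped ComplexOrder ENNReal

variable {𝕜 : Type*} [RCLike 𝕜]

instance (p : ℕ) : BorelSpace (Matrix (Fin p) (Fin p) 𝕜) :=
  inferInstanceAs (BorelSpace (Fin p → Fin p → 𝕜))

instance (p : ℕ) : SecondCountableTopology (Matrix (Fin p) (Fin p) 𝕜) :=
  inferInstanceAs (SecondCountableTopology (Fin p → Fin p → 𝕜))

theorem isClosed_posSemidef (p : ℕ) :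
    IsClosed {S : Matrix (Fin p) (Fin p) 𝕜 | S.PosSemidef} := by
  have e : {S : Matrix (Fin p) (Fin p) 𝕜 | S.PosSemidef} = {S | Sᴴ = S} ∩
      ⋂ x : Fin p → 𝕜, {S | 0 ≤ RCLike.re (star x ⬝ᵥ (S *ᵥ x)) ∧
        0 = RCLike.im (star x ⬝ᵥ (S *ᵥ x))} := by
    ext S
    show S.PosSemidef ↔ _
    rw [Matrix.posSemidef_iff_dotProduct_mulVec, Set.mem_inter_iff, Set.mem_iInter]
    refine and_congr Iff.rfl (forall_congr' fun x => ?_)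
    rw [RCLike.le_iff_re_im, map_zero, map_zero]
    rfl
  rw [e]
  refine (isClosed_eq (Continuous.matrix_conjTranspose continuous_id) continuous_id).inter
    (isClosed_iInter fun x => ?_)
  have hc : Continuous fun S : Matrix (Fin p) (Fin p) 𝕜 => star x ⬝ᵥ (S *ᵥ x) :=
    continuous_const.dotProduct (continuous_id.matrix_mulVec continuous_const)
  exact (isClosed_le continuous_const (RCLike.continuous_re.comp hc)).inter
    (isClosed_eq continuous_const (RCLike.continuous_im.comp hc))

theorem measurableSet_posDef (p : ℕ) :
    MeasurableSet {S : Matrix (Fin p) (Fin p) 𝕜 | S.PosDef} := by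
  have e : {S : Matrix (Fin p) (Fin p) 𝕜 | S.PosDef} = {S | S.PosSemidef} ∩ {S | S.det = 0}ᶜ := by
    ext S
    exact ⟨fun h => ⟨h.posSemidef, h.posSemidef.posDef_iff_det_ne_zero.1 h⟩,
      fun h => h.1.posDef_iff_det_ne_zero.2 h.2⟩
  rw [e]
  exact (isClosed_posSemidef p).measurableSet.inter
    (isClosed_eq (Continuous.matrix_det continuous_id) continuous_const).measurableSet.compl

theorem measurable_re_det (p : ℕ) :
    Measurable fun S : Matrix (Fin p) (Fin p) 𝕜 => RCLike.re S.det :=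
  (RCLike.continuous_re.comp (Continuous.matrix_det continuous_id)).measurable

/-- Matrix inversion is not continuous at singular matrices. Writing the inverse as the adjugate
divided by the determinant leaves only a scalar inversion. -/
theorem measurable_re_trace_mul_inv (p : ℕ) :
    Measurable fun q : Matrix (Fin p) (Fin p) 𝕜 × Matrix (Fin p) (Fin p) 𝕜 =>
      RCLike.re (q.1 * q.2⁻¹).trace := by
  have e : (fun q : Matrix (Fin p) (Fin p) 𝕜 × Matrix (Fin p) (Fin p) 𝕜 =>
      RCLike.re (q.1 * q.2⁻¹).trace)
      = fun q => RCLike.re ((q.2.det)⁻¹ * (q.1 * q.2.adjugate).trace) := by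
    ext q
    rw [Matrix.inv_def, Matrix.mul_smul, Matrix.trace_smul, Ring.inverse_eq_inv', smul_eq_mul]
  rw [e]
  refine RCLike.measurable_re.comp (Measurable.mul (Measurable.inv ?_) ?_)
  · exact (Continuous.matrix_det continuous_snd).measurable
  · exact (Continuous.matrix_trace
      (continuous_fst.matrix_mul (Continuous.matrix_adjugate continuous_snd))).measurable

theorem measurable_iwKernel (p : ℕ) (ν : ℝ) :
    Measurable fun q : Matrix (Fin p) (Fin p) 𝕜 × Matrix (Fin p) (Fin p) 𝕜 =>
      iwKernel q.1 ν q.2 := by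
  classical
  unfold iwKernel
  refine Measurable.ite (measurable_snd (measurableSet_posDef p)) ?_ measurable_const
  exact (((measurable_re_det p).comp measurable_snd).pow_const _).mul
    (Real.measurable_exp.comp ((measurable_re_trace_mul_inv p).neg.div_const _))

theorem iwKernel_nonneg {p : ℕ} (Ψ : Matrix (Fin p) (Fin p) 𝕜) (ν : ℝ)
    (S : Matrix (Fin p) (Fin p) 𝕜) : 0 ≤ iwKernel Ψ ν S := by
  unfold iwKernel
  split_ifs with h
  · exact mul_nonneg (Real.rpow_nonneg (RCLike.pos_iff.1 h.det_pos).1.le _) (Real.exp_nonneg _)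
  · exact le_rfl

theorem iwKernel_of_not_posDef {p : ℕ} (Ψ : Matrix (Fin p) (Fin p) 𝕜) (ν : ℝ)
    {S : Matrix (Fin p) (Fin p) 𝕜} (h : ¬ S.PosDef) : iwKernel Ψ ν S = 0 := if_neg h

theorem continuous_outer (p : ℕ) : Continuous (outer : (Fin p → 𝕜) → Matrix (Fin p) (Fin p) 𝕜) :=
  Continuous.matrix_vecMulVec continuous_id continuous_star

theorem measurable_gaussDensity (M : ℕ) :
    Measurable fun q : Matrix (Fin M) (Fin M) 𝕜 × (Fin M → 𝕜) => gaussDensity q.1 q.2 := by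
  have h : Measurable fun q : Matrix (Fin M) (Fin M) 𝕜 × (Fin M → 𝕜) => (outer q.2, q.1) :=
    ((continuous_outer M).measurable.comp measurable_snd).prodMk measurable_fst
  have h1 : Measurable fun q : Matrix (Fin M) (Fin M) 𝕜 × (Fin M → 𝕜) =>
      Real.exp (-(RCLike.re (outer q.2 * q.1⁻¹).trace) / 2) :=
    Real.measurable_exp.comp (((measurable_re_trace_mul_inv M).comp h).neg.div_const 2)
  have h2 : Measurable fun q : Matrix (Fin M) (Fin M) 𝕜 × (Fin M → 𝕜) =>
      (RCLike.re q.1.det) ^ (-(Module.finrank ℝ 𝕜 : ℝ) / 2) :=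
    ((measurable_re_det M).comp measurable_fst).pow_const _
  exact h2.mul h1

theorem affineIW_ae_posDef {p N : ℕ} {S : (Fin N → ℝ) → Matrix (Fin p) (Fin p) 𝕜}
    (hS : Measurable S) (D : Set (Fin N → ℝ)) (Ψ : Matrix (Fin p) (Fin p) 𝕜) (ν : ℝ) :
    ∀ᵐ x ∂(affineIW S D Ψ ν), (S x).PosDef := by
  refine (normalized_absolutelyContinuous _).ae_le ?_
  have hm : Measurable fun x => ENNReal.ofReal (iwKernel Ψ ν (S x)) :=
    ((measurable_iwKernel p ν).comp (measurable_const.prodMk hS)).ennreal_ofReal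
  refine (ae_withDensity_iff hm).2 ?_
  refine Eventually.of_forall fun x hx => ?_
  by_contra h
  exact hx (by rw [iwKernel_of_not_posDef _ _ h, ENNReal.ofReal_zero])

theorem affineIW_absolutelyContinuous {p N : ℕ} (S : (Fin N → ℝ) → Matrix (Fin p) (Fin p) 𝕜)
    (D : Set (Fin N → ℝ)) (Ψ : Matrix (Fin p) (Fin p) 𝕜) (ν : ℝ) :
    affineIW S D Ψ ν ≪ volume :=
  (normalized_absolutelyContinuous _).trans
    ((withDensity_absolutelyContinuous _ _).trans Measure.restrict_le_self.absolutelyContinuous)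

open Classical in
/-- The density of the centered Gaussian law with covariance `S`, if `S` is positive definite. -/
noncomputable def gaussKernelDensity {M : ℕ} (S : Matrix (Fin M) (Fin M) 𝕜) (y : Fin M → 𝕜) : ℝ≥0∞ :=
  if S.PosDef then (ENNReal.ofReal (gaussConst 𝕜 M))⁻¹ * ENNReal.ofReal (gaussDensity S y) else 0

theorem measurable_gaussKernelDensity (M : ℕ) :
    Measurable (Function.uncurry
      (gaussKernelDensity : Matrix (Fin M) (Fin M) 𝕜 → (Fin M → 𝕜) → ℝ≥0∞)) := by
  classical
  unfold gaussKernelDensity Function.uncurry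
  exact Measurable.ite (measurable_fst (measurableSet_posDef M))
    (measurable_const.mul (measurable_gaussDensity M).ennreal_ofReal) measurable_const

/-- The centered Gaussian laws with covariance `S`, for positive definite `S`. -/
noncomputable def gaussKernel (𝕜 : Type*) [RCLike 𝕜] (M : ℕ) :
    Kernel (Matrix (Fin M) (Fin M) 𝕜) (Fin M → 𝕜) :=
  Kernel.withDensity (Kernel.const _ (refMeasure 𝕜 M)) gaussKernelDensity

theorem gaussKernel_apply {M : ℕ} (S : Matrix (Fin M) (Fin M) 𝕜) :
    gaussKernel 𝕜 M S = (refMeasure 𝕜 M).withDensity (gaussKernelDensity S) := by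
  rw [gaussKernel, Kernel.withDensity_apply _ (measurable_gaussKernelDensity M), Kernel.const_apply]

instance (M : ℕ) : IsFiniteKernel (gaussKernel 𝕜 M) := by
  refine ⟨1, ENNReal.one_lt_top, fun S => ?_⟩
  rw [gaussKernel_apply, withDensity_apply _ MeasurableSet.univ, Measure.restrict_univ]
  unfold gaussKernelDensity
  by_cases h : S.PosDef
  · simp only [h, if_true]
    rw [lintegral_const_mul' _ _ (ENNReal.inv_ne_top.2
      (ENNReal.ofReal_pos.2 (gaussConst_pos M)).ne'), lintegral_gaussDensity h]
    exact ENNReal.inv_mul_le_one _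
  · simp [h]

theorem integral_gaussKernel {M : ℕ} {S : Matrix (Fin M) (Fin M) 𝕜} (hS : S.PosDef)
    (w : Fin M → 𝕜) :
    ∫ y, Complex.exp (Complex.I * ((RCLike.re (w ⬝ᵥ y) : ℝ) : ℂ)) ∂(gaussKernel 𝕜 M S)
      = Complex.exp (((-(RCLike.re (w ⬝ᵥ (S *ᵥ star w))) / 2 : ℝ) : ℂ)) := by
  have hm : Measurable (gaussKernelDensity S) :=
    (measurable_gaussKernelDensity M).comp measurable_prodMk_left
  have hc := gaussConst_pos (𝕜 := 𝕜) M
  have hc' : (ENNReal.ofReal (gaussConst 𝕜 M))⁻¹ ≠ ∞ :=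
    ENNReal.inv_ne_top.2 (ENNReal.ofReal_pos.2 hc).ne'
  rw [gaussKernel_apply, integral_withDensity_eq_integral_toReal_smul hm]
  · have e : ∀ y, (gaussKernelDensity S y).toReal •
        Complex.exp (Complex.I * ((RCLike.re (w ⬝ᵥ y) : ℝ) : ℂ))
        = ((gaussConst 𝕜 M)⁻¹ : ℝ) • ((gaussDensity S y : ℂ) *
          Complex.exp (Complex.I * ((RCLike.re (w ⬝ᵥ y) : ℝ) : ℂ))) := by
      intro y
      rw [gaussKernelDensity, if_pos hS, ENNReal.toReal_mul, ENNReal.toReal_inv,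
        ENNReal.toReal_ofReal hc.le, ENNReal.toReal_ofReal (gaussDensity_nonneg hS y)]
      simp only [Complex.real_smul]
      push_cast
      ring
    simp only [e]
    rw [integral_smul, integral_gaussDensity_mul_cexp hS, Complex.real_smul, ← mul_assoc]
    push_cast
    rw [inv_mul_cancel₀ (by exact_mod_cast hc.ne'), one_mul]
  · refine Eventually.of_forall fun y => ?_
    rw [gaussKernelDensity, if_pos hS]
    exact ENNReal.mul_lt_top hc'.lt_top ENNReal.ofReal_lt_top

/-- Every real functional is the real part of a `𝕜`-linear one, so the integrals of `exp(i Re (w ⬝ᵥ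
y))` determine a finite measure on `𝕜ᴹ`. -/
theorem exists_dual_eq_re_dotProduct {M : ℕ} (ℓ : StrongDual ℝ (Fin M → 𝕜)) :
    ∃ w : Fin M → 𝕜, ∀ y, ℓ y = RCLike.re (w ⬝ᵥ y) := by
  refine ⟨fun i => (ℓ.extendRCLike : StrongDual 𝕜 (Fin M → 𝕜)) (Pi.single i 1), fun y => ?_⟩
  rw [← StrongDual.re_extendRCLike_apply (𝕜 := 𝕜) ℓ y]
  congr 1
  have := LinearMap.pi_apply_eq_sum_univ
    ((ℓ.extendRCLike : StrongDual 𝕜 (Fin M → 𝕜)) : (Fin M → 𝕜) →ₗ[𝕜] 𝕜) y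
  refine this.trans ?_
  rw [dotProduct]
  refine Finset.sum_congr rfl fun i _ => ?_
  have e : (Pi.single i 1 : Fin M → 𝕜) = fun j => if i = j then 1 else 0 := by
    ext j
    simp [Pi.single_apply, eq_comm]
  rw [smul_eq_mul, mul_comm, e]
  rfl

variable {Ω : Type*} [MeasurableSpace Ω] (P : Measure Ω) [IsProbabilityMeasure P] {M N : ℕ}
  {Y : Ω → Fin M → 𝕜} {V : Ω → Fin N → ℝ}

/-- For fixed `E`, the law of `Y` on the event `V ∈ E` and the mixture of Gaussian laws over `E`
have the same characteristic function, hence agree. Rectangles `E ×ˢ B` then determine the joint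
law. -/
theorem map_prodMk_eq_compProd_gaussKernel (hY : Measurable Y) (hV : Measurable V)
    {S : (Fin N → ℝ) → Matrix (Fin M) (Fin M) 𝕜} (hS : Measurable S)
    (hpos : ∀ᵐ x ∂(P.map V), (S x).PosDef)
    (hchar : ∀ (w : Fin M → 𝕜) (E : Set (Fin N → ℝ)), MeasurableSet E →
      ∫ ω in V ⁻¹' E, Complex.exp (Complex.I * ((RCLike.re (w ⬝ᵥ Y ω) : ℝ) : ℂ)) ∂P
        = ∫ ω in V ⁻¹' E,
          Complex.exp (((-(RCLike.re (w ⬝ᵥ (S (V ω) *ᵥ star w))) / 2 : ℝ) : ℂ)) ∂P) :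
    P.map (fun ω => (V ω, Y ω)) = (P.map V) ⊗ₘ ((gaussKernel 𝕜 M).comap S hS) := by
  have := Measure.isFiniteMeasure_map P (fun ω => (V ω, Y ω))
  have := Measure.isFiniteMeasure_map P V
  refine Measure.ext_prod_iff.2 fun {E B} hE hB => ?_
  have key : (P.restrict (V ⁻¹' E)).map Y
      = (((P.map V).restrict E) ⊗ₘ ((gaussKernel 𝕜 M).comap S hS)).snd := by
    have := Measure.isFiniteMeasure_map (P.restrict (V ⁻¹' E)) Y
    refine Measure.ext_of_charFunDual (funext fun ℓ => ?_)
    obtain ⟨w, hw⟩ := exists_dual_eq_re_dotProduct ℓ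
    have hcont : Continuous fun y : Fin M → 𝕜 => Complex.exp (ℓ y * Complex.I) := by fun_prop
    rw [charFunDual_apply, charFunDual_apply, integral_map hY.aemeasurable
      hcont.aestronglyMeasurable, Measure.snd, integral_map measurable_snd.aemeasurable
      hcont.aestronglyMeasurable, Measure.integral_compProd]
    · simp only [hw, mul_comm _ Complex.I]
      rw [hchar w E hE, ← integral_indicator (hV hE), ← integral_indicator hE]
      have e : (fun ω => (V ⁻¹' E).indicator (fun ω =>
          Complex.exp (((-(RCLike.re (w ⬝ᵥ (S (V ω) *ᵥ star w))) / 2 : ℝ) : ℂ))) ω)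
          = fun ω => (E.indicator (fun x =>
          Complex.exp (((-(RCLike.re (w ⬝ᵥ (S x *ᵥ star w))) / 2 : ℝ) : ℂ)))) (V ω) := rfl
      rw [e, ← integral_map hV.aemeasurable (f := E.indicator (fun x =>
          Complex.exp (((-(RCLike.re (w ⬝ᵥ (S x *ᵥ star w))) / 2 : ℝ) : ℂ))))]
      · refine integral_congr_ae ?_
        filter_upwards [hpos] with x hx
        by_cases hxE : x ∈ E
        · simp only [Set.indicator_of_mem hxE, Kernel.comap_apply]
          exact (integral_gaussKernel hx w).symm
        · simp [Set.indicator_of_notMem hxE]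
      · refine (Measurable.indicator ?_ hE).aestronglyMeasurable
        refine Complex.measurable_exp.comp (Complex.measurable_ofReal.comp
          (((RCLike.measurable_re.comp ?_).neg).div_const _))
        have : Continuous fun A : Matrix (Fin M) (Fin M) 𝕜 => w ⬝ᵥ (A *ᵥ star w) :=
          continuous_const.dotProduct (continuous_id.matrix_mulVec continuous_const)
        exact this.measurable.comp hS
    · refine Integrable.of_bound (C := 1)
        (hcont.comp continuous_snd).aestronglyMeasurable (Eventually.of_forall fun x => ?_)
      rw [Complex.norm_exp_ofReal_mul_I]
  have h1 : P.map (fun ω => (V ω, Y ω)) (E ×ˢ B) = (P.restrict (V ⁻¹' E)).map Y B := by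
    rw [Measure.map_apply (hV.prodMk hY) (hE.prod hB), Measure.map_apply hY hB,
      Measure.restrict_apply (hY hB), Set.mk_preimage_prod, Set.inter_comm]
  rw [h1, key, Measure.snd_apply hB, Measure.compProd_apply (measurable_snd hB),
    Measure.compProd_apply_prod hE hB]
  rfl

/-- Prior density times Gaussian likelihood, simplified by conjugacy. The constant `c` collects the
two normalizations and cancels when the posterior is normalized. -/
theorem joint_density_of_affineIW_prior (hY : Measurable Y) (hV : Measurable V)
    {S : (Fin N → ℝ) → Matrix (Fin M) (Fin M) 𝕜} (hS : Measurable S) (D : Set (Fin N → ℝ))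
    (Ψ : Matrix (Fin M) (Fin M) 𝕜) (ν : ℝ) (hprior : P.map V = affineIW S D Ψ ν)
    (hchar : ∀ (w : Fin M → 𝕜) (E : Set (Fin N → ℝ)), MeasurableSet E →
      ∫ ω in V ⁻¹' E, Complex.exp (Complex.I * ((RCLike.re (w ⬝ᵥ Y ω) : ℝ) : ℂ)) ∂P
        = ∫ ω in V ⁻¹' E,
          Complex.exp (((-(RCLike.re (w ⬝ᵥ (S (V ω) *ᵥ star w))) / 2 : ℝ) : ℂ)) ∂P) :
    ∃ c : ℝ≥0∞, c ≠ 0 ∧ c ≠ ∞ ∧ P.map (fun ω => (Y ω, V ω)) =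
      ((refMeasure 𝕜 M).prod (volume.restrict D)).withDensity (Function.uncurry fun y x =>
        c * ENNReal.ofReal (iwKernel (outer y + Ψ) (ν + 1) (S x))) := by
  set m := (volume.restrict D).withDensity fun x => ENNReal.ofReal (iwKernel Ψ ν (S x)) with hm
  have hprior' : P.map V = normalized m := hprior
  have hprob : IsProbabilityMeasure (normalized m) := by
    rw [← hprior']
    exact Measure.isProbabilityMeasure_map hV.aemeasurable
  obtain ⟨hm0, hm1⟩ := mass_of_isProbabilityMeasure_normalized hprob
  have hc := ENNReal.ofReal_pos.2 (gaussConst_pos (𝕜 := 𝕜) M)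
  refine ⟨(m Set.univ)⁻¹ * (ENNReal.ofReal (gaussConst 𝕜 M))⁻¹,
    mul_ne_zero (ENNReal.inv_ne_zero.2 hm1) (ENNReal.inv_ne_zero.2 ENNReal.ofReal_ne_top),
    ENNReal.mul_ne_top (ENNReal.inv_ne_top.2 hm0) (ENNReal.inv_ne_top.2 hc.ne'), ?_⟩
  have hjoint := map_prodMk_eq_compProd_gaussKernel P hY hV hS
    (by rw [hprior]; exact affineIW_ae_posDef hS D Ψ ν) hchar
  have hk : Measurable fun x => ENNReal.ofReal (iwKernel Ψ ν (S x)) :=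
    ((measurable_iwKernel M ν).comp (measurable_const.prodMk hS)).ennreal_ofReal
  have hf : Measurable (Function.uncurry fun (y : Fin M → 𝕜) x =>
      (m Set.univ)⁻¹ * (ENNReal.ofReal (gaussConst 𝕜 M))⁻¹ *
        ENNReal.ofReal (iwKernel (outer y + Ψ) (ν + 1) (S x))) := by
    refine Measurable.const_mul (Measurable.ennreal_ofReal ?_) _
    refine (measurable_iwKernel M (ν + 1)).comp (Measurable.prodMk ?_ (hS.comp measurable_snd))
    exact (((continuous_outer M).add continuous_const).measurable).comp measurable_fst
  have hswap : P.map (fun ω => (Y ω, V ω)) = (P.map fun ω => (V ω, Y ω)).map Prod.swap := by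
    rw [Measure.map_map measurable_swap (hV.prodMk hY)]
    rfl
  have := Measure.isFiniteMeasure_map P (fun ω => (Y ω, V ω))
  refine Measure.ext_prod_iff.2 fun {B E} hB hE => ?_
  rw [hswap, hjoint, Measure.map_apply measurable_swap (hB.prod hE), Set.preimage_swap_prod,
    Measure.compProd_apply_prod hE hB, withDensity_apply _ (hB.prod hE), ← Measure.prod_restrict,
    lintegral_prod_symm _ hf.aemeasurable, hprior', normalized, Measure.restrict_smul,
    lintegral_smul_measure, hm,
    setLIntegral_withDensity_eq_setLIntegral_mul _ hk
      (Kernel.measurable_coe _ hB) hE, ← hm, smul_eq_mul, ← lintegral_const_mul']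
  · refine lintegral_congr fun x => ?_
    simp only [Pi.mul_apply, Kernel.comap_apply, gaussKernel_apply, withDensity_apply _ hB,
      Function.uncurry]
    rw [← lintegral_const_mul' _ _ ENNReal.ofReal_ne_top, ← lintegral_const_mul' _ _
      (ENNReal.inv_ne_top.2 hm0)]
    refine lintegral_congr fun y => ?_
    rw [← iwKernel_mul_gaussDensity, ENNReal.ofReal_mul (iwKernel_nonneg _ _ _)]
    by_cases hx : (S x).PosDef
    · rw [gaussKernelDensity, if_pos hx]
      ring
    · rw [iwKernel_of_not_posDef _ _ hx]
      simp
  · exact ENNReal.inv_ne_top.2 hm0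

theorem condDistrib_of_affineIW_prior (hY : Measurable Y) (hV : Measurable V)
    {S : (Fin N → ℝ) → Matrix (Fin M) (Fin M) 𝕜} (hS : Measurable S) (D : Set (Fin N → ℝ))
    (Ψ : Matrix (Fin M) (Fin M) 𝕜) (ν : ℝ) (hprior : P.map V = affineIW S D Ψ ν)
    (hchar : ∀ (w : Fin M → 𝕜) (E : Set (Fin N → ℝ)), MeasurableSet E →
      ∫ ω in V ⁻¹' E, Complex.exp (Complex.I * ((RCLike.re (w ⬝ᵥ Y ω) : ℝ) : ℂ)) ∂P
        = ∫ ω in V ⁻¹' E,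
          Complex.exp (((-(RCLike.re (w ⬝ᵥ (S (V ω) *ᵥ star w))) / 2 : ℝ) : ℂ)) ∂P) :
    ∀ᵐ ω ∂P, condDistrib V Y P (Y ω) = affineIW S D (outer (Y ω) + Ψ) (ν + 1) := by
  obtain ⟨c, hc0, hc1, hjoint⟩ :=
    joint_density_of_affineIW_prior P hY hV hS D Ψ ν hprior hchar
  have hf : Measurable (Function.uncurry fun (y : Fin M → 𝕜) x =>
      c * ENNReal.ofReal (iwKernel (outer y + Ψ) (ν + 1) (S x))) := by
    refine Measurable.const_mul (Measurable.ennreal_ofReal ?_) _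
    refine (measurable_iwKernel M (ν + 1)).comp (Measurable.prodMk ?_ (hS.comp measurable_snd))
    exact (((continuous_outer M).add continuous_const).measurable).comp measurable_fst
  have h := ae_of_ae_map hY.aemeasurable
    (condDistrib_of_joint_density P hY hV _ _ _ hf hjoint)
  filter_upwards [h] with ω hω
  rw [hω]
  have e : (volume.restrict D).withDensity
      (fun x => c * ENNReal.ofReal (iwKernel (outer (Y ω) + Ψ) (ν + 1) (S x)))
      = c • (volume.restrict D).withDensity
        (fun x => ENNReal.ofReal (iwKernel (outer (Y ω) + Ψ) (ν + 1) (S x))) :=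
    withDensity_smul' _ _ hc1
  rw [e, normalized_smul hc0 hc1]
  rfl

end JointLaw

/-! ### Gaussian laws carried by positive definite matrices are point masses. -/

section NotGaussian

open scoped ComplexOrder ENNReal

variable {𝕜 : Type*} [RCLike 𝕜]

/-- By continuity the quadratic form vanishes everywhere, so `H` and `-H` are both positive
semidefinite and the Loewner order is antisymmetric. A countable dense `W` lets almost sure
identities for single vectors be combined. -/
theorem eq_zero_of_dense_quadratic {p : ℕ} {H : Matrix (Fin p) (Fin p) 𝕜} (hH : H.IsHermitian)
    {W : Set (Fin p → 𝕜)} (hW : Dense W) (h : ∀ w ∈ W, RCLike.re (w ⬝ᵥ (H *ᵥ star w)) = 0) :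
    H = 0 := by
  have hall : ∀ w : Fin p → 𝕜, RCLike.re (w ⬝ᵥ (H *ᵥ star w)) = 0 := by
    have hc : Continuous fun w : Fin p → 𝕜 => RCLike.re (w ⬝ᵥ (H *ᵥ star w)) :=
      RCLike.continuous_re.comp
        (continuous_id.dotProduct (continuous_const.matrix_mulVec continuous_star))
    exact fun w => congrFun (hc.ext_on hW continuous_const h) w
  have hx : ∀ x : Fin p → 𝕜, RCLike.re (star x ⬝ᵥ (H *ᵥ x)) = 0 := fun x => by
    simpa using hall (star x)
  have psd : ∀ K : Matrix (Fin p) (Fin p) 𝕜, K.IsHermitian →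
      (∀ x : Fin p → 𝕜, RCLike.re (star x ⬝ᵥ (K *ᵥ x)) = 0) → K.PosSemidef := by
    intro K hK hKx
    refine Matrix.posSemidef_iff_dotProduct_mulVec.2 ⟨hK, fun x => ?_⟩
    rw [RCLike.le_iff_re_im, map_zero, map_zero, hKx, hK.im_star_dotProduct_mulVec_self]
    exact ⟨le_rfl, rfl⟩
  have h1 := psd H hH hx
  have h2 := psd (-H) hH.neg fun x => by simpa [Matrix.neg_mulVec] using hx x
  open scoped MatrixOrder in
  exact le_antisymm (neg_nonneg.1 h2.nonneg) h1.nonneg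

/-- A real Gaussian law of positive variance charges every half-line, so a one-sided bound forces
zero variance. -/
theorem ae_eq_const_of_isGaussian_of_le {E : Type*} [TopologicalSpace E] [AddCommMonoid E]
    [Module ℝ E] [MeasurableSpace E] [BorelSpace E] {μ : Measure E} (hμ : IsGaussian μ)
    (ℓ : StrongDual ℝ E) {c : ℝ} (h : ∀ᵐ x ∂μ, c ≤ ℓ x) : ∃ a, ∀ᵐ x ∂μ, ℓ x = a := by
  have hℓ : Measurable ℓ := ℓ.continuous.measurable
  have hmap := hμ.map_eq_gaussianReal ℓ
  have hle : ∀ᵐ t ∂(μ.map ℓ), c ≤ t :=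
    (ae_map_iff hℓ.aemeasurable measurableSet_Ici).2 h
  by_cases hs : (Var[ℓ; μ]).toNNReal = 0
  · rw [hs, gaussianReal_zero_var] at hmap
    refine ⟨μ[ℓ], ae_of_ae_map (p := fun t => t = μ[ℓ]) hℓ.aemeasurable ?_⟩
    rw [hmap]
    exact (ae_dirac_iff (measurableSet_singleton _)).2 rfl
  · rw [hmap] at hle
    have := (gaussianReal_absolutelyContinuous' (μ[ℓ]) hs).ae_le hle
    have h0 : volume (Set.Iio c) = 0 := by
      refine measure_mono_null ?_ (ae_iff.1 this)
      intro t ht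
      simpa using ht
    simp at h0

/-- Positivity of `S x` bounds each functional `q w (S.linear x)` below by `-q w (S 0)`, so under a
Gaussian law it is constant. Enough of these constants determine `S x`, hence `x` by injectivity. -/
theorem isGaussian_eq_dirac_of_posDef {p N : ℕ}
    {S : (Fin N → ℝ) →ᵃ[ℝ] Matrix (Fin p) (Fin p) 𝕜} (hS : Function.Injective S)
    (hH : ∀ x, (S x).IsHermitian) {μ : Measure (Fin N → ℝ)} (hμ : IsGaussian μ)
    (hpos : ∀ᵐ x ∂μ, (S x).PosDef) : ∃ x₀, μ = Measure.dirac x₀ := by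
  have hdec : ∀ x, S x = S.linear x + S 0 := fun x => congrFun S.decomp x
  obtain ⟨W, hWc, hWd⟩ := TopologicalSpace.exists_countable_dense (Fin p → 𝕜)
  let q : (Fin p → 𝕜) → Matrix (Fin p) (Fin p) 𝕜 →ₗ[ℝ] ℝ := fun w =>
    { toFun := fun A => RCLike.re (w ⬝ᵥ (A *ᵥ star w))
      map_add' := fun A B => by simp [Matrix.add_mulVec, dotProduct_add]
      map_smul' := fun c A => by simp [Matrix.smul_mulVec, dotProduct_smul, RCLike.smul_re] }
  have hq : ∀ w, ∃ a, ∀ᵐ x ∂μ, q w (S.linear x) = a := fun w => by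
    refine ae_eq_const_of_isGaussian_of_le hμ
      (LinearMap.toContinuousLinearMap ((q w).comp S.linear)) (c := -q w (S 0)) ?_
    filter_upwards [hpos] with x hx
    have h1 : 0 ≤ q w (S x) := by
      have := hx.posSemidef.dotProduct_mulVec_nonneg (star w)
      rw [star_star] at this
      exact (RCLike.nonneg_iff.1 this).1
    rw [hdec, map_add] at h1
    simpa [neg_le_iff_add_nonneg] using h1
  choose a ha using hq
  have hae : ∀ᵐ x ∂μ, ∀ w ∈ W, q w (S.linear x) = a w := (ae_ball_iff hWc).2 fun w _ => ha w
  obtain ⟨x₀, hx₀⟩ := hae.exists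
  refine ⟨x₀, ?_⟩
  have hconst : (fun x : Fin N → ℝ => x) =ᵐ[μ] fun _ => x₀ := by
    filter_upwards [hae] with x hx
    refine hS ?_
    rw [← sub_eq_zero]
    refine eq_zero_of_dense_quadratic ((hH x).sub (hH x₀)) hWd fun w hw => ?_
    show q w (S x - S x₀) = 0
    rw [hdec x, hdec x₀, add_sub_add_right_eq_sub, map_sub, hx w hw, hx₀ w hw, sub_self]
  have := Measure.map_congr (mβ := MeasurableSpace.pi) hconst
  rw [Measure.map_id', Measure.map_const, measure_univ, one_smul] at this
  exact this

/-- A point mass is not absolutely continuous in positive dimension; for `N = 0` it is Lebesgue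
measure itself. -/
theorem not_isGaussian_of_posDef {p N : ℕ} (hN : 0 < N)
    {S : (Fin N → ℝ) →ᵃ[ℝ] Matrix (Fin p) (Fin p) 𝕜} (hS : Function.Injective S)
    (hH : ∀ x, (S x).IsHermitian) {μ : Measure (Fin N → ℝ)} (hac : μ ≪ volume)
    (hpos : ∀ᵐ x ∂μ, (S x).PosDef) : ¬ IsGaussian μ := by
  intro hμ
  obtain ⟨x₀, rfl⟩ := isGaussian_eq_dirac_of_posDef hS hH hμ hpos
  have : Nonempty (Fin N) := ⟨⟨0, hN⟩⟩
  have := hac (measure_singleton x₀)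
  simp at this

end NotGaussian

/-! ### Affine changes of parameters and the inverse Wishart law. -/

section AffineChange

open scoped ENNReal

variable {𝕜 : Type*} [RCLike 𝕜]

theorem exists_affine_leftInverse {E W : Type*} [AddCommGroup E] [Module ℝ E] [AddCommGroup W]
    [Module ℝ W] {S : E →ᵃ[ℝ] W} (hS : Function.Injective S) :
    ∃ R : W →ᵃ[ℝ] E, ∀ x, R (S x) = x := by
  obtain ⟨g, hg⟩ := S.linear.exists_leftInverse_of_injective
    (LinearMap.ker_eq_bot.2 (S.linear_injective_iff.2 hS))
  refine ⟨g.toAffineMap - AffineMap.const ℝ W (g (S 0)), fun x => ?_⟩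
  have hdec : S x = S.linear x + S 0 := congrFun S.decomp x
  have := LinearMap.congr_fun hg x
  simp only [LinearMap.comp_apply, LinearMap.id_apply] at this
  simp [hdec, this]

/-- Uniqueness of Haar measure, after absorbing the translation. The value of `c` is immaterial
since it is applied only to normalized laws. -/
theorem map_addHaar_affine {E F : Type*} [NormedAddCommGroup E] [NormedSpace ℝ E]
    [FiniteDimensional ℝ E] [MeasurableSpace E] [BorelSpace E] [NormedAddCommGroup F]
    [NormedSpace ℝ F] [FiniteDimensional ℝ F] [MeasurableSpace F] [BorelSpace F] (μ : Measure E)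
    [μ.IsAddHaarMeasure] (η : Measure F) [η.IsAddHaarMeasure] (e : E →ᵃ[ℝ] F)
    (he : Function.Bijective e) : ∃ c : ℝ≥0∞, c ≠ 0 ∧ c ≠ ∞ ∧ μ.map e = c • η := by
  let L : E ≃ₗ[ℝ] F := LinearEquiv.ofBijective e.linear
    ⟨e.linear_injective_iff.2 he.1, e.linear_surjective_iff.2 he.2⟩
  have hL : Measurable L :=
    (LinearMap.continuous_of_finiteDimensional (L : E →ₗ[ℝ] F)).measurable
  have hdec : ⇑e = (fun y => y + e 0) ∘ L := by
    ext x
    exact congrFun e.decomp x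
  refine ⟨(μ.map L).addHaarScalarFactor η, ?_, ENNReal.coe_ne_top, ?_⟩
  · exact_mod_cast (Measure.addHaarScalarFactor_pos_of_isAddHaarMeasure (μ.map L) η).ne'
  · rw [hdec, ← Measure.map_map (measurable_add_const _) hL, map_add_right_eq_self]
    exact Measure.isAddLeftInvariant_eq_smul (μ.map L) η

theorem continuous_affine_matrix {E : Type*} [NormedAddCommGroup E] [NormedSpace ℝ E]
    [FiniteDimensional ℝ E] {p : ℕ} (S : E →ᵃ[ℝ] Matrix (Fin p) (Fin p) 𝕜) :
    Continuous S := by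
  rw [S.decomp]
  exact (LinearMap.continuous_of_finiteDimensional S.linear).add continuous_const

theorem affineIW_map {p N N' : ℕ} {S : (Fin N → ℝ) → Matrix (Fin p) (Fin p) 𝕜}
    {S' : (Fin N' → ℝ) → Matrix (Fin p) (Fin p) 𝕜} (hS' : Measurable S')
    (e : (Fin N → ℝ) →ᵃ[ℝ] (Fin N' → ℝ)) (he : Function.Bijective e) (h : ∀ x, S' (e x) = S x)
    (Ψ : Matrix (Fin p) (Fin p) 𝕜) (ν : ℝ) :
    (affineIW S Set.univ Ψ ν).map e = affineIW S' Set.univ Ψ ν := by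
  have hem : Measurable e := (AffineMap.continuous_of_finiteDimensional e).measurable
  obtain ⟨c, h0, h1, hc⟩ := map_addHaar_affine volume (volume : Measure (Fin N' → ℝ)) e he
  have hk : Measurable fun x => ENNReal.ofReal (iwKernel Ψ ν (S' x)) :=
    ((measurable_iwKernel p ν).comp (measurable_const.prodMk hS')).ennreal_ofReal
  rw [affineIW, affineIW, normalized_map hem, Measure.restrict_univ, Measure.restrict_univ,
    ← normalized_smul h0 h1 (volume.withDensity _), ← withDensity_smul_measure, ← hc]
  congr 1
  ext s hs
  rw [Measure.map_apply hem hs, withDensity_apply _ (hem hs), withDensity_apply _ hs,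
    setLIntegral_map hs hk hem]
  simp only [h]

/-- `hermCoord` as a linear map. -/
noncomputable def hermCoordLin (𝕜 : Type*) [RCLike 𝕜] (p : ℕ) :
    (Fin (Module.finrank ℝ (Herm 𝕜 p)) → ℝ) →ₗ[ℝ] Matrix (Fin p) (Fin p) 𝕜 :=
  (Herm 𝕜 p).subtype.comp (Module.finBasis ℝ (Herm 𝕜 p)).equivFun.symm.toLinearMap

theorem measurable_hermCoord (p : ℕ) : Measurable (hermCoord 𝕜 p) := by
  have h : Continuous (hermCoordLin 𝕜 p) := LinearMap.continuous_of_finiteDimensional _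
  exact h.measurable

theorem hermCoord_injective (p : ℕ) : Function.Injective (hermCoord 𝕜 p) :=
  Subtype.val_injective.comp (LinearEquiv.injective _)

theorem exists_hermCoord_eq {p : ℕ} {A : Matrix (Fin p) (Fin p) 𝕜} (hA : A.IsHermitian) :
    ∃ c, hermCoord 𝕜 p c = A := by
  refine ⟨(Module.finBasis ℝ (Herm 𝕜 p)).equivFun ⟨A, hA⟩, ?_⟩
  rw [hermCoord, LinearEquiv.symm_apply_apply]

theorem isHermitian_hermCoord {p : ℕ} (c : Fin (Module.finrank ℝ (Herm 𝕜 p)) → ℝ) :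
    (hermCoord 𝕜 p c).IsHermitian :=
  ((Module.finBasis ℝ (Herm 𝕜 p)).equivFun.symm c).2

/-- A bijective `S` differs from the coordinates `hermCoord` by an affine bijection `e` of the
parameter spaces, to which `affineIW_map` applies. -/
theorem affineIW_map_eq_invWishart {p N : ℕ} (S : (Fin N → ℝ) →ᵃ[ℝ] Matrix (Fin p) (Fin p) 𝕜)
    (hS : Set.BijOn S Set.univ {H | H.IsHermitian}) (Ψ : Matrix (Fin p) (Fin p) 𝕜) (ν : ℝ) :
    (affineIW S Set.univ Ψ ν).map S = invWishart Ψ ν := by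
  have hinj : Function.Injective (hermCoordLin 𝕜 p).toAffineMap := hermCoord_injective p
  obtain ⟨R, hR⟩ := exists_affine_leftInverse hinj
  let e := R.comp S
  have he : ∀ x, hermCoord 𝕜 p (e x) = S x := fun x => by
    obtain ⟨c, hc⟩ := exists_hermCoord_eq (hS.mapsTo (Set.mem_univ x))
    have : e x = c := by
      show R (S x) = c
      rw [← hc]
      exact hR c
    rw [this, hc]
  have hbij : Function.Bijective e := by
    refine ⟨fun x y hxy => hS.injOn (Set.mem_univ x) (Set.mem_univ y) ?_, fun c => ?_⟩
    · rw [← he, ← he, hxy]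
    · obtain ⟨x, -, hx⟩ := hS.surjOn (isHermitian_hermCoord c)
      refine ⟨x, hinj ?_⟩
      exact (he x).trans hx
  have hem : Measurable e := (AffineMap.continuous_of_finiteDimensional e).measurable
  rw [invWishart, ← affineIW_map (measurable_hermCoord p) e hbij he Ψ ν,
    Measure.map_map (measurable_hermCoord p) hem]
  congr 1
  ext1 x
  exact (he x).symm

end AffineChange

/-! ### Conditional Gaussianity and the hierarchical model. -/

section Conditional

variable {𝕜 : Type*} [RCLike 𝕜] {Ω : Type*} [MeasurableSpace Ω]

theorem measurable_eval (φ : Test 𝕜) : Measurable fun u : TDist 𝕜 => u φ :=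
  Measurable.of_comap_le (le_iSup (fun φ : Test 𝕜 =>
    MeasurableSpace.comap (fun u : TDist 𝕜 => u φ) inferInstance) φ)

theorem measurable_obs {M : ℕ} {z : Ω → TDist 𝕜} (hz : Measurable z) (φ : Fin M → Test 𝕜) :
    Measurable (obs z φ) :=
  measurable_pi_iff.2 fun i => (measurable_eval (φ i)).comp hz

theorem measurable_char (φ : Test 𝕜) : Measurable fun u : TDist 𝕜 =>
    Complex.exp (Complex.I * ((RCLike.re (u φ) : ℝ) : ℂ)) :=
  Complex.measurable_exp.comp ((Complex.measurable_ofReal.comp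
    (RCLike.measurable_re.comp (measurable_eval φ))).const_mul _)

theorem integrable_char (P : Measure Ω) [IsFiniteMeasure P] {u : Ω → TDist 𝕜} (hu : Measurable u)
    (φ : Test 𝕜) :
    Integrable (fun ω => Complex.exp (Complex.I * ((RCLike.re (u ω φ) : ℝ) : ℂ))) P :=
  Integrable.of_bound (C := 1) ((measurable_char φ).comp hu).aestronglyMeasurable
    (Eventually.of_forall fun ω => by rw [mul_comm, Complex.norm_exp_ofReal_mul_I])

theorem continuous_signalForm (ε : TDist 𝕜) (T : ℝ) (L : Discretization) (φ ψ : Test 𝕜) :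
    Continuous fun v => signalForm ε T L v φ ψ := by
  have e : (fun v => signalForm ε T L v φ ψ) = fun v => (∑ j, v j •
      scatterForm L (Pi.single j 1) (transpose ε φ) (transpose ε ψ)) + (T : 𝕜) * ip φ ψ := by
    ext v
    rw [signalForm, scatterForm_eq_sum]
  rw [e]
  exact (continuous_finsetSum _ fun j _ => (continuous_apply j).smul continuous_const).add
    continuous_const

theorem CondGaussian.setIntegral_eq (P : Measure Ω) [IsFiniteMeasure P] {Θ : Type*}
    [MeasurableSpace Θ] {θ : Ω → Θ} (hθ : Measurable θ) {u : Ω → TDist 𝕜} (hu : Measurable u)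
    {Q : Ω → Test 𝕜 → Test 𝕜 → 𝕜} {U : Set (Test 𝕜)} (h : CondGaussian P θ u Q U) {φ : Test 𝕜}
    (hφ : φ ∈ U) {E : Set Θ} (hE : MeasurableSet E) :
    ∫ ω in θ ⁻¹' E, Complex.exp (Complex.I * ((RCLike.re (u ω φ) : ℝ) : ℂ)) ∂P
      = ∫ ω in θ ⁻¹' E, Complex.exp (((-(RCLike.re (Q ω φ φ)) / 2 : ℝ) : ℂ)) ∂P := by
  rw [← setIntegral_condExp hθ.comap_le (integrable_char P hu φ) ⟨E, hE, rfl⟩]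
  exact setIntegral_congr_ae (hθ hE) ((h φ hφ).mono fun ω hω _ => hω)

/-- Integrability is inherited from the conditional expectation; no positivity of `Q` is needed to
bound the exponential. -/
theorem CondGaussian.integrable (P : Measure Ω) {Θ : Type*}
    [MeasurableSpace Θ] {θ : Ω → Θ} {u : Ω → TDist 𝕜}
    {Q : Ω → Test 𝕜 → Test 𝕜 → 𝕜} {U : Set (Test 𝕜)} (h : CondGaussian P θ u Q U) {φ : Test 𝕜}
    (hφ : φ ∈ U) :
    Integrable (fun ω => Complex.exp (((-(RCLike.re (Q ω φ φ)) / 2 : ℝ) : ℂ))) P :=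
  integrable_condExp.congr (h φ hφ)

/-- A conditionally Gaussian distribution whose form depends on a function `g ∘ θ` of `θ` only is
conditionally Gaussian given `g ∘ θ`. -/
theorem CondGaussian.comp (P : Measure Ω) [IsFiniteMeasure P] {Θ Θ' : Type*}
    [MeasurableSpace Θ] [MeasurableSpace Θ'] {θ : Ω → Θ} (hθ : Measurable θ) {u : Ω → TDist 𝕜}
    {g : Θ → Θ'} (hg : Measurable g) {Q : Θ' → Test 𝕜 → Test 𝕜 → 𝕜} {U : Set (Test 𝕜)}
    (hQ : ∀ φ ∈ U, Measurable fun t => Q t φ φ)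
    (h : CondGaussian P θ u (fun ω => Q (g (θ ω))) U) :
    CondGaussian P (fun ω => g (θ ω)) u (fun ω => Q (g (θ ω))) U := by
  intro φ hφ
  have hle : MeasurableSpace.comap (fun ω => g (θ ω)) inferInstance
      ≤ MeasurableSpace.comap θ inferInstance := by
    rintro s ⟨t, ht, rfl⟩
    exact ⟨g ⁻¹' t, hg ht, rfl⟩
  -- Tower property: the conditional characteristic functional given `θ` is already a function of `g
  -- ∘ θ`.
  refine (condExp_condExp_of_le hle hθ.comap_le).symm.trans ((condExp_congr_ae (h φ hφ)).trans ?_)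
  rw [condExp_of_stronglyMeasurable (hle.trans hθ.comap_le) _ (CondGaussian.integrable P h hφ)]
  refine Measurable.stronglyMeasurable ?_
  have hc : Measurable fun t => Complex.exp (((-(RCLike.re (Q t φ φ)) / 2 : ℝ) : ℂ)) :=
    Complex.measurable_exp.comp (Complex.measurable_ofReal.comp
      (((RCLike.measurable_re.comp (hQ φ hφ)).neg).div_const 2))
  exact hc.comp (comap_measurable fun ω => g (θ ω))

/-- The exponential of the signal factors into a scatterer part `A` and a noise part `B`, and the
noise is independent of `(θ, μ)`. Its expectation, taken at the test function `√T φ`, contributes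
exactly the term `T ‖φ‖²`. -/
theorem IsHierarchical.condGaussian (P : Measure Ω) [IsProbabilityMeasure P] {ε : TDist 𝕜} {T : ℝ}
    (hT : 0 ≤ T) {z : Ω → TDist 𝕜} (hz : Measurable z) {Θ : Type*} [MeasurableSpace Θ] {θ : Ω → Θ}
    {L : Discretization} {v : Θ → Fin L.N → ℝ} {U : Set (Test 𝕜)} {μ ξ : Ω → TDist 𝕜}
    (hθ : Measurable θ) (hv : Measurable v) (h : IsHierarchical P θ ε T L v U μ ξ z) :
    CondGaussian P θ z (fun ω => signalForm ε T L (v (θ ω))) U := by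
  intro φ hφ
  have hμφ : transpose ε φ ∈ transpose ε '' U := ⟨φ, hφ, rfl⟩
  set a : 𝕜 := ((√T : ℝ) : 𝕜) with ha
  set A : TDist 𝕜 → ℂ := fun u =>
    Complex.exp (Complex.I * ((RCLike.re (u (transpose ε φ)) : ℝ) : ℂ)) with hA
  set B : TDist 𝕜 → ℂ := fun u =>
    Complex.exp (Complex.I * ((RCLike.re (u (a • φ)) : ℝ) : ℂ)) with hB
  have hB0 : ∫ ω, B (ξ ω) ∂P = Complex.exp (((-(RCLike.re ((T : 𝕜) * ip φ φ)) / 2 : ℝ) : ℂ)) := by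
    have e : ip φ (a • φ) = a * ip φ φ := by
      rw [← ip_conj, ip_smul_left, map_mul, ip_conj, ha, RCLike.conj_ofReal]
    rw [hB, h.noise (a • φ), ip_smul_left, e, ← mul_assoc, ha, ← RCLike.ofReal_mul,
      Real.mul_self_sqrt hT]
  have hzeq : ∀ᵐ ω ∂P, Complex.exp (Complex.I * ((RCLike.re (z ω φ) : ℝ) : ℂ))
      = A (μ ω) * B (ξ ω) := by
    filter_upwards [h.signal] with ω hω
    have e : ξ ω (a • φ) = a * ξ ω φ := (ξ ω).toLin.map_smul a φ
    simp only [hA, hB]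
    rw [hω φ, ← ha, e, ← Complex.exp_add, map_add]
    push_cast
    ring_nf
  have hRHS : ∀ ω, Complex.exp (((-(RCLike.re (signalForm ε T L (v (θ ω)) φ φ)) / 2 : ℝ) : ℂ))
      = Complex.exp (((-(RCLike.re (scatterForm L (v (θ ω)) (transpose ε φ) (transpose ε φ))) / 2
        : ℝ) : ℂ)) * ∫ ω, B (ξ ω) ∂P := by
    intro ω
    rw [hB0, ← Complex.exp_add, signalForm, map_add]
    push_cast
    ring_nf
  symm
  refine ae_eq_condExp_of_forall_setIntegral_eq hθ.comap_le (integrable_char P hz φ) ?_ ?_ ?_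
  · intro s _ _
    simp only [hRHS]
    exact ((CondGaussian.integrable P h.scatterer hμφ).mul_const _).integrableOn
  · rintro _ ⟨E, hE, rfl⟩ -
    simp only [hRHS]
    rw [integral_mul_const,
      ← CondGaussian.setIntegral_eq P hθ h.measurable_scatterer h.scatterer hμφ hE,
      setIntegral_congr_ae (hθ hE) (hzeq.mono fun ω hω _ => hω), ← integral_indicator (hθ hE),
      ← integral_indicator (hθ hE)]
    -- The indicator of `θ ∈ E` is absorbed into a function of the pair `(θ, μ)`, so that
    -- independence of `ξ` from the pair applies.
    have hf : Measurable fun q : Θ × TDist 𝕜 => (E ×ˢ Set.univ).indicator (fun q => A q.2) q :=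
      ((measurable_char (transpose ε φ)).comp measurable_snd).indicator (hE.prod MeasurableSet.univ)
    have := h.indep.symm.integral_fun_comp_mul_comp
      (hθ.prodMk h.measurable_scatterer).aemeasurable h.measurable_noise.aemeasurable
      hf.aestronglyMeasurable (measurable_char (a • φ)).aestronglyMeasurable
    have e1 : ∀ ω, (E ×ˢ Set.univ).indicator (fun q : Θ × TDist 𝕜 => A q.2) (θ ω, μ ω)
        = (θ ⁻¹' E).indicator (fun ω => A (μ ω)) ω := fun ω => by
      by_cases hω : θ ω ∈ E <;> simp [Set.indicator, hω]
    simp only [e1] at this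
    refine this.symm.trans (integral_congr_ae (Eventually.of_forall fun ω => ?_))
    by_cases hω : θ ω ∈ E <;> simp [Set.indicator, hω, hB]
  · refine (Measurable.stronglyMeasurable ?_).aestronglyMeasurable
    have hc : Measurable fun t =>
        Complex.exp (((-(RCLike.re (signalForm ε T L (v t) φ φ)) / 2 : ℝ) : ℂ)) :=
      Complex.measurable_exp.comp (Complex.measurable_ofReal.comp
        (((RCLike.measurable_re.comp
          ((continuous_signalForm ε T L φ φ).measurable.comp hv)).neg).div_const 2))
    exact hc.comp (comap_measurable θ)

theorem sum_smul_apply {M : ℕ} (u : TDist 𝕜) (φ : Fin M → Test 𝕜) (w : Fin M → 𝕜) :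
    u (∑ i, w i • φ i) = w ⬝ᵥ fun i => u (φ i) :=
  (map_sum u.toLin (fun i => w i • φ i) Finset.univ).trans
    (Finset.sum_congr rfl fun i _ => u.toLin.map_smul (w i) (φ i))

theorem sum_smul_mem_span {M : ℕ} (φ : Fin M → Test 𝕜) (w : Fin M → 𝕜) :
    ∑ i, w i • φ i ∈ Submodule.span 𝕜 (Set.range φ) :=
  Submodule.sum_mem _ fun i _ => Submodule.smul_mem _ _ (Submodule.subset_span ⟨i, rfl⟩)

theorem measurable_sigmaMat (ε : TDist 𝕜) (T : ℝ) (L : Discretization) (φ : Fin L.M → Test 𝕜) :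
    Measurable (sigmaMat ε T L φ) := by
  rw [← coe_sigmaAff]
  exact (continuous_affine_matrix (sigmaAff ε T L φ)).measurable

theorem condDistrib_obs_of_affineIW_prior (P : Measure Ω) [IsProbabilityMeasure P] {ε : TDist 𝕜}
    {T : ℝ} {z : Ω → TDist 𝕜} (hz : Measurable z) (L : Discretization) (φ : Fin L.M → Test 𝕜)
    {v : Ω → Fin L.N → ℝ} (D : Set (Fin L.N → ℝ)) (Ψ : Matrix (Fin L.M) (Fin L.M) 𝕜) (ν : ℝ)
    (hv : Measurable v)
    (h : CondGaussian P v z (fun ω => signalForm ε T L (v ω)) (Submodule.span 𝕜 (Set.range φ)))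
    (hprior : P.map v = affineIW (sigmaMat ε T L φ) D Ψ ν) :
    ∀ᵐ ω ∂P, condDistrib v (obs z φ) P (obs z φ ω) =
      affineIW (sigmaMat ε T L φ) D (outer (obs z φ ω) + Ψ) (ν + 1) := by
  refine condDistrib_of_affineIW_prior P (measurable_obs hz φ) hv (measurable_sigmaMat ε T L φ) D Ψ
    ν hprior fun w E hE => ?_
  have := h.setIntegral_eq P hv hz (sum_smul_mem_span φ w) hE
  simpa only [sum_smul_apply, signalForm_span] using! this

end Conditional

/-! ### Weak convergence of posteriors and generation of the σ-algebra of the signal. -/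

section Limit

open scoped ENNReal

/-- Finite unions of basic open sets exhaust any open set from inside, which gives the portmanteau
inequality for open sets. There are only countably many such unions, so almost sure convergence can
be arranged for all of them at once. -/
theorem tendsto_integral_of_tendsto_measureReal_finset_biUnion {E : Type*} [TopologicalSpace E]
    [SecondCountableTopology E] [MeasurableSpace E] [OpensMeasurableSpace E] {μ : Measure E}
    {μs : ℕ → Measure E} [IsProbabilityMeasure μ] [∀ n, IsProbabilityMeasure (μs n)]
    (h : ∀ s : Finset (TopologicalSpace.countableBasis E),
      Tendsto (fun n => (μs n).real (⋃ b ∈ s, (b : Set E))) atTop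
        (𝓝 (μ.real (⋃ b ∈ s, (b : Set E)))))
    (f : BoundedContinuousFunction E ℝ) :
    Tendsto (fun n => ∫ x, f x ∂(μs n)) atTop (𝓝 (∫ x, f x ∂μ)) := by
  have hopen : ∀ G, IsOpen G → μ G ≤ liminf (fun n => μs n G) atTop := by
    intro G hG
    let ι := {s : Finset (TopologicalSpace.countableBasis E) // ∀ b ∈ s, (b : Set E) ⊆ G}
    let V : ι → Set E := fun s => ⋃ b ∈ s.1, (b : Set E)
    have hV : ⋃ s, V s = G := by
      refine Set.Subset.antisymm (Set.iUnion_subset fun s => Set.iUnion₂_subset s.2) fun x hx => ?_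
      obtain ⟨b, hb, hxb, hbG⟩ :=
        (TopologicalSpace.isBasis_countableBasis E).exists_subset_of_mem_open hx hG
      refine Set.mem_iUnion.2 ⟨⟨{⟨b, hb⟩}, by simpa using hbG⟩, ?_⟩
      simpa [V] using ⟨hb, hxb⟩
    have hdir : Directed (· ⊆ ·) V := by
      classical
      intro s t
      refine ⟨⟨s.1 ∪ t.1, fun b hb => ?_⟩, ?_, ?_⟩
      · exact (Finset.mem_union.1 hb).elim (s.2 b) (t.2 b)
      · exact Set.biUnion_subset_biUnion_left fun b hb => Finset.mem_union_left _ hb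
      · exact Set.biUnion_subset_biUnion_left fun b hb => Finset.mem_union_right _ hb
    have : Countable (TopologicalSpace.countableBasis E) :=
      TopologicalSpace.countable_countableBasis E
    have hμ : μ G = ⨆ s, μ (V s) := by rw [← hV, hdir.measure_iUnion]
    rw [hμ]
    refine iSup_le fun s => ?_
    have ht : Tendsto (fun n => μs n (V s)) atTop (𝓝 (μ (V s))) := by
      have := (ENNReal.continuous_ofReal.tendsto _).comp (h s.1)
      simpa [Function.comp_def, V] using this
    rw [← ht.liminf_eq]
    refine liminf_le_liminf (Eventually.of_forall fun n => measure_mono ?_)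
    exact Set.iUnion₂_subset s.2
  have := tendsto_of_forall_isOpen_le_liminf_nat' (μ := ⟨μ, inferInstance⟩)
    (μs := fun n => ⟨μs n, inferInstance⟩) hopen
  exact ProbabilityMeasure.tendsto_iff_forall_integral_tendsto.1 this f

/-- Conditional laws given an increasing sequence of observations converge weakly, almost surely,
to the conditional law given the whole sequence. -/
theorem ae_tendsto_integral_condDistrib {Ω : Type*} [mΩ : MeasurableSpace Ω] {E F : Type*}
    [TopologicalSpace E]
    [SecondCountableTopology E] [MeasurableSpace E] [OpensMeasurableSpace E] [StandardBorelSpace E]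
    [Nonempty E] [MeasurableSpace F] {G : ℕ → Type*} [∀ n, MeasurableSpace (G n)] (P : Measure Ω)
    [IsProbabilityMeasure P] {V : Ω → E} (hV : Measurable V) {Z : Ω → F} (hZ : Measurable Z)
    {Y : (n : ℕ) → Ω → G n} (hY : ∀ n, Measurable (Y n))
    (hmono : Monotone fun n => MeasurableSpace.comap (Y n) inferInstance)
    (hsup : MeasurableSpace.comap Z inferInstance
      = ⨆ n, MeasurableSpace.comap (Y n) inferInstance) :
    ∀ᵐ ω ∂P, ∀ f : BoundedContinuousFunction E ℝ,
      Tendsto (fun n => ∫ x, f x ∂(condDistrib V (Y n) P (Y n ω))) atTop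
        (𝓝 (∫ x, f x ∂(condDistrib V Z P (Z ω)))) := by
  let ℱ : Filtration ℕ mΩ :=
    { seq := fun n => MeasurableSpace.comap (Y n) inferInstance
      mono' := hmono
      le' := fun n => (hY n).comap_le }
  have hopen : ∀ s : Finset (TopologicalSpace.countableBasis E),
      MeasurableSet (⋃ b ∈ s, (b : Set E)) := fun s =>
    Finset.measurableSet_biUnion s fun b _ =>
      (TopologicalSpace.isOpen_of_mem_countableBasis b.2).measurableSet
  have : Countable (TopologicalSpace.countableBasis E) :=
    TopologicalSpace.countable_countableBasis E
  have h : ∀ s : Finset (TopologicalSpace.countableBasis E), ∀ᵐ ω ∂P,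
      Tendsto (fun n => (condDistrib V (Y n) P (Y n ω)).real (⋃ b ∈ s, (b : Set E))) atTop
        (𝓝 ((condDistrib V Z P (Z ω)).real (⋃ b ∈ s, (b : Set E)))) := by
    intro s
    -- Lévy's upward theorem for the event that `V` lies in the given finite union.
    have h1 := tendsto_ae_condExp (μ := P) (ℱ := ℱ)
      ((V ⁻¹' (⋃ b ∈ s, (b : Set E))).indicator fun _ => (1 : ℝ))
    have h2 := condDistrib_ae_eq_condExp (μ := P) hZ hV (hopen s)
    have h3 := ae_all_iff.2 fun n => condDistrib_ae_eq_condExp (μ := P) (hY n) hV (hopen s)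
    rw [hsup] at h2
    filter_upwards [h1, h2, h3] with ω h1 h2 h3
    rw [h2]
    exact h1.congr fun n => (h3 n).symm
  filter_upwards [ae_all_iff.2 h] with ω hω f
  exact tendsto_integral_of_tendsto_measureReal_finset_biUnion hω f

variable {Ω : Type*} {𝕜 : Type*} [RCLike 𝕜]

theorem comap_obs_mono {z : Ω → TDist 𝕜} (φ : ℕ → Test 𝕜) {M M' : ℕ} (h : M ≤ M') :
    MeasurableSpace.comap (obs z fun i : Fin M => φ i) inferInstance
      ≤ MeasurableSpace.comap (obs z fun i : Fin M' => φ i) inferInstance := by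
  have : (obs z fun i : Fin M => φ i)
      = (fun y i => y (Fin.castLE h i)) ∘ obs z fun i : Fin M' => φ i := rfl
  rw [this, ← MeasurableSpace.comap_comp]
  refine MeasurableSpace.comap_mono (Measurable.comap_le ?_)
  exact measurable_pi_iff.2 fun i => measurable_pi_apply _

/-- Evaluations on the span of the `φ i` are measurable for the observations, and by continuity
every other evaluation is a pointwise limit of these. -/
theorem comap_eq_iSup_comap_obs {z : Ω → TDist 𝕜} {φ : ℕ → Test 𝕜} (hφ : Total φ) {M : ℕ → ℕ}
    (hM : Tendsto M atTop atTop) :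
    MeasurableSpace.comap z inferInstance
      = ⨆ n, MeasurableSpace.comap (obs z fun i : Fin (M n) => φ i) inferInstance := by
  refine le_antisymm ?_ (iSup_le fun n => ?_)
  · set m : MeasurableSpace Ω :=
      ⨆ n, MeasurableSpace.comap (obs z fun i : Fin (M n) => φ i) inferInstance with hm
    have hgen : ∀ i, Measurable[m] fun ω => z ω (φ i) := by
      intro i
      obtain ⟨n, hn⟩ := (hM.eventually (eventually_gt_atTop i)).exists
      refine Measurable.mono (comap_measurable (fun ω => z ω (φ i))) ?_ le_rfl
      refine le_trans ?_ (le_iSup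
        (fun n => MeasurableSpace.comap (obs z fun i : Fin (M n) => φ i) inferInstance) n)
      have : (fun ω => z ω (φ i)) = (fun y => y ⟨i, hn⟩) ∘ obs z fun i : Fin (M n) => φ i := rfl
      rw [this, ← MeasurableSpace.comap_comp]
      exact MeasurableSpace.comap_mono (measurable_pi_apply _).comap_le
    have hspan : ∀ η ∈ Submodule.span 𝕜 (Set.range φ), Measurable[m] fun ω => z ω η := by
      intro η hη
      induction hη using Submodule.span_induction with
      | mem x hx =>
        obtain ⟨i, rfl⟩ := hx
        exact hgen i
      | zero =>
        have : (fun ω => z ω (0 : Test 𝕜)) = fun _ => 0 := funext fun ω => (z ω).toLin.map_zero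
        rw [this]
        exact measurable_const
      | add x y _ _ hx hy =>
        have : (fun ω => z ω (x + y)) = fun ω => z ω x + z ω y :=
          funext fun ω => (z ω).toLin.map_add x y
        rw [this]
        exact hx.add hy
      | smul a x _ hx =>
        have : (fun ω => z ω (a • x)) = fun ω => a * z ω x :=
          funext fun ω => (z ω).toLin.map_smul a x
        rw [this]
        exact hx.const_mul a
    have hall : ∀ ψ : Test 𝕜, Measurable[m] fun ω => z ω ψ := by
      intro ψ
      -- The order and the constant of the distribution `z ω` depend on `ω`. Controlling `n`
      -- derivatives at the `n`-th approximation eventually covers every order with one sequence.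
      choose η hη hb using fun n : ℕ => hφ ψ n (1 / ((n : ℝ) + 1)) (by positivity)
      refine @measurable_of_tendsto_metrizable Ω 𝕜 m _ _ _ _ (fun n ω => z ω (η n)) _
        (fun n => hspan (η n) (hη n)) ?_
      refine tendsto_pi_nhds.2 fun ω => ?_
      obtain ⟨C, k, hC⟩ := (z ω).bound
      rw [tendsto_iff_norm_sub_tendsto_zero]
      have hlim : Tendsto (fun n : ℕ => C * (1 / ((n : ℝ) + 1))) atTop (𝓝 0) := by
        simpa using tendsto_one_div_add_atTop_nhds_zero_nat.const_mul C
      refine squeeze_zero' (Eventually.of_forall fun n => norm_nonneg _) ?_ hlim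
      filter_upwards [eventually_ge_atTop k] with n hn
      have e : z ω (η n) - z ω ψ = -z ω (ψ - η n) := by
        rw [(z ω).toLin.map_sub]
        ring
      rw [e, norm_neg]
      exact hC _ _ fun j hj t => hb n j (hj.trans hn) t
    rintro _ ⟨s, hs, rfl⟩
    have hz : Measurable[m] z := by
      refine measurable_iff_comap_le.2 ?_
      simp only [instMeasurableSpaceTDist, MeasurableSpace.comap_iSup, MeasurableSpace.comap_comp]
      exact iSup_le fun ψ => (hall ψ).comap_le
    exact hz hs
  · have : (obs z fun i : Fin (M n) => φ i)
        = (fun (u : TDist 𝕜) (i : Fin (M n)) => u (φ i)) ∘ z := rfl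
    rw [this, ← MeasurableSpace.comap_comp]
    refine MeasurableSpace.comap_mono (Measurable.comap_le ?_)
    exact measurable_pi_iff.2 fun i => measurable_eval (φ i)

end Limit

/-! ### Schur complement factorization of the inverse Wishart density. -/

section BlockFactorization

open scoped ComplexOrder ENNReal

variable {𝕜 : Type*} [RCLike 𝕜]

open Classical in
/-- The inverse Wishart density with arbitrary exponent and arbitrary index type. -/
noncomputable def iwFun {ι : Type*} [Fintype ι] [DecidableEq ι] (a : ℝ) (Φ A : Matrix ι ι 𝕜) : ℝ :=
  if A.PosDef then (RCLike.re A.det) ^ a * Real.exp (-(RCLike.re (Φ * A⁻¹).trace) / 2) else 0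

theorem iwFun_nonneg {ι : Type*} [Fintype ι] [DecidableEq ι] (a : ℝ) (Φ A : Matrix ι ι 𝕜) :
    0 ≤ iwFun a Φ A := by
  unfold iwFun
  split_ifs with h
  · exact mul_nonneg (Real.rpow_nonneg (RCLike.pos_iff.1 h.det_pos).1.le _) (Real.exp_nonneg _)
  · exact le_rfl

theorem iwFun_submatrix {ι κ : Type*} [Fintype ι] [DecidableEq ι] [Fintype κ] [DecidableEq κ]
    (e : ι ≃ κ) (a : ℝ) (Φ A : Matrix κ κ 𝕜) :
    iwFun a (Φ.submatrix e e) (A.submatrix e e) = iwFun a Φ A := by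
  have h : (A.submatrix e e).PosDef ↔ A.PosDef := by
    refine ⟨fun h => ?_, fun h => h.submatrix e.injective⟩
    have := h.submatrix e.symm.injective
    simpa using this
  have ht : ∀ B : Matrix κ κ 𝕜, (B.submatrix e e).trace = B.trace := fun B => by
    simp only [Matrix.trace, Matrix.diag, Matrix.submatrix_apply]
    exact e.sum_comp fun i => B i i
  unfold iwFun
  rw [Matrix.det_submatrix_equiv_self, Matrix.inv_submatrix_equiv, Matrix.submatrix_mul_equiv, ht]
  by_cases hA : A.PosDef
  · rw [if_pos (h.2 hA), if_pos hA]
  · rw [if_neg (fun h' => hA (h.1 h')), if_neg hA]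

/-- The factor of the inverse Wishart density which depends on the Schur complement `C` and
on `G = A⁻¹ B` for a block matrix with first row `A`, `B`. -/
noncomputable def schurFactor {m n : Type*} [Fintype m] [Fintype n] [DecidableEq n]
    (a : ℝ) (Φ : Matrix (m ⊕ n) (m ⊕ n) 𝕜) (G : Matrix m n 𝕜) (C : Matrix n n 𝕜) : ℝ :=
  open Classical in
  if C.PosDef then (RCLike.re C.det) ^ a *
    Real.exp (-(RCLike.re ((Φ.toBlocks₁₁ * (G * C⁻¹ * Gᴴ) + Φ.toBlocks₁₂ * -(C⁻¹ * Gᴴ)).trace +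
      (Φ.toBlocks₂₁ * -(G * C⁻¹) + Φ.toBlocks₂₂ * C⁻¹).trace)) / 2) else 0

theorem trace_fromBlocks {m n : Type*} [Fintype m] [Fintype n] (A : Matrix m m 𝕜)
    (B : Matrix m n 𝕜) (C : Matrix n m 𝕜) (D : Matrix n n 𝕜) :
    (Matrix.fromBlocks A B C D).trace = A.trace + D.trace := by
  simp [Matrix.trace, Fintype.sum_sum_type]

/-- With `G = A⁻¹ B` and the Schur complement `C` as coordinates, the determinant is `det A * det
C`. In the inverse, `A` enters only through the summand `A⁻¹` of the leading block, so the kernel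
splits and the second factor is free of `A`. -/
theorem iwFun_fromBlocks {m n : Type*} [Fintype m] [DecidableEq m] [Fintype n] [DecidableEq n]
    (a : ℝ) (Φ : Matrix (m ⊕ n) (m ⊕ n) 𝕜) {A : Matrix m m 𝕜} (hA : A.PosDef) (G : Matrix m n 𝕜)
    (C : Matrix n n 𝕜) :
    iwFun a Φ (Matrix.fromBlocks A (A * G) (A * G)ᴴ (C + Gᴴ * A * G))
      = iwFun a Φ.toBlocks₁₁ A * schurFactor a Φ G C := by
  have hAu : IsUnit A.det := (Matrix.isUnit_iff_isUnit_det A).1 hA.isUnit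
  let iA : Invertible A := A.invertibleOfIsUnitDet hAu
  have hAA : Aᴴ = A := hA.isHermitian
  have hschur : C + Gᴴ * A * G - (A * G)ᴴ * A⁻¹ * (A * G) = C := by
    have : (A * G)ᴴ * A⁻¹ * (A * G) = Gᴴ * A * G := by
      rw [Matrix.conjTranspose_mul, hAA, Matrix.mul_assoc Gᴴ, Matrix.mul_nonsing_inv _ hAu,
        Matrix.mul_one, Matrix.mul_assoc]
    rw [this, add_sub_cancel_right]
  have hpsd := Matrix.PosDef.fromBlocks₁₁ (A * G) (C + Gᴴ * A * G) hA
  rw [hschur] at hpsd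
  have hdet : (Matrix.fromBlocks A (A * G) (A * G)ᴴ (C + Gᴴ * A * G)).det = A.det * C.det := by
    rw [Matrix.det_fromBlocks₁₁, Matrix.invOf_eq_nonsing_inv, hschur]
  have hpd : (Matrix.fromBlocks A (A * G) (A * G)ᴴ (C + Gᴴ * A * G)).PosDef ↔ C.PosDef := by
    constructor
    · intro h
      refine (hpsd.1 h.posSemidef).posDef_iff_det_ne_zero.2 fun h0 => ?_
      refine h.posSemidef.posDef_iff_det_ne_zero.1 h ?_
      rw [hdet, h0, mul_zero]
    · intro h
      refine (hpsd.2 h.posSemidef).posDef_iff_det_ne_zero.2 ?_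
      rw [hdet]
      exact mul_ne_zero hA.det_pos.ne' h.det_pos.ne'
  unfold iwFun schurFactor
  by_cases hC : C.PosDef
  · have hCu : IsUnit C.det := (Matrix.isUnit_iff_isUnit_det C).1 hC.isUnit
    have hinv : (Matrix.fromBlocks A (A * G) (A * G)ᴴ (C + Gᴴ * A * G))⁻¹
        = Matrix.fromBlocks (A⁻¹ + G * C⁻¹ * Gᴴ) (-(G * C⁻¹)) (-(C⁻¹ * Gᴴ)) C⁻¹ := by
      refine Matrix.inv_eq_right_inv ?_
      rw [Matrix.fromBlocks_multiply, ← Matrix.fromBlocks_one, Matrix.conjTranspose_mul, hAA]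
      have e1 : A * A⁻¹ = 1 := Matrix.mul_nonsing_inv _ hAu
      have e2 : C * C⁻¹ = 1 := Matrix.mul_nonsing_inv _ hCu
      congr 1
      · rw [Matrix.mul_add, e1, Matrix.mul_neg]
        simp only [Matrix.mul_assoc]
        abel
      · rw [Matrix.mul_neg]
        simp only [Matrix.mul_assoc]
        abel
      · rw [Matrix.mul_add, Matrix.mul_neg, Matrix.add_mul, Matrix.mul_assoc Gᴴ A A⁻¹, e1,
          ← Matrix.mul_assoc C, e2]
        simp only [Matrix.mul_assoc, Matrix.mul_one, Matrix.one_mul]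
        abel
      · rw [Matrix.mul_neg, Matrix.add_mul, e2]
        simp only [Matrix.mul_assoc]
        abel
    have hdA : 0 < RCLike.re A.det := (RCLike.pos_iff.1 hA.det_pos).1
    have hdC : 0 < RCLike.re C.det := (RCLike.pos_iff.1 hC.det_pos).1
    have hre : RCLike.re (A.det * C.det) = RCLike.re A.det * RCLike.re C.det := by
      rw [RCLike.mul_re, (RCLike.pos_iff.1 hA.det_pos).2, zero_mul, sub_zero]
    rw [if_pos (hpd.2 hC), if_pos hA, if_pos hC, hdet, hre, Real.mul_rpow hdA.le hdC.le,
      mul_mul_mul_comm, ← Real.exp_add, hinv]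
    congr 2
    nth_rewrite 1 [← Φ.fromBlocks_toBlocks]
    rw [Matrix.fromBlocks_multiply, trace_fromBlocks, Matrix.mul_add, add_assoc,
      Matrix.trace_add, add_assoc, map_add]
    ring
  · rw [if_neg (fun h => hC (hpd.1 h)), if_neg hC, mul_zero]

/-- Left multiplication by a square matrix, on `q × r` matrices. -/
noncomputable def leftMul (𝕜 : Type*) [RCLike 𝕜] (q r : ℕ) : Matrix (Fin q) (Fin q) 𝕜 →ₗ[ℝ]
    (Fin q → Fin r → 𝕜) →ₗ[ℝ] (Fin q → Fin r → 𝕜) :=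
  LinearMap.mk₂ ℝ (fun A b => Matrix.of.symm (A * Matrix.of b))
    (fun A B b => Matrix.add_mul A B (Matrix.of b)) (fun c A b => Matrix.smul_mul c A (Matrix.of b))
    (fun A b b' => Matrix.mul_add A (Matrix.of b) (Matrix.of b'))
    (fun c A b => Matrix.mul_smul A c (Matrix.of b))

theorem det_leftMul_ne_zero {q r : ℕ} {A : Matrix (Fin q) (Fin q) 𝕜} (hA : IsUnit A.det) :
    LinearMap.det (leftMul 𝕜 q r A) ≠ 0 := by
  have h : leftMul 𝕜 q r A⁻¹ ∘ₗ leftMul 𝕜 q r A = LinearMap.id := by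
    refine LinearMap.ext fun b => ?_
    show A⁻¹ * (A * Matrix.of b) = b
    rw [← Matrix.mul_assoc, Matrix.nonsing_inv_mul _ hA, Matrix.one_mul]
    rfl
  have := congrArg LinearMap.det h
  rw [LinearMap.det_comp, LinearMap.det_id] at this
  exact right_ne_zero_of_mul_eq_one this

/-- This determinant is the Jacobian of `G ↦ A G`. Only its nonvanishing and measurability matter,
because it depends on `A` alone. -/
theorem continuous_det_leftMul (q r : ℕ) :
    Continuous fun A : Matrix (Fin q) (Fin q) 𝕜 => LinearMap.det (leftMul 𝕜 q r A) := by
  have h : Continuous ((LinearMap.toContinuousLinearMap :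
      ((Fin q → Fin r → 𝕜) →ₗ[ℝ] (Fin q → Fin r → 𝕜)) ≃ₗ[ℝ] _).toLinearMap ∘ₗ leftMul 𝕜 q r) :=
    LinearMap.continuous_of_finiteDimensional _
  exact ContinuousLinearMap.continuous_det.comp h

/-- The density of the leading `q × q` block of an inverse Wishart matrix of size `q + r`, up to
a factor. -/
noncomputable def blockDensity {q : ℕ} (r : ℕ) (a : ℝ) (Φ A : Matrix (Fin q) (Fin q) 𝕜) : ℝ≥0∞ :=
  ENNReal.ofReal (iwFun a Φ A) * ENNReal.ofReal |LinearMap.det (leftMul 𝕜 q r A)|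

theorem measurable_iwFun (q : ℕ) (a : ℝ) :
    Measurable fun x : Matrix (Fin q) (Fin q) 𝕜 × Matrix (Fin q) (Fin q) 𝕜 => iwFun a x.1 x.2 := by
  classical
  unfold iwFun
  refine Measurable.ite (measurable_snd (measurableSet_posDef q)) ?_ measurable_const
  exact (((measurable_re_det q).comp measurable_snd).pow_const _).mul
    (Real.measurable_exp.comp ((measurable_re_trace_mul_inv q).neg.div_const _))

theorem measurable_blockDensity (q r : ℕ) (a : ℝ) :
    Measurable fun x : Matrix (Fin q) (Fin q) 𝕜 × Matrix (Fin q) (Fin q) 𝕜 =>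
      blockDensity r a x.1 x.2 :=
  (measurable_iwFun q a).ennreal_ofReal.mul
    (((continuous_det_leftMul q r).measurable.comp measurable_snd).abs.ennreal_ofReal)

end BlockFactorization

/-! ### Integrating out all but the leading block. -/

section BlockMarginal

open scoped ComplexOrder ENNReal

variable {𝕜 : Type*} [RCLike 𝕜] {q N N' : ℕ}

/-- The block matrices with leading block `S x`, off-diagonal block `b` and last block
`hermCoord c`. -/
noncomputable def blockAff (r : ℕ) (S : (Fin N → ℝ) →ᵃ[ℝ] Matrix (Fin q) (Fin q) 𝕜) :
    (Fin N → ℝ) × (Fin q → Fin r → 𝕜) × (Fin (Module.finrank ℝ (Herm 𝕜 r)) → ℝ) →ᵃ[ℝ]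
      Matrix (Fin (q + r)) (Fin (q + r)) 𝕜 where
  toFun y := (Matrix.fromBlocks (S y.1) (Matrix.of y.2.1) (Matrix.of y.2.1)ᴴ
    (hermCoord 𝕜 r y.2.2)).submatrix finSumFinEquiv.symm finSumFinEquiv.symm
  linear :=
    { toFun := fun y => (Matrix.fromBlocks (S.linear y.1) (Matrix.of y.2.1) (Matrix.of y.2.1)ᴴ
        (hermCoordLin 𝕜 r y.2.2)).submatrix finSumFinEquiv.symm finSumFinEquiv.symm
      map_add' := fun y y' => by
        have h := Matrix.fromBlocks_add (S.linear y.1) (Matrix.of y.2.1) (Matrix.of y.2.1)ᴴ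
          (hermCoordLin 𝕜 r y.2.2) (S.linear y'.1) (Matrix.of y'.2.1) (Matrix.of y'.2.1)ᴴ
          (hermCoordLin 𝕜 r y'.2.2)
        show (Matrix.fromBlocks (S.linear (y.1 + y'.1)) (Matrix.of y.2.1 + Matrix.of y'.2.1)
          (Matrix.of y.2.1 + Matrix.of y'.2.1)ᴴ (hermCoordLin 𝕜 r (y.2.2 + y'.2.2))).submatrix
            finSumFinEquiv.symm finSumFinEquiv.symm = _
        rw [map_add, map_add, Matrix.conjTranspose_add, ← h]
        rfl
      map_smul' := fun c y => by
        have h := Matrix.fromBlocks_smul c (S.linear y.1) (Matrix.of y.2.1) (Matrix.of y.2.1)ᴴ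
          (hermCoordLin 𝕜 r y.2.2)
        show (Matrix.fromBlocks (S.linear (c • y.1)) (c • Matrix.of y.2.1)
          (c • Matrix.of y.2.1)ᴴ (hermCoordLin 𝕜 r (c • y.2.2))).submatrix
            finSumFinEquiv.symm finSumFinEquiv.symm = _
        rw [map_smul, map_smul, Matrix.conjTranspose_smul, star_trivial, ← h]
        rfl }
  map_vadd' y y' := by
    have h := Matrix.fromBlocks_add (S.linear y'.1) (Matrix.of y'.2.1) (Matrix.of y'.2.1)ᴴ
      (hermCoordLin 𝕜 r y'.2.2) (S y.1) (Matrix.of y.2.1) (Matrix.of y.2.1)ᴴ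
      (hermCoordLin 𝕜 r y.2.2)
    show (Matrix.fromBlocks (S (y'.1 +ᵥ y.1)) (Matrix.of y'.2.1 + Matrix.of y.2.1)
      (Matrix.of y'.2.1 + Matrix.of y.2.1)ᴴ (hermCoordLin 𝕜 r (y'.2.2 + y.2.2))).submatrix
        finSumFinEquiv.symm finSumFinEquiv.symm = _
    rw [AffineMap.map_vadd, vadd_eq_add, map_add, Matrix.conjTranspose_add, ← h]
    rfl

theorem blockAff_apply (r : ℕ) (S : (Fin N → ℝ) →ᵃ[ℝ] Matrix (Fin q) (Fin q) 𝕜)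
    (y : (Fin N → ℝ) × (Fin q → Fin r → 𝕜) × (Fin (Module.finrank ℝ (Herm 𝕜 r)) → ℝ)) :
    blockAff r S y = (Matrix.fromBlocks (S y.1) (Matrix.of y.2.1) (Matrix.of y.2.1)ᴴ
      (hermCoord 𝕜 r y.2.2)).submatrix finSumFinEquiv.symm finSumFinEquiv.symm := rfl

/-- Substituting `b = A G` and translating the last block by `Gᴴ A G` turns the integrand into the
Schur factorization, and the remaining integral no longer involves `A`. If `A` is not positive
definite, neither is any matrix with leading block `A`, and both sides vanish. -/
theorem lintegral_iwFun_fromBlocks (r : ℕ) (a : ℝ)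
    (Φ : Matrix (Fin q ⊕ Fin r) (Fin q ⊕ Fin r) 𝕜) (A : Matrix (Fin q) (Fin q) 𝕜) :
    ∫⁻ b : Fin q → Fin r → 𝕜, ∫⁻ c, ENNReal.ofReal (iwFun a Φ
        (Matrix.fromBlocks A (Matrix.of b) (Matrix.of b)ᴴ (hermCoord 𝕜 r c)))
        ∂volume ∂Measure.addHaar
      = blockDensity r a Φ.toBlocks₁₁ A *
        ∫⁻ b : Fin q → Fin r → 𝕜, ∫⁻ c,
          ENNReal.ofReal (schurFactor a Φ (Matrix.of b) (hermCoord 𝕜 r c))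
          ∂volume ∂Measure.addHaar := by
  by_cases hA : A.PosDef
  · have hAu : IsUnit A.det := (Matrix.isUnit_iff_isUnit_det A).1 hA.isUnit
    have hdet := det_leftMul_ne_zero (r := r) hAu
    have hemb : MeasurableEmbedding (leftMul 𝕜 q r A) := by
      refine (LinearMap.isClosedEmbedding_of_injective ?_).measurableEmbedding
      exact LinearMap.ker_eq_bot.2 (LinearMap.equivOfDetNeZero _ hdet).injective
    have hmap := Measure.map_linearMap_addHaar_eq_smul_addHaar
      (Measure.addHaar : Measure (Fin q → Fin r → 𝕜)) hdet
    have hsub : ∀ φ : (Fin q → Fin r → 𝕜) → ℝ≥0∞, ∫⁻ b, φ b ∂Measure.addHaar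
        = ENNReal.ofReal |LinearMap.det (leftMul 𝕜 q r A)| *
          ∫⁻ b, φ (leftMul 𝕜 q r A b) ∂Measure.addHaar := by
      intro φ
      rw [← hemb.lintegral_map, hmap, lintegral_smul_measure, smul_eq_mul, ← mul_assoc,
        ← ENNReal.ofReal_mul (abs_nonneg _), ← abs_mul, mul_inv_cancel₀ hdet, abs_one,
        ENNReal.ofReal_one, one_mul]
    have hinner : ∀ b : Fin q → Fin r → 𝕜, ∫⁻ c, ENNReal.ofReal (iwFun a Φ
        (Matrix.fromBlocks A (Matrix.of (leftMul 𝕜 q r A b)) (Matrix.of (leftMul 𝕜 q r A b))ᴴ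
          (hermCoord 𝕜 r c)))
        = ENNReal.ofReal (iwFun a Φ.toBlocks₁₁ A) *
          ∫⁻ c, ENNReal.ofReal (schurFactor a Φ (Matrix.of b) (hermCoord 𝕜 r c)) := by
      intro b
      have hG : ((Matrix.of b)ᴴ * A * Matrix.of b).IsHermitian :=
        Matrix.isHermitian_conjTranspose_mul_mul _ hA.isHermitian
      obtain ⟨c₀, hc₀⟩ := exists_hermCoord_eq hG
      rw [← lintegral_add_right_eq_self _ c₀, ← lintegral_const_mul' _ _ ENNReal.ofReal_ne_top]
      refine lintegral_congr fun c => ?_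
      have e : hermCoord 𝕜 r (c + c₀) = hermCoord 𝕜 r c + (Matrix.of b)ᴴ * A * Matrix.of b := by
        rw [← hc₀]
        exact (hermCoordLin 𝕜 r).map_add c c₀
      rw [← ENNReal.ofReal_mul (iwFun_nonneg _ _ _), ← iwFun_fromBlocks a Φ hA, e]
      rfl
    rw [hsub]
    simp only [hinner]
    rw [lintegral_const_mul' _ _ ENNReal.ofReal_ne_top, blockDensity, ← mul_assoc,
      mul_comm (ENNReal.ofReal _) (ENNReal.ofReal _)]
  · have h0 : ∀ (B : Matrix (Fin q) (Fin r) 𝕜) (C : Matrix (Fin r) (Fin r) 𝕜),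
        iwFun a Φ (Matrix.fromBlocks A B Bᴴ C) = 0 := fun B C => by
      refine if_neg fun h => hA ?_
      have := h.submatrix (e := (Sum.inl : Fin q → Fin q ⊕ Fin r)) Sum.inl_injective
      exact this
    have h1 : iwFun a Φ.toBlocks₁₁ A = 0 := if_neg hA
    simp [h0, h1, blockDensity]

/-- Any bijective parametrization of the Hermitian matrices agrees, up to an affine bijection, with
the coordinates leading block, off-diagonal block, last block. -/
theorem exists_affine_blockAff_eq (r : ℕ)
    {S : (Fin N → ℝ) →ᵃ[ℝ] Matrix (Fin (q + r)) (Fin (q + r)) 𝕜}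
    (hS : Set.BijOn S Set.univ {H | H.IsHermitian})
    {S' : (Fin N' → ℝ) →ᵃ[ℝ] Matrix (Fin q) (Fin q) 𝕜}
    (hS' : Set.BijOn S' Set.univ {H | H.IsHermitian}) :
    ∃ e : (Fin N' → ℝ) × (Fin q → Fin r → 𝕜) × (Fin (Module.finrank ℝ (Herm 𝕜 r)) → ℝ) →ᵃ[ℝ]
      (Fin N → ℝ), Function.Bijective e ∧ ∀ y, S (e y) = blockAff r S' y := by
  obtain ⟨R, hR⟩ := exists_affine_leftInverse (Set.injOn_univ.1 hS.injOn)
  have hherm : ∀ y, (blockAff r S' y).IsHermitian := fun y => by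
    rw [blockAff_apply]
    refine Matrix.IsHermitian.submatrix ?_ _
    exact Matrix.IsHermitian.fromBlocks (hS'.mapsTo (Set.mem_univ _)) rfl
      (isHermitian_hermCoord _)
  have he : ∀ y, S (R (blockAff r S' y)) = blockAff r S' y := fun y => by
    obtain ⟨x, -, hx⟩ := hS.surjOn (hherm y)
    rw [← hx, hR]
  refine ⟨R.comp (blockAff r S'), ⟨fun y y' h => ?_, fun x => ?_⟩, he⟩
  · have h1 : blockAff r S' y = blockAff r S' y' := by
      rw [← he, ← he y']
      exact congrArg S h
    have h2 := congrArg (fun A => A.submatrix finSumFinEquiv finSumFinEquiv) h1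
    simp only [blockAff_apply, Matrix.submatrix_submatrix, Equiv.symm_comp_self,
      Matrix.submatrix_id_id] at h2
    obtain ⟨h3, h4, -, h5⟩ := Matrix.fromBlocks_inj.1 h2
    refine Prod.ext (hS'.injOn (Set.mem_univ _) (Set.mem_univ _) h3) (Prod.ext ?_ ?_)
    · exact Matrix.of.injective h4
    · exact hermCoord_injective r h5
  · set A := (S x).submatrix finSumFinEquiv finSumFinEquiv with hA
    have hAh : A.IsHermitian := Matrix.IsHermitian.submatrix (hS.mapsTo (Set.mem_univ x)) _
    rw [← Matrix.fromBlocks_toBlocks A, Matrix.isHermitian_fromBlocks_iff] at hAh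
    obtain ⟨h1, h2, -, h4⟩ := hAh
    obtain ⟨a, -, ha⟩ := hS'.surjOn h1
    obtain ⟨c, hc⟩ := exists_hermCoord_eq h4
    refine ⟨(a, Matrix.of.symm A.toBlocks₁₂, c), ?_⟩
    show R (blockAff r S' _) = x
    rw [← hR x]
    congr 1
    rw [blockAff_apply]
    simp only [ha, hc, Equiv.apply_symm_apply, h2, Matrix.fromBlocks_toBlocks]
    rw [hA, Matrix.submatrix_submatrix]
    simp

end BlockMarginal

/-! ### Leading blocks of the posterior see only the leading observations. -/

section BlockKernel

open scoped ComplexOrder ENNReal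

variable {𝕜 : Type*} [RCLike 𝕜] {N N' : ℕ}

set_option maxHeartbeats 1000000 in
/-- The law of the leading block under an affine inverse Wishart law has density
`blockDensity`, up to normalization. -/
theorem map_affineIW_block {q r : ℕ} {S : (Fin N → ℝ) →ᵃ[ℝ] Matrix (Fin (q + r)) (Fin (q + r)) 𝕜}
    (hS : Set.BijOn S Set.univ {H | H.IsHermitian})
    {S' : (Fin N' → ℝ) →ᵃ[ℝ] Matrix (Fin q) (Fin q) 𝕜}
    (hS' : Set.BijOn S' Set.univ {H | H.IsHermitian}) {R : (Fin N → ℝ) → (Fin N' → ℝ)}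
    (hRm : Measurable R)
    (hR : ∀ x, S' (R x) = (S x).submatrix (Fin.castAdd r) (Fin.castAdd r))
    (Ψ : Matrix (Fin (q + r)) (Fin (q + r)) 𝕜) (ν : ℝ)
    (hprob : IsProbabilityMeasure (affineIW S Set.univ Ψ ν)) :
    (affineIW S Set.univ Ψ ν).map R = normalized ((volume : Measure (Fin N' → ℝ)).withDensity
      fun x => blockDensity r
        (-((Module.finrank ℝ 𝕜 : ℝ) * (ν + (q + r : ℕ) - 1) / 2 + 1))
        (Ψ.submatrix (Fin.castAdd r) (Fin.castAdd r)) (S' x)) := by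
  -- The exponent stays that of the full size `q + r`; the Jacobian inside `blockDensity` accounts
  -- for the change of size.
  set a : ℝ := -((Module.finrank ℝ 𝕜 : ℝ) * (ν + (q + r : ℕ) - 1) / 2 + 1) with ha
  set Ψ' := Ψ.submatrix finSumFinEquiv finSumFinEquiv with hΨ'
  have hΨ11 : Ψ'.toBlocks₁₁ = Ψ.submatrix (Fin.castAdd r) (Fin.castAdd r) := by
    ext i j
    simp [hΨ', Matrix.toBlocks₁₁]
  set K := ∫⁻ b : Fin q → Fin r → 𝕜, ∫⁻ c,
    ENNReal.ofReal (schurFactor a Ψ' (Matrix.of b) (hermCoord 𝕜 r c))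
    ∂volume ∂Measure.addHaar with hK
  obtain ⟨e, he, heS⟩ := exists_affine_blockAff_eq r hS hS'
  have hem : Measurable e := (AffineMap.continuous_of_finiteDimensional e).measurable
  set μ : Measure ((Fin N' → ℝ) × (Fin q → Fin r → 𝕜) ×
      (Fin (Module.finrank ℝ (Herm 𝕜 r)) → ℝ)) :=
    (volume : Measure (Fin N' → ℝ)).prod
      ((Measure.addHaar : Measure (Fin q → Fin r → 𝕜)).prod volume) with hμ
  have hμ2 : ((Measure.addHaar : Measure (Fin q → Fin r → 𝕜)).prod
      (volume : Measure (Fin (Module.finrank ℝ (Herm 𝕜 r)) → ℝ))).IsAddHaarMeasure :=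
    Measure.prod.instIsAddHaarMeasure _ _
  have hμ3 : μ.IsAddHaarMeasure := Measure.prod.instIsAddHaarMeasure _ _
  obtain ⟨c, hc0, hc1, hc⟩ := map_addHaar_affine μ (volume : Measure (Fin N → ℝ)) e he
  have hRe : ∀ y, R (e y) = y.1 := fun y => by
    refine hS'.injOn (Set.mem_univ _) (Set.mem_univ _) ?_
    rw [hR, heS, blockAff_apply, Matrix.submatrix_submatrix]
    ext i j
    simp
  have hSm : Measurable S := (continuous_affine_matrix S).measurable
  have hSm' : Measurable S' := (continuous_affine_matrix S').measurable
  have hf : Measurable fun x => ENNReal.ofReal (iwKernel Ψ ν (S x)) :=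
    ((measurable_iwKernel (q + r) ν).comp (measurable_const.prodMk hSm)).ennreal_ofReal
  have hb : Measurable fun x => blockDensity r a Ψ'.toBlocks₁₁ (S' x) :=
    (measurable_blockDensity q r a).comp (measurable_const.prodMk hSm')
  have hval : ∀ y, iwKernel Ψ ν (S (e y)) = iwFun a Ψ' (Matrix.fromBlocks (S' y.1)
      (Matrix.of y.2.1) (Matrix.of y.2.1)ᴴ (hermCoord 𝕜 r y.2.2)) := fun y => by
    have h1 : iwKernel Ψ ν (S (e y)) = iwFun a Ψ (S (e y)) := rfl
    rw [h1, heS, blockAff_apply, ← iwFun_submatrix finSumFinEquiv a Ψ, Matrix.submatrix_submatrix]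
    simp [hΨ']
  have hmap : (volume.withDensity fun x => ENNReal.ofReal (iwKernel Ψ ν (S x))).map R
      = (c⁻¹ * K) • (volume : Measure (Fin N' → ℝ)).withDensity
        fun x => blockDensity r a Ψ'.toBlocks₁₁ (S' x) := by
    have hvol : (volume : Measure (Fin N → ℝ)) = c⁻¹ • μ.map e := by
      rw [hc, smul_smul, ENNReal.inv_mul_cancel hc0 hc1, one_smul]
    ext s hs
    rw [Measure.map_apply hRm hs, withDensity_apply _ (hRm hs), hvol, Measure.restrict_smul,
      lintegral_smul_measure, setLIntegral_map (hRm hs) hf hem, Measure.smul_apply,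
      withDensity_apply _ hs, smul_eq_mul, smul_eq_mul, mul_assoc]
    congr 1
    have hpre : e ⁻¹' (R ⁻¹' s) = s ×ˢ Set.univ := by
      ext y
      simp [hRe]
    have hfe : Measurable fun y => ENNReal.ofReal (iwKernel Ψ ν (S (e y))) := hf.comp hem
    rw [hpre, hμ, ← Measure.prod_restrict, Measure.restrict_univ,
      lintegral_prod _ hfe.aemeasurable, ← lintegral_const_mul _ hb]
    refine lintegral_congr fun x => ?_
    have hfx : Measurable fun y => ENNReal.ofReal (iwKernel Ψ ν (S (e (x, y)))) :=
      hfe.comp measurable_prodMk_left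
    rw [lintegral_prod _ hfx.aemeasurable, mul_comm, hK, ← lintegral_iwFun_fromBlocks]
    simp only [hval]
  have hnorm : affineIW S Set.univ Ψ ν
      = normalized (volume.withDensity fun x => ENNReal.ofReal (iwKernel Ψ ν (S x))) := by
    rw [affineIW, Measure.restrict_univ]
  rw [hnorm] at hprob
  obtain ⟨hm0, hm1⟩ := mass_of_isProbabilityMeasure_normalized hprob
  have hmass : (volume.withDensity fun x => ENNReal.ofReal (iwKernel Ψ ν (S x))) Set.univ
      = c⁻¹ * K * ((volume : Measure (Fin N' → ℝ)).withDensity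
        fun x => blockDensity r a Ψ'.toBlocks₁₁ (S' x)) Set.univ := by
    rw [← smul_eq_mul, ← Measure.smul_apply, ← hmap, Measure.map_apply hRm MeasurableSet.univ,
      Set.preimage_univ]
  rw [hmass] at hm0 hm1
  -- The full kernel has positive finite mass, and this mass is the product of the constant with the
  -- mass of the block density. So the constant, containing the integral `K`, is neither `0` nor
  -- `∞`.
  have hk0 : c⁻¹ * K ≠ 0 := left_ne_zero_of_mul hm0
  have hk1 : c⁻¹ * K ≠ ∞ := fun h => by
    rw [h, ENNReal.top_mul (right_ne_zero_of_mul hm0)] at hm1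
    exact hm1 rfl
  rw [hnorm, normalized_map hRm, hmap, normalized_smul hk0 hk1, hΨ11]

theorem measurable_blockDensity_outer {q : ℕ} (r : ℕ) (a : ℝ) (Φ : Matrix (Fin q) (Fin q) 𝕜)
    {S : (Fin N → ℝ) → Matrix (Fin q) (Fin q) 𝕜} (hS : Measurable S) :
    Measurable (Function.uncurry fun (y : Fin q → 𝕜) x =>
      blockDensity r a (outer y + Φ) (S x)) := by
  have h1 : Measurable fun y : Fin q → 𝕜 => outer y + Φ :=
    ((continuous_outer q).add continuous_const).measurable
  have h2 : Measurable fun z : (Fin q → 𝕜) × (Fin N → ℝ) => (outer z.1 + Φ, S z.2) :=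
    (h1.comp measurable_fst).prodMk (hS.comp measurable_snd)
  have h3 : Measurable fun z : (Fin q → 𝕜) × (Fin N → ℝ) => iwFun a (outer z.1 + Φ) (S z.2) :=
    (measurable_iwFun q a).comp h2
  have h4 : Measurable fun z : (Fin q → 𝕜) × (Fin N → ℝ) =>
      LinearMap.det (leftMul 𝕜 q r (S z.2)) :=
    (continuous_det_leftMul q r).measurable.comp (hS.comp measurable_snd)
  exact h3.ennreal_ofReal.mul h4.abs.ennreal_ofReal

/-- For the family of posteriors `affineIW S univ (outer y + Ψ) ν`, the law of the leading block
only depends on the leading part of `y`. -/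
theorem exists_kernel_map_affineIW {p q : ℕ} (hqp : q ≤ p)
    {S : (Fin N → ℝ) →ᵃ[ℝ] Matrix (Fin p) (Fin p) 𝕜}
    (hS : Set.BijOn S Set.univ {H | H.IsHermitian})
    {S' : (Fin N' → ℝ) →ᵃ[ℝ] Matrix (Fin q) (Fin q) 𝕜}
    (hS' : Set.BijOn S' Set.univ {H | H.IsHermitian}) {R : (Fin N → ℝ) → (Fin N' → ℝ)}
    (hRm : Measurable R)
    (hR : ∀ x, S' (R x) = (S x).submatrix (Fin.castLE hqp) (Fin.castLE hqp))
    (Ψ : Matrix (Fin p) (Fin p) 𝕜) (ν : ℝ) :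
    ∃ κ : Kernel (Fin q → 𝕜) (Fin N' → ℝ), IsFiniteKernel κ ∧ ∀ y : Fin p → 𝕜,
      IsProbabilityMeasure (affineIW S Set.univ (outer y + Ψ) ν) →
      (affineIW S Set.univ (outer y + Ψ) ν).map R = κ fun i => y (Fin.castLE hqp i) := by
  obtain ⟨r, rfl⟩ := Nat.exists_eq_add_of_le hqp
  have hf := measurable_blockDensity_outer r
    (-((Module.finrank ℝ 𝕜 : ℝ) * (ν + (q + r : ℕ) - 1) / 2 + 1))
    (Ψ.submatrix (Fin.castAdd r) (Fin.castAdd r)) (continuous_affine_matrix S').measurable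
  refine ⟨normalizedKernel volume _ hf, inferInstance, fun y hy => ?_⟩
  rw [map_affineIW_block hS hS' hRm hR _ ν hy]
  -- The leading block of `outer y + Ψ` is the outer product of the truncated vector plus the
  -- leading block of `Ψ`.
  rfl

end BlockKernel

/-! ### Compatibility of levels and transport of conditional laws. -/

section Posterior

variable {𝕜 : Type*} [RCLike 𝕜] {Ω : Type*} [MeasurableSpace Ω]

theorem not_isGaussian_affineIW_sigmaMat {ε : TDist 𝕜} {T : ℝ} {L : Discretization}
    {φ : Fin L.M → Test 𝕜} (hN : 0 < L.N) (hS : Function.Injective (sigmaMat ε T L φ))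
    (D : Set (Fin L.N → ℝ)) (Ψ : Matrix (Fin L.M) (Fin L.M) 𝕜) (ν : ℝ) :
    ¬ IsGaussian (affineIW (sigmaMat ε T L φ) D Ψ ν) := by
  have hpos := affineIW_ae_posDef (measurable_sigmaMat ε T L φ) D Ψ ν
  have hH := isHermitian_sigmaMat ε T L φ
  have hac := affineIW_absolutelyContinuous (sigmaMat ε T L φ) D Ψ ν
  rw [← coe_sigmaAff] at *
  exact not_isGaussian_of_posDef hN hS hH hac hpos

theorem affineIW_map_sigmaMat {ε : TDist 𝕜} {T : ℝ} {L : Discretization}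
    {φ : Fin L.M → Test 𝕜} (hS : Set.BijOn (sigmaMat ε T L φ) Set.univ {H | H.IsHermitian})
    (Ψ : Matrix (Fin L.M) (Fin L.M) 𝕜) (ν : ℝ) :
    (affineIW (sigmaMat ε T L φ) Set.univ Ψ ν).map (sigmaMat ε T L φ) = invWishart Ψ ν := by
  rw [← coe_sigmaAff] at *
  exact affineIW_map_eq_invWishart _ hS Ψ ν

/-- The covariance matrices of the observations at two discretization levels are compatible. -/
theorem ae_sigmaMat_eq_submatrix (P : Measure Ω) {Θ : Type*} [MeasurableSpace Θ] {θ : Ω → Θ}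
    {ε : TDist 𝕜} {T : ℝ} {z : Ω → TDist 𝕜} {L L' : Discretization} (φ : ℕ → Test 𝕜)
    (hM : L'.M ≤ L.M) {v : Ω → Fin L.N → ℝ} {v' : Ω → Fin L'.N → ℝ}
    (h : CondGaussian P θ z (fun ω => signalForm ε T L (v ω))
      (Submodule.span 𝕜 (Set.range fun i : Fin L.M => φ i)))
    (h' : CondGaussian P θ z (fun ω => signalForm ε T L' (v' ω))
      (Submodule.span 𝕜 (Set.range fun i : Fin L'.M => φ i))) :
    ∀ᵐ ω ∂P, sigmaMat ε T L' (fun i => φ i) (v' ω)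
      = (sigmaMat ε T L (fun i => φ i) (v ω)).submatrix (Fin.castLE hM) (Fin.castLE hM) := by
  obtain ⟨W, hWc, hWd⟩ := TopologicalSpace.exists_countable_dense (Fin L'.M → 𝕜)
  have hw : ∀ᵐ ω ∂P, ∀ w ∈ W, RCLike.re (w ⬝ᵥ (sigmaMat ε T L' (fun i => φ i) (v' ω) *ᵥ star w))
      = RCLike.re (w ⬝ᵥ ((sigmaMat ε T L (fun i => φ i) (v ω)).submatrix
        (Fin.castLE hM) (Fin.castLE hM) *ᵥ star w)) := by
    refine (ae_ball_iff hWc).2 fun w _ => ?_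
    have hmem' := sum_smul_mem_span (fun i : Fin L'.M => φ i) w
    have hmem : ∑ i : Fin L'.M, w i • φ i
        ∈ Submodule.span 𝕜 (Set.range fun i : Fin L.M => φ i) :=
      Submodule.sum_mem _ fun i _ => Submodule.smul_mem _ _
        (Submodule.subset_span ⟨Fin.castLE hM i, rfl⟩)
    filter_upwards [h _ hmem, h' _ hmem'] with ω h1 h2
    -- Both forms express the same conditional characteristic functional at a test function common
    -- to the two levels; injectivity of the real exponential then equates the quadratic values.
    have h3 := h2.symm.trans h1
    rw [← Complex.ofReal_exp, ← Complex.ofReal_exp] at h3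
    have h4 := Real.exp_injective (Complex.ofReal_injective h3)
    have h5 : signalForm ε T L (v ω) (∑ i : Fin L'.M, w i • φ i) (∑ i : Fin L'.M, w i • φ i)
        = w ⬝ᵥ ((sigmaMat ε T L (fun i => φ i) (v ω)).submatrix
          (Fin.castLE hM) (Fin.castLE hM) *ᵥ star w) := by
      rw [signalForm_sum_sum]
      simp only [dotProduct, Matrix.mulVec, sigmaMat, Matrix.of_apply, Matrix.submatrix_apply,
        Finset.mul_sum, Pi.star_apply, RCLike.star_def, Fin.val_castLE]
      refine Finset.sum_congr rfl fun i _ => Finset.sum_congr rfl fun k _ => ?_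
      ring
    rw [signalForm_span, h5] at h4
    linarith
  filter_upwards [hw] with ω hω
  refine sub_eq_zero.1 (eq_zero_of_dense_quadratic
    ((isHermitian_sigmaMat ε T L' _ _).sub ((isHermitian_sigmaMat ε T L _ _).submatrix _)) hWd
    fun w hwW => ?_)
  rw [Matrix.sub_mulVec, dotProduct_sub, map_sub, hω w hwW, sub_self]

theorem condDistrib_comp_left {E F G : Type*} [MeasurableSpace E] [MeasurableSpace F]
    [StandardBorelSpace F] [Nonempty F] [MeasurableSpace G] [StandardBorelSpace G] [Nonempty G]
    (P : Measure Ω) [IsFiniteMeasure P] {Y : Ω → E} {V : Ω → F} (hY : Measurable Y)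
    (hV : Measurable V) {f : F → G} (hf : Measurable f) :
    ∀ᵐ ω ∂P, condDistrib (fun ω => f (V ω)) Y P (Y ω) = (condDistrib V Y P (Y ω)).map f := by
  filter_upwards [ae_of_ae_map hY.aemeasurable (condDistrib_comp Y hV.aemeasurable hf)] with ω hω
  rw [← Kernel.map_apply _ hf]
  exact hω

/-- An almost sure property of a random variable holds almost surely under its conditional law. -/
theorem ae_ae_condDistrib {E F : Type*} [MeasurableSpace E] [MeasurableSpace F]
    [StandardBorelSpace F] [Nonempty F] (P : Measure Ω) [IsFiniteMeasure P] {Y : Ω → E}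
    {V : Ω → F} (hY : Measurable Y) (hV : Measurable V) {p : F → Prop} (h : ∀ᵐ ω ∂P, p (V ω))
    (hp : MeasurableSet {x | p x}) :
    ∀ᵐ ω ∂P, ∀ᵐ x ∂(condDistrib V Y P (Y ω)), p x := by
  have h1 : ∀ᵐ x ∂(P.map V), p x := (ae_map_iff hV.aemeasurable hp).2 h
  rw [← condDistrib_comp_map hY.aemeasurable hV.aemeasurable] at h1
  exact ae_of_ae_map hY.aemeasurable (Measure.ae_ae_of_ae_comp h1)

end Posterior

/-! ### Passing from a fine to a coarse level. -/

section Levels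

variable {𝕜 : Type*} [RCLike 𝕜] {Ω : Type*} [MeasurableSpace Ω]

/-- The parameters at a coarse level are an affine function of those at a fine level. -/
theorem exists_affine_of_submatrix {ε : TDist 𝕜} {T : ℝ} {L L' : Discretization} (φ : ℕ → Test 𝕜)
    (hM : L'.M ≤ L.M)
    (hS' : Function.Injective (sigmaMat ε T L' fun i => φ i)) :
    ∃ R : (Fin L.N → ℝ) →ᵃ[ℝ] (Fin L'.N → ℝ), ∀ x y, sigmaMat ε T L' (fun i => φ i) y
      = (sigmaMat ε T L (fun i => φ i) x).submatrix (Fin.castLE hM) (Fin.castLE hM) → R x = y := by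
  rw [← coe_sigmaAff] at hS'
  obtain ⟨R, hR⟩ := exists_affine_leftInverse hS'
  let B : Matrix (Fin L.M) (Fin L.M) 𝕜 →ₗ[ℝ] Matrix (Fin L'.M) (Fin L'.M) 𝕜 :=
    { toFun := fun A => A.submatrix (Fin.castLE hM) (Fin.castLE hM)
      map_add' := fun _ _ => rfl
      map_smul' := fun _ _ => rfl }
  refine ⟨(R.comp B.toAffineMap).comp (sigmaAff ε T L fun i => φ i), fun x y h => ?_⟩
  rw [← coe_sigmaAff, ← coe_sigmaAff] at h
  show R ((sigmaAff ε T L (fun i => φ i) x).submatrix (Fin.castLE hM) (Fin.castLE hM)) = y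
  rw [← h, hR]

variable (P : Measure Ω) [IsProbabilityMeasure P] {ε : TDist 𝕜} {T : ℝ} {z : Ω → TDist 𝕜}
  {L L' : Discretization} (φ : ℕ → Test 𝕜)

/-- The image of the fine level posterior is the posterior of the coarse level parameters given
the fine level observations. -/
theorem ae_affineIW_map_eq_condDistrib (hz : Measurable z) {v : Ω → Fin L.N → ℝ}
    {v' : Ω → Fin L'.N → ℝ} (hv : Measurable v) {R : (Fin L.N → ℝ) →ᵃ[ℝ] (Fin L'.N → ℝ)}
    (hR : ∀ᵐ ω ∂P, R (v ω) = v' ω) (D : Set (Fin L.N → ℝ))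
    (Ψ : Matrix (Fin L.M) (Fin L.M) 𝕜) (ν : ℝ)
    (hpost : ∀ᵐ ω ∂P, condDistrib v (obs z fun i : Fin L.M => φ i) P
      (obs z (fun i : Fin L.M => φ i) ω) = affineIW (sigmaMat ε T L fun i => φ i) D
        (outer (obs z (fun i : Fin L.M => φ i) ω) + Ψ) ν) :
    ∀ᵐ ω ∂P, (affineIW (sigmaMat ε T L fun i => φ i) D
        (outer (obs z (fun i : Fin L.M => φ i) ω) + Ψ) ν).map R
      = condDistrib v' (obs z fun i : Fin L.M => φ i) P (obs z (fun i : Fin L.M => φ i) ω) := by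
  have hRm : Measurable R := (AffineMap.continuous_of_finiteDimensional R).measurable
  filter_upwards [hpost, condDistrib_comp_left P (measurable_obs hz fun i : Fin L.M => φ i) hv hRm]
    with ω h1 h2
  rw [← h1, ← h2, condDistrib_congr_left hR]

/-- In the bijective case, the fine level observations carry no more information about the coarse
level parameters than the coarse level observations. -/
theorem ae_condDistrib_fine_eq_coarse (hz : Measurable z) (hM : L'.M ≤ L.M)
    {v : Ω → Fin L.N → ℝ} {v' : Ω → Fin L'.N → ℝ} (hv : Measurable v) (hv' : Measurable v')
    (hS : Set.BijOn (sigmaMat ε T L fun i => φ i) Set.univ {H | H.IsHermitian})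
    (hS' : Set.BijOn (sigmaMat ε T L' fun i => φ i) Set.univ {H | H.IsHermitian})
    (hcomp : ∀ᵐ ω ∂P, sigmaMat ε T L' (fun i => φ i) (v' ω)
      = (sigmaMat ε T L (fun i => φ i) (v ω)).submatrix (Fin.castLE hM) (Fin.castLE hM))
    (Ψ : Matrix (Fin L.M) (Fin L.M) 𝕜) (ν : ℝ)
    (hpost : ∀ᵐ ω ∂P, condDistrib v (obs z fun i : Fin L.M => φ i) P
      (obs z (fun i : Fin L.M => φ i) ω) = affineIW (sigmaMat ε T L fun i => φ i) Set.univ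
        (outer (obs z (fun i : Fin L.M => φ i) ω) + Ψ) ν) :
    ∀ᵐ ω ∂P, condDistrib v' (obs z fun i : Fin L.M => φ i) P (obs z (fun i : Fin L.M => φ i) ω)
      = condDistrib v' (obs z fun i : Fin L'.M => φ i) P
        (obs z (fun i : Fin L'.M => φ i) ω) := by
  obtain ⟨R, hR⟩ := exists_affine_of_submatrix (L := L) φ hM (Set.injOn_univ.1 hS'.injOn)
  have hRm : Measurable R := (AffineMap.continuous_of_finiteDimensional R).measurable
  -- Surjectivity of the coarse map makes the block relation hold for every parameter vector, not
  -- only almost surely along `v`.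
  have hRS : ∀ x, sigmaMat ε T L' (fun i => φ i) (R x)
      = (sigmaMat ε T L (fun i => φ i) x).submatrix (Fin.castLE hM) (Fin.castLE hM) := fun x => by
    obtain ⟨y, -, hy⟩ := hS'.surjOn
      ((isHermitian_sigmaMat ε T L (fun i => φ i) x).submatrix (Fin.castLE hM))
    rw [hR x y hy, hy]
  have hRv : ∀ᵐ ω ∂P, R (v ω) = v' ω := hcomp.mono fun ω hω => hR _ _ hω
  have hmap := ae_affineIW_map_eq_condDistrib P φ hz hv hRv Set.univ Ψ ν hpost
  obtain ⟨κ, hκ, hκR⟩ : ∃ κ : Kernel (Fin L'.M → 𝕜) (Fin L'.N → ℝ), IsFiniteKernel κ ∧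
      ∀ y : Fin L.M → 𝕜, IsProbabilityMeasure
        (affineIW (sigmaMat ε T L fun i => φ i) Set.univ (outer y + Ψ) ν) →
      (affineIW (sigmaMat ε T L fun i => φ i) Set.univ (outer y + Ψ) ν).map R
        = κ fun i => y (Fin.castLE hM i) := by
    simp only [← coe_sigmaAff] at hS hS' hRS ⊢
    exact exists_kernel_map_affineIW hM hS hS' hRm hRS Ψ ν
  have hg : Measurable fun (y : Fin L.M → 𝕜) i => y (Fin.castLE hM i) :=
    measurable_pi_iff.2 fun i => measurable_pi_apply _
  have hκY : ∀ᵐ ω ∂P, condDistrib v' (obs z fun i : Fin L.M => φ i) P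
      (obs z (fun i : Fin L.M => φ i) ω) = κ (obs z (fun i : Fin L'.M => φ i) ω) := by
    filter_upwards [hmap, hpost] with ω h1 h2
    rw [← h1]
    refine hκR _ ?_
    rw [← h2]
    infer_instance
  filter_upwards [hκY, condDistrib_comp_of_ae_eq P (measurable_obs hz fun i : Fin L.M => φ i) hv' hg
    κ hκY] with ω h1 h2
  rw [h1]
  exact h2.symm

end Levels

/-! ### Marginals of the posterior given the whole signal. -/

section Family

variable {𝕜 : Type*} [RCLike 𝕜] {Ω : Type*} [MeasurableSpace Ω]

theorem ae_condDistrib_marginal (P : Measure Ω) [IsProbabilityMeasure P] {z : Ω → TDist 𝕜}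
    (hz : Measurable z) {N : ℕ → ℕ} {v : Ω → (n : ℕ) → Fin (N n) → ℝ} (hv : Measurable v) (k : ℕ) :
    ∀ᵐ ω ∂P, (condDistrib v z P (z ω)).map (fun w => w k)
      = condDistrib (fun ω => v ω k) z P (z ω) := by
  filter_upwards [condDistrib_comp_left P hz hv (measurable_pi_apply k)] with ω hω
  exact hω.symm

/-- For `p > 0` the matrices `0` and `1` are distinct and Hermitian, so a one-point parameter space
is too small. -/
theorem pos_of_bijOn_isHermitian {p N : ℕ} (hp : 0 < p)
    {S : (Fin N → ℝ) → Matrix (Fin p) (Fin p) 𝕜}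
    (hS : Set.BijOn S Set.univ {H | H.IsHermitian}) : 0 < N := by
  rcases Nat.eq_zero_or_pos N with rfl | h
  · obtain ⟨x, -, hx⟩ := hS.surjOn (Matrix.isHermitian_zero (n := Fin p) (α := 𝕜))
    obtain ⟨y, -, hy⟩ := hS.surjOn (Matrix.isHermitian_one (n := Fin p) (α := 𝕜))
    have h01 : (0 : Matrix (Fin p) (Fin p) 𝕜) = 1 := by
      rw [← hx, ← hy, Subsingleton.elim x y]
    have := congrFun (congrFun h01 ⟨0, hp⟩) ⟨0, hp⟩
    simp at this
  · exact h

open scoped ComplexOrder in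
/-- Since the covariance matrix is positive definite, a Gaussian posterior is a point mass. -/
theorem ae_eq_dirac_of_isGaussian_condDistrib (P : Measure Ω) [IsProbabilityMeasure P]
    {z : Ω → TDist 𝕜} (hz : Measurable z) {ε : TDist 𝕜} {T : ℝ} {L : Discretization}
    {φ : Fin L.M → Test 𝕜} {v : Ω → Fin L.N → ℝ} (hv : Measurable v)
    (hS : Function.Injective (sigmaMat ε T L φ)) {D : Set (Fin L.N → ℝ)}
    {Ψ : Matrix (Fin L.M) (Fin L.M) 𝕜} {ν : ℝ}
    (hprior : P.map v = affineIW (sigmaMat ε T L φ) D Ψ ν) :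
    ∀ᵐ ω ∂P, IsGaussian (condDistrib v z P (z ω)) →
      ∃ x, condDistrib v z P (z ω) = Measure.dirac x := by
  have hm := measurable_sigmaMat ε T L φ
  have hpos : ∀ᵐ ω ∂P, (sigmaMat ε T L φ (v ω)).PosDef := by
    refine ae_of_ae_map (p := fun x => (sigmaMat ε T L φ x).PosDef) hv.aemeasurable ?_
    rw [hprior]
    exact affineIW_ae_posDef hm _ _ _
  filter_upwards [ae_ae_condDistrib P hz hv hpos (hm (measurableSet_posDef _))] with ω h hG
  have hH := isHermitian_sigmaMat ε T L φ
  simp only [← coe_sigmaAff] at h hH hS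
  exact isGaussian_eq_dirac_of_posDef hS hH hG h

end Family

end Radar

/-! ### The theorem. -/

theorem theorem3p1 {𝕜 : Type*} [RCLike 𝕜] {Ω : Type*} [MeasurableSpace Ω]
    (P : Measure Ω) [IsProbabilityMeasure P]
    (ε : TDist 𝕜) (T : ℝ) (hT : 0 ≤ T) (z : Ω → TDist 𝕜) (hz : Measurable z) :
    -- in the hierarchical model the signal is conditionally Gaussian given the parameters
    (∀ (Θ : Type) [MeasurableSpace Θ] (θ : Ω → Θ) (L : Discretization)
        (v : Θ → Fin L.N → ℝ) (U : Set (Test 𝕜)) (μ ξ : Ω → TDist 𝕜),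
      Measurable θ → Measurable v → IsHierarchical P θ ε T L v U μ ξ z →
      CondGaussian P θ z (fun ω => signalForm ε T L (v (θ ω))) U) ∧
    -- posterior given a finite-dimensional marginal of the signal
    (∀ (L : Discretization) (φ : Fin L.M → Test 𝕜) (v : Ω → Fin L.N → ℝ)
        (D : Set (Fin L.N → ℝ)) (Ψ : Matrix (Fin L.M) (Fin L.M) 𝕜) (ν : ℝ),
      Measurable v → MeasurableSet D → Admissible Ψ ν →
      CondGaussian P v z (fun ω => signalForm ε T L (v ω)) (Submodule.span 𝕜 (Set.range φ)) →
      P.map v = affineIW (sigmaMat ε T L φ) D Ψ ν →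
      (∀ᵐ ω ∂P, condDistrib v (obs z φ) P (obs z φ ω) =
        affineIW (sigmaMat ε T L φ) D (outer (obs z φ ω) + Ψ) (ν + 1)) ∧
      (0 < L.N → Function.Injective (sigmaMat ε T L φ) →
        ∀ᵐ ω ∂P, ¬ IsGaussian (condDistrib v (obs z φ) P (obs z φ ω))) ∧
      (D = Set.univ → Set.BijOn (sigmaMat ε T L φ) Set.univ {H | H.IsHermitian} →
        P.map (fun ω => sigmaMat ε T L φ (v ω)) = invWishart Ψ ν ∧
        ∀ᵐ ω ∂P, (condDistrib v (obs z φ) P (obs z φ ω)).map (sigmaMat ε T L φ) =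
          invWishart (outer (obs z φ ω) + Ψ) (ν + 1))) ∧
    -- posterior given the whole signal, for a prior given by a consistent family
    (∀ (L : ℕ → Discretization) (φ : ℕ → Test 𝕜) (v : Ω → (n : ℕ) → Fin (L n).N → ℝ)
        (D : (n : ℕ) → Set (Fin (L n).N → ℝ))
        (Ψ : (n : ℕ) → Matrix (Fin (L n).M) (Fin (L n).M) 𝕜) (ν : ℕ → ℝ)
        (S : (n : ℕ) → (Fin (L n).N → ℝ) → Matrix (Fin (L n).M) (Fin (L n).M) 𝕜)
        (Y : (n : ℕ) → Ω → Fin (L n).M → 𝕜),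
      (∀ n, S n = sigmaMat ε T (L n) (fun i => φ i)) →
      (∀ n, Y n = obs z (fun i : Fin (L n).M => φ i)) →
      Measurable v → (∀ n, MeasurableSet (D n)) → (∀ n, Admissible (Ψ n) (ν n)) →
      Monotone (fun n => (L n).M) → Tendsto (fun n => (L n).M) atTop atTop → Total φ →
      (∀ n, Function.Injective (S n)) →
      (∀ n, CondGaussian P v z (fun ω => signalForm ε T (L n) (v ω n))
        (Submodule.span 𝕜 (Set.range fun i : Fin (L n).M => φ i))) →
      (∀ n, P.map (fun ω => v ω n) = affineIW (S n) (D n) (Ψ n) (ν n)) →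
      (∀ n, ∀ᵐ ω ∂P, condDistrib (fun ω => v ω n) (Y n) P (Y n ω) =
        affineIW (S n) (D n) (outer (Y n ω) + Ψ n) (ν n + 1)) ∧
      (∀ k, ∃ R : (n : ℕ) → (Fin (L n).N → ℝ) →ᵃ[ℝ] (Fin (L k).N → ℝ),
        (∀ n, k ≤ n → ∀ᵐ ω ∂P, R n (v ω n) = v ω k) ∧
        ∀ᵐ ω ∂P, ∀ f : BoundedContinuousFunction (Fin (L k).N → ℝ) ℝ,
          Tendsto (fun n => ∫ x, f x ∂((affineIW (S n) (D n) (outer (Y n ω) + Ψ n)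
              (ν n + 1)).map (R n))) atTop
            (𝓝 (∫ x, f x ∂((condDistrib v z P (z ω)).map fun w => w k)))) ∧
      (∀ k, ∀ᵐ ω ∂P, IsGaussian ((condDistrib v z P (z ω)).map fun w => w k) →
        ∃ x, (condDistrib v z P (z ω)).map (fun w => w k) = Measure.dirac x) ∧
      ((∀ n, D n = Set.univ ∧ Set.BijOn (S n) Set.univ {H | H.IsHermitian}) →
        (∀ k, ∀ᵐ ω ∂P, (condDistrib v z P (z ω)).map (fun w => w k) =
          affineIW (S k) Set.univ (outer (Y k ω) + Ψ k) (ν k + 1)) ∧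
        ∀ᵐ ω ∂P, ¬ IsGaussian (condDistrib v z P (z ω)))) := by
  refine ⟨fun Θ _ θ L v U μ ξ hθ hv h => h.condGaussian P hT hz hθ hv, ?_, ?_⟩
  · intro L φ v D Ψ ν hv _ _ h hprior
    have hpost := condDistrib_obs_of_affineIW_prior P hz L φ D Ψ ν hv h hprior
    refine ⟨hpost, fun hN hinj => ?_, ?_⟩
    · filter_upwards [hpost] with ω hω
      rw [hω]
      exact not_isGaussian_affineIW_sigmaMat hN hinj _ _ _
    · rintro rfl hS
      refine ⟨?_, ?_⟩
      · rw [← affineIW_map_sigmaMat hS, ← hprior, Measure.map_map (measurable_sigmaMat ε T L φ) hv]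
        rfl
      · filter_upwards [hpost] with ω hω
        rw [hω, affineIW_map_sigmaMat hS]
  · intro L φ v D Ψ ν S Y hSeq hYeq hv _ _ hmono htend htot hinj hcg hprior
    obtain rfl : S = fun n => sigmaMat ε T (L n) fun i => φ i := funext hSeq
    obtain rfl : Y = fun n => obs z fun i : Fin (L n).M => φ i := funext hYeq
    have hvk : ∀ k, Measurable fun ω => v ω k := fun k => (measurable_pi_apply k).comp hv
    have hY : ∀ n, Measurable (obs z fun i : Fin (L n).M => φ i) := fun n => measurable_obs hz _
    have hpost : ∀ n, ∀ᵐ ω ∂P,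
        condDistrib (fun ω => v ω n) (obs z fun i : Fin (L n).M => φ i) P
          (obs z (fun i : Fin (L n).M => φ i) ω) =
        affineIW (sigmaMat ε T (L n) fun i => φ i) (D n)
          (outer (obs z (fun i : Fin (L n).M => φ i) ω) + Ψ n) (ν n + 1) := fun n =>
      condDistrib_obs_of_affineIW_prior P hz (L n) _ (D n) (Ψ n) (ν n) (hvk n)
        -- The model conditions on the whole family `v`; its form at level `n` depends only on the
        -- `n`-th component.
        (CondGaussian.comp P hv (measurable_pi_apply n)
          (Q := fun t => signalForm ε T (L n) t)
          (fun φ _ => (continuous_signalForm ε T (L n) φ φ).measurable) (hcg n)) (hprior n)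
    have hcomp : ∀ {k n} (h : k ≤ n), ∀ᵐ ω ∂P, sigmaMat ε T (L k) (fun i => φ i) (v ω k)
        = (sigmaMat ε T (L n) (fun i => φ i) (v ω n)).submatrix (Fin.castLE (hmono h))
          (Fin.castLE (hmono h)) := fun {k n} h =>
      ae_sigmaMat_eq_submatrix P φ (hmono h) (hcg n) (hcg k)
    have hlim : ∀ k, ∀ᵐ ω ∂P, ∀ f : BoundedContinuousFunction (Fin (L k).N → ℝ) ℝ,
        Tendsto (fun n => ∫ x, f x ∂(condDistrib (fun ω => v ω k)
          (obs z fun i : Fin (L n).M => φ i) P (obs z (fun i : Fin (L n).M => φ i) ω))) atTop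
          (𝓝 (∫ x, f x ∂(condDistrib (fun ω => v ω k) z P (z ω)))) := fun k =>
      ae_tendsto_integral_condDistrib P (hvk k) hz hY (fun _ _ h => comap_obs_mono φ (hmono h))
        (comap_eq_iSup_comap_obs htot htend)
    have hmarg := ae_condDistrib_marginal P hz hv
    refine ⟨hpost, fun k => ?_, fun k => ?_, fun hbij => ?_⟩
    · have hex : ∀ n, ∃ R : (Fin (L n).N → ℝ) →ᵃ[ℝ] (Fin (L k).N → ℝ),
          k ≤ n → ∀ᵐ ω ∂P, R (v ω n) = v ω k := fun n => by
        by_cases h : k ≤ n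
        · obtain ⟨R, hR⟩ := exists_affine_of_submatrix (L := L n) φ (hmono h) (hinj k)
          exact ⟨R, fun _ => (hcomp h).mono fun ω hω => hR _ _ hω⟩
        -- Levels below `k` do not affect the limit, so any map serves there.
        · exact ⟨AffineMap.const ℝ _ 0, fun h' => absurd h' h⟩
      choose R hR using hex
      refine ⟨R, hR, ?_⟩
      have hmap : ∀ᵐ ω ∂P, ∀ n, k ≤ n → (affineIW (sigmaMat ε T (L n) fun i => φ i) (D n)
          (outer (obs z (fun i : Fin (L n).M => φ i) ω) + Ψ n) (ν n + 1)).map (R n)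
          = condDistrib (fun ω => v ω k) (obs z fun i : Fin (L n).M => φ i) P
            (obs z (fun i : Fin (L n).M => φ i) ω) := by
        refine ae_all_iff.2 fun n => ?_
        by_cases h : k ≤ n
        · exact (ae_affineIW_map_eq_condDistrib P φ hz (hvk n) (hR n h) _ _ _ (hpost n)).mono
            fun ω hω _ => hω
        · exact Eventually.of_forall fun ω h' => absurd h' h
      filter_upwards [hmap, hlim k, hmarg k] with ω h1 h2 h3 f
      rw [h3]
      refine (h2 f).congr' ?_
      filter_upwards [eventually_ge_atTop k] with n hn
      rw [h1 n hn]
    · filter_upwards [hmarg k,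
        ae_eq_dirac_of_isGaussian_condDistrib P hz (hvk k) (hinj k) (hprior k)] with ω h1 h2
      rw [h1]
      exact h2
    · have hk : ∀ k, ∀ᵐ ω ∂P, (condDistrib v z P (z ω)).map (fun w => w k)
          = affineIW (sigmaMat ε T (L k) fun i => φ i) Set.univ
            (outer (obs z (fun i : Fin (L k).M => φ i) ω) + Ψ k) (ν k + 1) := fun k => by
        have hpost' := fun n => (hbij n).1 ▸ hpost n
        have hconst : ∀ᵐ ω ∂P, ∀ n, k ≤ n →
            condDistrib (fun ω => v ω k) (obs z fun i : Fin (L n).M => φ i) P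
              (obs z (fun i : Fin (L n).M => φ i) ω)
            = condDistrib (fun ω => v ω k) (obs z fun i : Fin (L k).M => φ i) P
              (obs z (fun i : Fin (L k).M => φ i) ω) := by
          refine ae_all_iff.2 fun n => ?_
          by_cases h : k ≤ n
          · exact (ae_condDistrib_fine_eq_coarse P φ hz (hmono h) (hvk n) (hvk k) (hbij n).2
              (hbij k).2 (hcomp h) _ _ (hpost' n)).mono fun ω hω _ => hω
          · exact Eventually.of_forall fun ω h' => absurd h' h
        filter_upwards [hconst, hlim k, hmarg k, hpost' k] with ω h1 h2 h3 h4
        rw [h3, ← h4]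
        refine ext_of_forall_integral_eq_of_IsFiniteMeasure fun f => ?_
        -- For `n ≥ k` the integrals against the conditional laws do not change with `n`, so the
        -- weak limit is their common value.
        refine tendsto_nhds_unique (h2 f) (tendsto_const_nhds.congr' ?_)
        filter_upwards [eventually_ge_atTop k] with n hn
        rw [h1 n hn]
      refine ⟨hk, ?_⟩
      -- A Gaussian law of the whole family would have Gaussian marginals. One level with a test
      -- function has a parameter as well, and there the marginal has a Lebesgue density.
      obtain ⟨k, hMk⟩ := (htend.eventually (eventually_gt_atTop 0)).exists
      filter_upwards [hk k] with ω hω hG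
      refine not_isGaussian_affineIW_sigmaMat (pos_of_bijOn_isHermitian hMk (hbij k).2)
        (hinj k) Set.univ (outer (obs z (fun i : Fin (L k).M => φ i) ω) + Ψ k) (ν k + 1) ?_
      rw [← hω]
      exact isGaussian_map_of_measurable
        (L := ContinuousLinearMap.proj (R := ℝ) (φ := fun n => Fin (L n).N → ℝ) k)
        (measurable_pi_apply k)
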